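/- Let $F_2$ be the free group with basis $\Sigma=\{a,b\}$. Automorphisms are composed from right to left. An automorphism of $F_2$ is of type (W1) if it permutes $\Sigma^{\pm1}=\{a,b,a^{-1},b^{-1}\}$. Let $\sigma,\tau$ be the automorphisms given by $\sigma(a)=ab,\ \sigma(b)=b$ and $\tau(a)=a,\ \tau(b)=ba$, and let $\delta_1,\dots,\delta_4$ be the automorphisms given by $$\delta_1: a\mapsto b^{-1}ab,\ b\mapsto b;\quad \delta_2: a\mapsto bab^{-1},\ b\mapsto b;\quad \delta_3: a\mapsto a,\ b\mapsto a^{-1}ba;\quad \delta_4: a\mapsto a,\ b\mapsto aba^{-1}.$$ A chain of type (C1) is an automorphism $\tau^{m_k}\sigma^{l_k}\cdots\tau^{m_1}\sigma^{l_1}$, and a chain of type (C2) is an automorphism $\tau^{-m_k}\sigma^{-l_k}\cdots\tau^{-m_1}\sigma^{-l_1}$, with all $l_i,m_i\ge 0$; its length is $\sum_{i}(m_i+l_i)$. A subgroup $H\le F_2$ is the fixed point group of an automorphism $\phi$ if $H=\{g\in F_2:\phi(g)=g\}$. For a finitely generated subgroup $H=\langle u_1,\dots,u_k\rangle$ of $F_2$,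 given with these generators, put $|H|=\max_{i}|u_i|$, where $|u_i|$ is the length of the reduced word $u_i$ (and $|H|=0$ if $k=0$). **Theorem.** (1) Let $H=\langle u_1,\dots,u_k\rangle$ be a finitely generated subgroup of $F_2$ that is the fixed point group of some automorphism of $F_2$. Then $H$ is the fixed point group of an automorphism of the form $\psi=\beta\delta'\psi'$, where $\beta$ is of type (W1), $\delta'$ is a composition of at most $(2^{4|H|+4}+1)\,|H|$ of the $\delta_i$ (repetitions allowed, the empty composition being the identity), and $\psi'$ is a chain of type (C1) or (C2) of length at most $4|H|+4$. (2) There is an algorithm which, given a finite list of words in $\Sigma^{\pm1}$, decides whether the subgroup of $F_2$ generated by them is the fixed point group of some automorphism of $F_2$. -/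

import Mathlib

/-- The free group `F_2`, with basis `a = FreeGroup.of 0`, `b = FreeGroup.of 1`. -/
abbrev F2 : Type := FreeGroup (Fin 2)

/-- A letter of `Σ^{±1}`: `(i, true)` is the `i`-th basis element, `(i, false)` its inverse. -/
abbrev Letter : Type := Fin 2 × Bool

/-- The inverse letter. -/
def Letter.inv (x : Letter) : Letter := (x.1, !x.2)

/-- A letter as an element of `F_2`. -/
def Letter.elt (x : Letter) : F2 := FreeGroup.mk [x]

/-- The endomorphism of `F_2` that sends each basis element `c` to `x^{-ε} c x^{η}`, where
`ε = 1` if `c⁻¹ ∈ S` and `ε = 0` otherwise, and `η = 1` if `c ∈ S` and `η = 0` otherwise. -/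
def whiteheadHom (S : Finset Letter) (x : Letter) : F2 →* F2 :=
  FreeGroup.lift fun i =>
    (if (i, false) ∈ S then x.elt⁻¹ else 1) * FreeGroup.of i * (if (i, true) ∈ S then x.elt else 1)

theorem Letter.elt_inv (x : Letter) : x.inv.elt = x.elt⁻¹ := by
  simp [Letter.elt, Letter.inv, FreeGroup.invRev]

theorem Letter.inv_inv (x : Letter) : x.inv.inv = x := by
  simp [Letter.inv]

theorem whiteheadHom_elt (S : Finset Letter) (x y : Letter) (h₁ : y ∉ S) (h₂ : y.inv ∉ S) :
    whiteheadHom S x y.elt = y.elt := by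
  obtain ⟨i, e⟩ := y
  cases e
  · have h : Letter.elt (i, false) = (FreeGroup.of i)⁻¹ := by
      simp [Letter.elt, FreeGroup.of, FreeGroup.invRev]
    simp only [Letter.inv, Bool.not_false] at h₂
    simp [h, whiteheadHom, h₁, h₂]
  · have h : Letter.elt (i, true) = FreeGroup.of i := rfl
    simp only [Letter.inv, Bool.not_true] at h₂
    simp [h, whiteheadHom, h₁, h₂]

theorem whiteheadHom_comp (S : Finset Letter) (x : Letter) (h₁ : x ∉ S) (h₂ : x.inv ∉ S) :
    (whiteheadHom S x).comp (whiteheadHom S x.inv) = MonoidHom.id F2 := by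
  have hx := whiteheadHom_elt S x x h₁ h₂
  ext i
  have h : whiteheadHom S x.inv (FreeGroup.of i) =
      (if (i, false) ∈ S then x.elt else 1) * FreeGroup.of i *
        (if (i, true) ∈ S then x.elt⁻¹ else 1) := by
    simp [whiteheadHom, Letter.elt_inv]
  have h' : whiteheadHom S x (FreeGroup.of i) =
      (if (i, false) ∈ S then x.elt⁻¹ else 1) * FreeGroup.of i *
        (if (i, true) ∈ S then x.elt else 1) := by
    simp [whiteheadHom]
  rw [MonoidHom.comp_apply, h, map_mul, map_mul, h']
  split_ifs <;> simp [hx, mul_assoc]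

/-- The Whitehead automorphism `(S, x)` of type (W2), for `S ⊆ Σ^{±1} \ {x, x⁻¹}`. -/
def whitehead (S : Finset Letter) (x : Letter) (h₁ : x ∉ S) (h₂ : x.inv ∉ S) : MulAut F2 :=
  MonoidHom.toMulEquiv (whiteheadHom S x) (whiteheadHom S x.inv)
    (by simpa [Letter.inv_inv] using
      whiteheadHom_comp S x.inv h₂ (by simpa [Letter.inv_inv] using h₁))
    (whiteheadHom_comp S x h₁ h₂)

/-- The defining clauses of a type (W2) automorphism. -/
theorem whitehead_apply (S : Finset Letter) (x : Letter) (h₁ : x ∉ S) (h₂ : x.inv ∉ S)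
    (c : Letter) :
    (c ∈ S → c.inv ∉ S → whitehead S x h₁ h₂ c.elt = c.elt * x.elt) ∧
    (c ∈ S → c.inv ∈ S → whitehead S x h₁ h₂ c.elt = x.elt⁻¹ * c.elt * x.elt) ∧
    (c ∉ S → c.inv ∉ S → whitehead S x h₁ h₂ c.elt = c.elt) := by
  have key : ∀ g, whitehead S x h₁ h₂ g = whiteheadHom S x g := fun _ => rfl
  obtain ⟨i, e⟩ := c
  have hf : Letter.elt (i, false) = (FreeGroup.of i)⁻¹ := by
    simp [Letter.elt, FreeGroup.of, FreeGroup.invRev]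
  have ht : Letter.elt (i, true) = FreeGroup.of i := rfl
  refine ⟨fun p q => ?_, fun p q => ?_, fun p q => ?_⟩ <;> rw [key] <;> cases e <;>
    simp only [Letter.inv, Bool.not_false, Bool.not_true] at q <;>
    simp [hf, ht, whiteheadHom, p, q, mul_assoc]

/-- The Whitehead automorphisms of type (W1): those that permute `Σ^{±1}`. -/
def IsTypeW1 (β : MulAut F2) : Prop :=
  β '' Set.range Letter.elt = Set.range Letter.elt

/-- The automorphism `σ = ({a}, b)`, that is, `a ↦ ab`, `b ↦ b`. -/
def sigma : MulAut F2 := whitehead {(0, true)} (1, true) (by decide) (by decide)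

/-- The automorphism `τ = ({b}, a)`, that is, `a ↦ a`, `b ↦ ba`. -/
def tau : MulAut F2 := whitehead {(1, true)} (0, true) (by decide) (by decide)

/-- `δ_1 = ({a^{±1}}, b)`, `δ_2 = ({a^{±1}}, b⁻¹)`, `δ_3 = ({b^{±1}}, a)`,
`δ_4 = ({b^{±1}}, a⁻¹)`, indexed from `0`. -/
def delta : Fin 4 → MulAut F2
  | 0 => whitehead {(0, true), (0, false)} (1, true) (by decide) (by decide)
  | 1 => whitehead {(0, true), (0, false)} (1, false) (by decide) (by decide)
  | 2 => whitehead {(1, true), (1, false)} (0, true) (by decide) (by decide)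
  | 3 => whitehead {(1, true), (1, false)} (0, false) (by decide) (by decide)

/-- For the list of exponents `[(l_1, m_1), …, (l_k, m_k)]`, the chain
`τ^{m_k} σ^{l_k} ⋯ τ^{m_1} σ^{l_1}` of type (C1); the rightmost factor acts first. -/
def chainC1 : List (ℕ × ℕ) → MulAut F2
  | [] => 1
  | (l, m) :: t => chainC1 t * (tau ^ m * sigma ^ l)

/-- For the list of exponents `[(l_1, m_1), …, (l_k, m_k)]`, the chain
`τ^{-m_k} σ^{-l_k} ⋯ τ^{-m_1} σ^{-l_1}` of type (C2). -/
def chainC2 : List (ℕ × ℕ) → MulAut F2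
  | [] => 1
  | (l, m) :: t => chainC2 t * (tau⁻¹ ^ m * sigma⁻¹ ^ l)

/-- The length `∑ (m_i + l_i)` of a chain. -/
def chainLength (e : List (ℕ × ℕ)) : ℕ := (e.map fun p => p.2 + p.1).sum

/-- The chains of type (C1) or (C2) of length at most `N`. -/
def chainsUpTo (N : ℕ) : Set (MulAut F2) :=
  {φ | ∃ e : List (ℕ × ℕ), chainLength e ≤ N ∧ (φ = chainC1 e ∨ φ = chainC2 e)}

/-- The compositions of at most `N` of the `δ_i` (repetitions allowed). -/
def deltaCompositionsUpTo (N : ℕ) : Set (MulAut F2) :=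
  {φ | ∃ w : List (Fin 4), w.length ≤ N ∧ φ = (w.map delta).prod}

/-- The set `Ω` of all `β δ' ψ'`, as a function of `h = |H|`. -/
def Omega (h : ℕ) : Set (MulAut F2) :=
  {ψ | ∃ β δ' ψ' : MulAut F2, IsTypeW1 β ∧
    δ' ∈ deltaCompositionsUpTo ((2 ^ (4 * h + 4) + 1) * h) ∧
    ψ' ∈ chainsUpTo (4 * h + 4) ∧ ψ = β * δ' * ψ'}

/-- `|H|`, the largest length of a reduced word among the given generators (`0` if there are
none). -/
def maxLength {k : ℕ} (u : Fin k → F2) : ℕ := Finset.univ.sup fun i => (u i).norm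

/-- `H` is the fixed point group of `φ`: it consists of exactly the elements fixed by `φ`. -/
def IsFixedPointGroup (H : Subgroup F2) (φ : MulAut F2) : Prop :=
  ∀ g : F2, g ∈ H ↔ φ g = g

/-- The subgroup generated by a finite list of (not necessarily reduced) words in `Σ^{±1}`. -/
def subgroupOfWords (L : List (List Letter)) : Subgroup F2 :=
  Subgroup.closure {g | ∃ w ∈ L, g = FreeGroup.mk w}

/-! The core is a classification (`fixClassified`): for an automorphism `φ` of `F_2`, either the
fixed elements commute with each other, or `φ = 1`, or `φ` has the same fixed elements as some
conjugate `α τ α⁻¹`, namely the subgroup generated by `α(a)` and `α(bab⁻¹)`.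

Nielsen reduction shows that signed permutations, `σ` and inner automorphisms generate `Aut F_2`
(`elementary_eq_top`). Rewriting products gives every automorphism the form (W1) · inner · chain,
and since chains of positive length have large matrices, the kernel of `Aut F_2 → GL_2(ℤ)` consists
of inner automorphisms. So the classification can go by determinant and trace. If the determinant is
1 and the absolute trace is at least 3, a fixed element lies in the commutator subgroup, which is
free on conjugates of `[a,b]` indexed by `ℤ²`; the automorphism acts on the indices by a hyperbolic
affine map, and no finite set of at least two points is invariant under such a map
(`commFix_of_three_le_trace`). If `±1` is an eigenvalue, then up to conjugation and inner factors
the map is `a ↦ a^{±1}`, `b ↦ (ba^n)^{±1}`, an isometry of the tree in which only the letters `b`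
have length; the distinction elliptic / hyperbolic / inversion settles this case. Trace `-1` is
reduced to one automorphism of order three, which becomes a cyclic permutation of a basis after
embedding `F_2` in a free group of rank three. The remaining matrices have a square or cube of a
type already treated.

For part (1), a trivial `H` is the fixed group of one explicit automorphism, and a nontrivial
commutative `H` is the centraliser of any nontrivial generator `u`, hence the fixed group of
conjugation by `u`. Otherwise `φ = 1` or `H` is the fixed group of `α τ α⁻¹`. In the latter case the
exponent vectors of `H` are multiples of that of `α(a)`, and some generator has a nonzero one, so
the vector of `α(a)` has `ℓ¹`-norm at most `|H|`. Euclid's algorithm then gives `α τ α⁻¹ = β c_g P`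
with `P` a chain of length at most `2|H|+1`. The conjugating element `g` is short too: two
noncommuting generators have short images under `P` whose conjugates by `g` are also short, whereas
elements that move both ends of a long segment only slightly commute (`commute_of_long_segment`).

For part (2), membership in a finitely generated subgroup is primitive recursive by separability
with an explicit bound (`mk_mem_subgroupOfWords_iff`). The classification supplies finite
certificates for being a fixed point group. By part (1) only finitely many automorphisms have to be
refuted in the negative case, and each refutation is a finite witness. Hence the predicate and its
complement are both recursively enumerable. -/

namespace FreeGroup

/-! ### Weighted trees of a free group: common prefixes and the four-point condition -/

section Tree

variable {α : Type*} [DecidableEq α]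

/-- The longest common prefix of two lists. -/
def lcp {γ : Type*} [DecidableEq γ] : List γ → List γ → List γ
  | x :: l, y :: m => if x = y then x :: lcp l m else []
  | _, _ => []

theorem lcp_prefix_left {γ : Type*} [DecidableEq γ] (l m : List γ) : lcp l m <+: l := by
  induction l generalizing m with
  | nil => simp [lcp]
  | cons x l ih =>
    cases m with
    | nil => simp [lcp]
    | cons y m =>
      rw [lcp]
      split_ifs with h
      · exact (List.prefix_cons_inj x).2 (ih m)
      · exact List.nil_prefix

theorem lcp_prefix_right {γ : Type*} [DecidableEq γ] (l m : List γ) : lcp l m <+: m := by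
  induction l generalizing m with
  | nil => simp [lcp]
  | cons x l ih =>
    cases m with
    | nil => simp [lcp]
    | cons y m =>
      rw [lcp]
      split_ifs with h
      · subst h
        exact (List.prefix_cons_inj x).2 (ih m)
      · exact List.nil_prefix

theorem prefix_lcp {γ : Type*} [DecidableEq γ] {p l m : List γ} (h₁ : p <+: l) (h₂ : p <+: m) :
    p <+: lcp l m := by
  induction p generalizing l m with
  | nil => exact List.nil_prefix
  | cons x p ih =>
    obtain ⟨l', rfl⟩ := h₁
    obtain ⟨m', rfl⟩ := h₂
    simp only [List.cons_append, lcp, if_true]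
    exact (List.prefix_cons_inj x).2 (ih (List.prefix_append _ _) (List.prefix_append _ _))

/-- The number of letters of a word that lie in `B`. -/
def wordWeight (B : α → Bool) (L : List (α × Bool)) : ℕ := L.countP fun x => B x.1

/-- The number of letters in `B` of the reduced word of `g`. -/
def wt (B : α → Bool) (g : FreeGroup α) : ℕ := wordWeight B g.toWord

/-- The pseudometric on the free group that is induced by `wt`. -/
def treeDist (B : α → Bool) (x y : FreeGroup α) : ℕ := wt B (x⁻¹ * y)

variable (B : α → Bool)

omit [DecidableEq α] in
theorem wordWeight_append (L M : List (α × Bool)) :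
    wordWeight B (L ++ M) = wordWeight B L + wordWeight B M := by
  simp [wordWeight]

omit [DecidableEq α] in
theorem wordWeight_invRev (L : List (α × Bool)) : wordWeight B (invRev L) = wordWeight B L := by
  simp [wordWeight, invRev, List.countP_map, Function.comp_def]

omit [DecidableEq α] in
theorem wordWeight_le_of_prefix {L M : List (α × Bool)} (h : L <+: M) :
    wordWeight B L ≤ wordWeight B M := h.sublist.countP_le

/-- Beyond the longest common prefix the two words start with different letters, so nothing more
cancels. -/
theorem exists_common_prefix {L M : List (α × Bool)} (hL : IsReduced L) (hM : IsReduced M) :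
    ∃ l m, L = lcp L M ++ l ∧ M = lcp L M ++ m ∧ IsReduced (invRev l ++ m) := by
  induction L generalizing M with
  | nil => exact ⟨[], M, by simp [lcp], by simp [lcp], by simpa using hM⟩
  | cons x L ih =>
    cases M with
    | nil =>
      refine ⟨x :: L, [], by simp [lcp], by simp [lcp], ?_⟩
      rw [isReduced_iff_reduce_eq, List.append_nil, reduce_invRev, hL.reduce_eq]
    | cons y M =>
      rw [lcp]
      split_ifs with h
      · subst h
        obtain ⟨l, m, h₁, h₂, h₃⟩ := ih (hL.infix (List.suffix_cons x L).isInfix)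
          (hM.infix (List.suffix_cons x M).isInfix)
        refine ⟨l, m, ?_, ?_, h₃⟩
        · simpa using h₁
        · simpa using h₂
      · refine ⟨x :: L, y :: M, rfl, rfl, ?_⟩
        have hL' : IsReduced (invRev (x :: L)) := by
          rw [isReduced_iff_reduce_eq, reduce_invRev, hL.reduce_eq]
        rw [invRev_cons] at hL' ⊢
        refine IsReduced.append_overlap (L₂ := invRev [x]) hL' ?_ (by simp [invRev])
        simp only [invRev, List.map_cons, List.map_nil, List.reverse_cons, List.reverse_nil,
          List.nil_append, List.singleton_append, isReduced_cons_cons]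
        refine ⟨fun h' => ?_, hM⟩
        rcases x with ⟨x, e⟩
        rcases y with ⟨y, f⟩
        simp only at h' ⊢
        subst h'
        cases e <;> cases f <;> simp_all

theorem exists_toWord_eq (x y : FreeGroup α) :
    ∃ l m, x.toWord = lcp x.toWord y.toWord ++ l ∧ y.toWord = lcp x.toWord y.toWord ++ m ∧
      (x⁻¹ * y).toWord = invRev l ++ m := by
  obtain ⟨l, m, h₁, h₂, h₃⟩ := exists_common_prefix (isReduced_toWord (x := x))
    (isReduced_toWord (x := y))
  refine ⟨l, m, h₁, h₂, ?_⟩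
  rw [← h₃.reduce_eq, ← toWord_mk]
  congr 1
  have hx : x = mk (lcp x.toWord y.toWord) * mk l := by rw [mul_mk, ← h₁, mk_toWord]
  have hy : y = mk (lcp x.toWord y.toWord) * mk m := by rw [mul_mk, ← h₂, mk_toWord]
  generalize lcp x.toWord y.toWord = p at hx hy
  rw [hx, hy, ← mul_mk, ← inv_mk]
  group

/-- The Gromov product: the weight of the longest common prefix. -/
def gp (x y : FreeGroup α) : ℕ := wordWeight B (lcp x.toWord y.toWord)

/-- Forming `x⁻¹y` cancels exactly the common prefix, once in each word. -/
theorem two_mul_gp (x y : FreeGroup α) : wt B (x⁻¹ * y) + 2 * gp B x y = wt B x + wt B y := by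
  obtain ⟨l, m, h₁, h₂, h₃⟩ := exists_toWord_eq x y
  have h₁' := congrArg (wordWeight B) h₁
  have h₂' := congrArg (wordWeight B) h₂
  have h₃' := congrArg (wordWeight B) h₃
  rw [wordWeight_append] at h₁' h₂' h₃'
  rw [wordWeight_invRev] at h₃'
  simp only [wt, gp]
  omega

/-- The common prefixes of `x, y` and of `y, z` are both prefixes of `y`, hence comparable; the
shorter one is a common prefix of `x` and `z`. -/
theorem gp_ultra (x y z : FreeGroup α) : gp B x y ≤ gp B x z ∨ gp B y z ≤ gp B x z := by
  have key := List.prefix_or_prefix_of_prefix (lcp_prefix_right x.toWord y.toWord)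
    (lcp_prefix_left y.toWord z.toWord)
  rcases key with h | h
  · left
    exact wordWeight_le_of_prefix B (prefix_lcp (lcp_prefix_left _ _)
      (h.trans (lcp_prefix_right _ _)))
  · right
    exact wordWeight_le_of_prefix B (prefix_lcp (h.trans (lcp_prefix_left _ _))
      (lcp_prefix_right _ _))

@[simp] theorem wt_one : wt B 1 = 0 := by simp [wt, wordWeight]

@[simp] theorem wt_inv (x : FreeGroup α) : wt B x⁻¹ = wt B x := by
  simp [wt, toWord_inv, wordWeight_invRev]

theorem wt_mul_le (x y : FreeGroup α) : wt B (x * y) ≤ wt B x + wt B y := by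
  have := two_mul_gp B x⁻¹ y
  rw [inv_inv, wt_inv] at this
  omega

theorem treeDist_mul_left (g x y : FreeGroup α) : treeDist B (g * x) (g * y) = treeDist B x y := by
  simp only [treeDist]
  congr 1
  group

theorem treeDist_comm (x y : FreeGroup α) : treeDist B x y = treeDist B y x := by
  rw [treeDist, treeDist, ← wt_inv]
  congr 1
  group

@[simp] theorem treeDist_one_left (x : FreeGroup α) : treeDist B 1 x = wt B x := by simp [treeDist]

@[simp] theorem treeDist_one_right (x : FreeGroup α) : treeDist B x 1 = wt B x := by simp [treeDist]

theorem treeDist_triangle (x y z : FreeGroup α) : treeDist B x z ≤ treeDist B x y + treeDist B y z := by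
  have := wt_mul_le B (x⁻¹ * y) (y⁻¹ * z)
  rw [show x⁻¹ * y * (y⁻¹ * z) = x⁻¹ * z by group] at this
  exact this

/-- This is 0-hyperbolicity, obtained from the ultrametric inequality for the Gromov product based
at `w`. Most tree geometry below is linear arithmetic over instances of it and of the triangle
inequality. -/
theorem four_point (w x y z : FreeGroup α) :
    treeDist B x z + treeDist B w y ≤ treeDist B w z + treeDist B x y ∨
      treeDist B x z + treeDist B w y ≤ treeDist B w x + treeDist B y z := by
  have h₁ := two_mul_gp B (w⁻¹ * x) (w⁻¹ * y)
  have h₂ := two_mul_gp B (w⁻¹ * y) (w⁻¹ * z)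
  have h₃ := two_mul_gp B (w⁻¹ * x) (w⁻¹ * z)
  have h := gp_ultra B (w⁻¹ * x) (w⁻¹ * y) (w⁻¹ * z)
  have e : ∀ p q : FreeGroup α, (w⁻¹ * p)⁻¹ * (w⁻¹ * q) = p⁻¹ * q := fun p q => by group
  rw [e] at h₁ h₂ h₃
  simp only [treeDist]
  omega

theorem treeDist_parity (x y z : FreeGroup α) :
    (treeDist B x y + treeDist B y z + treeDist B x z) % 2 = 0 := by
  have h := two_mul_gp B (y⁻¹ * x) (y⁻¹ * z)
  rw [show (y⁻¹ * x)⁻¹ * (y⁻¹ * z) = x⁻¹ * z by group] at h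
  have := treeDist_comm B x y
  simp only [treeDist] at *
  omega

theorem exists_prefix (g : FreeGroup α) {t : ℕ} (h : t ≤ wt B g) :
    ∃ x, wt B x = t ∧ wt B g = t + wt B (x⁻¹ * g) := by
  have key : ∀ L : List (α × Bool), t ≤ wordWeight B L → ∃ p q, L = p ++ q ∧
      wordWeight B p = t := by
    intro L
    induction L generalizing t with
    | nil => intro h; exact ⟨[], [], rfl, by simpa [wordWeight, eq_comm] using h⟩
    | cons x L ih =>
      intro h'
      rcases t with _ | t
      · exact ⟨[], x :: L, rfl, by simp [wordWeight]⟩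
      by_cases hx : B x.1 = true
      · obtain ⟨p, q, rfl, hp⟩ := ih (t := t) (by omega) (by simp [wordWeight, hx] at h' ⊢; omega)
        exact ⟨x :: p, q, rfl, by simp [wordWeight, hx] at hp ⊢; omega⟩
      · obtain ⟨p, q, rfl, hp⟩ := ih (t := t + 1) h (by simp [wordWeight, hx] at h' ⊢; omega)
        exact ⟨x :: p, q, rfl, by simp [wordWeight, hx] at hp ⊢; omega⟩
  obtain ⟨p, q, hpq, hp⟩ := key g.toWord h
  have hr : IsReduced (p ++ q) := hpq ▸ isReduced_toWord
  have hpr : reduce p = p := (hr.infix ⟨[], q, by simp⟩).reduce_eq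
  have hqr : reduce q = q := (hr.infix ⟨p, [], by simp⟩).reduce_eq
  refine ⟨mk p, by rw [wt, toWord_mk, hpr, hp], ?_⟩
  have : (mk p)⁻¹ * g = mk q := by
    rw [← mk_toWord (x := g), hpq, ← mul_mk]
    group
  rw [this, wt, wt, hpq, toWord_mk, hqr, wordWeight_append, hp]

/-- In a tree a path that is geodesic around each of its pieces is geodesic. The middle piece must
have positive weight: otherwise `z` could cancel against `x`. -/
theorem wt_mul_of_dist {x y z : FreeGroup α} (hxy : wt B (x * y) = wt B x + wt B y)
    (hyz : wt B (y * z) = wt B y + wt B z) (hy : 0 < wt B y) :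
    wt B (x * y * z) = wt B x + wt B y + wt B z := by
  have h := four_point B 1 x (x * y) (x * y * z)
  have h' := treeDist_triangle B 1 (x * y) (x * y * z)
  have e₁ : treeDist B x (x * y * z) = wt B (y * z) := by rw [treeDist]; congr 1; group
  have e₂ : treeDist B x (x * y) = wt B y := by rw [treeDist]; congr 1; group
  have e₃ : treeDist B (x * y) (x * y * z) = wt B z := by rw [treeDist]; congr 1; group
  simp only [treeDist_one_left, e₁, e₂, e₃] at h h'
  omega

theorem lcp_eq_nil {L M : List (α × Bool)} (hL : ∀ x ∈ L.head?, B x.1 = false)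
    (hM : ∀ x ∈ M.head?, B x.1 = true) : lcp L M = [] := by
  cases L with
  | nil => simp [lcp]
  | cons x L =>
    cases M with
    | nil => simp [lcp]
    | cons y M =>
      rw [lcp, if_neg]
      rintro rfl
      simp at hL hM
      simp [hL] at hM

theorem lcp_comm {γ : Type*} [DecidableEq γ] (l m : List γ) : lcp l m = lcp m l := by
  induction l generalizing m with
  | nil => cases m <;> simp [lcp]
  | cons x l ih =>
    cases m with
    | nil => simp [lcp]
    | cons y m =>
      by_cases h : x = y
      · simp [lcp, h, ih m]
      · simp [lcp, h, Ne.symm h]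

theorem head?_of_wt_eq_zero {g : FreeGroup α} (h : wt B g = 0) :
    ∀ x ∈ g.toWord.head?, B x.1 = false := by
  intro x hx
  simp only [wt, wordWeight, List.countP_eq_zero] at h
  simpa using h x (List.mem_of_mem_head? hx)

/-- A nontrivial element of weight zero does not fix an edge of positive weight. -/
theorem eq_one_of_wt_conj {h y : FreeGroup α} (h₀ : wt B h = 0) (hy : 0 < wt B y)
    (h₁ : wt B (y⁻¹ * h * y) = 0) : h = 1 := by
  by_contra hne
  obtain ⟨p, b, q, hpq, hp, hb⟩ : ∃ p b q, y.toWord = p ++ b :: q ∧ wordWeight B p = 0 ∧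
      B b.1 = true := by
    have key : ∀ L : List (α × Bool), 0 < wordWeight B L → ∃ p b q, L = p ++ b :: q ∧
        wordWeight B p = 0 ∧ B b.1 = true := by
      intro L
      induction L with
      | nil => simp [wordWeight]
      | cons x L ih =>
        intro h
        by_cases hx : B x.1 = true
        · exact ⟨[], x, L, rfl, rfl, hx⟩
        · obtain ⟨p, b, q, rfl, hp, hb⟩ := ih (by simpa [wordWeight, hx] using h)
          exact ⟨x :: p, b, q, rfl, by simpa [wordWeight, hx] using hp, hb⟩
    exact key _ hy
  have hr : IsReduced (p ++ b :: q) := hpq ▸ isReduced_toWord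
  have hpr : reduce p = p := (hr.infix ⟨[], b :: q, by simp⟩).reduce_eq
  have hqr : reduce (b :: q) = b :: q := (hr.infix ⟨p, [], by simp⟩).reduce_eq
  -- `Y` starts at the first letter of `y` that lies in `B`. The conjugate `k = P⁻¹hP` still has
  -- weight zero, so if it is nontrivial, it and its inverse begin with letters outside `B`. Then
  -- `kY` is reduced as written and shares no prefix with `Y`, so `Y⁻¹kY` has positive weight.
  have hy' : y = mk p * mk (b :: q) := by rw [mul_mk, ← hpq, mk_toWord]
  have hP : wt B (mk p) = 0 := by rw [wt, toWord_mk, hpr, hp]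
  have hY : (mk (b :: q)).toWord = b :: q := by rw [toWord_mk, hqr]
  generalize mk p = P at hy' hP
  generalize mk (b :: q) = Y at hy' hY
  subst hy'
  have hk : wt B (P⁻¹ * h * P) = 0 := by
    have h2 := wt_mul_le B (P⁻¹ * h) P
    have h3 := wt_mul_le B P⁻¹ h
    rw [wt_inv] at h3
    omega
  rw [show (P * Y)⁻¹ * h * (P * Y) = Y⁻¹ * ((P⁻¹ * h * P) * Y) by group] at h₁
  have hk1 : P⁻¹ * h * P ≠ 1 := fun h' => hne (by
    have := congrArg (fun z => P * z * P⁻¹) h'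
    simpa [mul_assoc] using this)
  generalize P⁻¹ * h * P = k at hk h₁ hk1
  obtain ⟨l, m, e₁, e₂, e₃⟩ := exists_toWord_eq k⁻¹ Y
  have hl : lcp k⁻¹.toWord Y.toWord = [] :=
    lcp_eq_nil B (head?_of_wt_eq_zero B (by simpa using hk)) (by simp [hY, hb])
  rw [hl, List.nil_append] at e₁ e₂
  rw [inv_inv, ← e₁, ← e₂, toWord_inv, invRev_invRev] at e₃
  have h4 := two_mul_gp B Y (k * Y)
  have h5 : gp B Y (k * Y) = 0 := by
    have : k.toWord ≠ [] := by simpa using hk1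
    rw [gp, lcp_comm, lcp_eq_nil B (L := (k * Y).toWord)]
    · rfl
    · intro x hx
      refine head?_of_wt_eq_zero B hk x ?_
      rw [e₃] at hx
      cases hw : k.toWord with
      | nil => exact absurd hw this
      | cons z t => simpa [hw] using hx
    · simp [hY, hb]
  have h6 : 0 < wt B Y := by simp [wt, wordWeight, hY, hb]
  omega

end Tree

end FreeGroup

namespace FreeGroup

/-! ### Isometries of the tree and commuting fixed elements -/

section TreeIsometry

variable {α : Type*} [DecidableEq α] (B : α → Bool)

/-- A point far from the end `p` of a segment stays on the segment when `p` is moved a little. -/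
theorem segment_of_near {p p' x q : FreeGroup α} (hx : treeDist B p x + treeDist B x q = treeDist B p q)
    (h : treeDist B p p' < treeDist B p x) : treeDist B p' x + treeDist B x q = treeDist B p' q := by
  have h₁ := four_point B p x p' q
  have h₂ := four_point B p p' x q
  have h₃ := four_point B p x q p'
  have t₁ := treeDist_triangle B p' x q
  have t₂ := treeDist_triangle B p p' x
  have t₃ := treeDist_triangle B p p' q
  rw [treeDist_comm B q p'] at h₃
  rw [treeDist_comm B x p'] at *
  omega

/-- An element that displaces both `1` and `g` by at most `D` carries the middle of the segment `[1,
g]` into that segment, and shifts it by the amount `wt(ug) - wt(g)`, which does not depend on the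
point. -/
theorem translate_segment {g u x : FreeGroup α} {D : ℕ} (hu : wt B u ≤ D)
    (hug : treeDist B g (u * g) ≤ D) (hx : wt B x + treeDist B x g = wt B g) (h₁ : D < wt B x)
    (h₂ : D < treeDist B x g) :
    wt B (u * x) + treeDist B (u * x) g = wt B g ∧
      wt B (u * x) + wt B g = wt B (u * g) + wt B x := by
  have e₁ : treeDist B u (u * x) = wt B x := by simp [treeDist]
  have e₂ : treeDist B u (u * g) = wt B g := by simp [treeDist]
  have e₃ := treeDist_mul_left B u x g
  have s₁ := segment_of_near B (p := u) (p' := 1) (x := u * x) (q := u * g) (by omega)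
    (by rw [e₁, treeDist_one_right]; omega)
  rw [treeDist_one_left, treeDist_one_left] at s₁
  have s₂ := segment_of_near B (p := u * g) (p' := g) (x := u * x) (q := 1)
    (by rw [treeDist_one_right, treeDist_one_right, treeDist_comm]; omega)
    (by rw [treeDist_comm, treeDist_comm B (u * g)]; omega)
  rw [treeDist_one_right, treeDist_one_right, treeDist_comm] at s₂
  constructor <;> omega

theorem treeDist_eq_zero_of_segment {p q x y : FreeGroup α}
    (hx : treeDist B p x + treeDist B x q = treeDist B p q) (hy : treeDist B p y + treeDist B y q = treeDist B p q)
    (h : treeDist B p x = treeDist B p y) : treeDist B x y = 0 := by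
  have h₁ := four_point B p x q y
  have h₂ := treeDist_comm B q y
  omega

/-- Two elements that move both ends of a long segment only a little commute. -/
theorem commute_of_long_segment {g u v : FreeGroup α} {D : ℕ} (hu : wt B u ≤ D)
    (hug : wt B (g⁻¹ * u * g) ≤ D) (hv : wt B v ≤ D) (hvg : wt B (g⁻¹ * v * g) ≤ D)
    (hg : 4 * D + 4 ≤ wt B g) : u * v = v * u := by
  have hug' : treeDist B g (u * g) ≤ D := by rwa [treeDist, ← mul_assoc]
  have hvg' : treeDist B g (v * g) ≤ D := by rwa [treeDist, ← mul_assoc]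
  -- Near the middle both elements act as translations along the segment, so `uvx` and `vux` lie on
  -- it at equal distance from `1`, and the commutator does not move `x`. The margin `2 * D` leaves
  -- room for two successive displacements.
  have key : ∀ x, wt B x + treeDist B x g = wt B g → 2 * D < wt B x → 2 * D < treeDist B x g →
      wt B (x⁻¹ * ((v * u)⁻¹ * (u * v)) * x) = 0 := by
    intro x hx h₁ h₂
    have near : ∀ {w}, wt B w ≤ D → treeDist B g (w * g) ≤ D →
        D < wt B (w * x) ∧ D < treeDist B (w * x) g := by
      intro w hw hwg
      have t₁ := wt_mul_le B w⁻¹ (w * x)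
      rw [inv_mul_cancel_left, wt_inv] at t₁
      have t₂ := treeDist_triangle B (w * x) g (w * g)
      rw [treeDist_mul_left] at t₂
      omega
    have hu1 := translate_segment B hu hug' hx (by omega) (by omega)
    have hv1 := translate_segment B hv hvg' hx (by omega) (by omega)
    have hvu := translate_segment B hv hvg' hu1.1 (near hu hug').1 (near hu hug').2
    have huv := translate_segment B hu hug' hv1.1 (near hv hvg').1 (near hv hvg').2
    have := treeDist_eq_zero_of_segment B (p := 1) (q := g) (x := v * (u * x)) (y := u * (v * x))
      (by simpa using hvu.1) (by simpa using huv.1) (by simp only [treeDist_one_left]; omega)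
    rw [← this, treeDist]
    congr 1
    group
  -- The points `x` and `xy` are at distance one and more than `2 * D` away from both ends; this
  -- uses the length `4 * D + 4`. A commutator that moves neither of them fixes an edge, hence is
  -- trivial.
  obtain ⟨x, hx, hxg⟩ := exists_prefix B g (t := 2 * D + 1) (by omega)
  obtain ⟨y, hy, hyg⟩ := exists_prefix B (x⁻¹ * g) (t := 1) (by omega)
  rw [show y⁻¹ * (x⁻¹ * g) = (x * y)⁻¹ * g by group] at hyg
  have k₁ := key x (by simp only [treeDist]; omega) (by omega) (by simp only [treeDist]; omega)
  have t₁ := wt_mul_le B x y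
  have t₂ := wt_mul_le B (x * y) ((x * y)⁻¹ * g)
  rw [mul_inv_cancel_left] at t₂
  have k₂ := key (x * y) (by simp only [treeDist]; omega) (by omega) (by simp only [treeDist]; omega)
  have := eq_one_of_wt_conj B k₁ (y := y) (by omega) (by rw [← k₂]; congr 1; group)
  have h1 : (v * u)⁻¹ * (u * v) = 1 := by
    have h2 := congrArg (fun z => x * z * x⁻¹) this
    simpa [mul_assoc] using h2
  exact (inv_mul_eq_one.1 h1).symm

/-- The product `g θ(g) ⋯ θⁿ⁻¹(g)`. -/
def twistedPow (θ : MulAut (FreeGroup α)) (g : FreeGroup α) : ℕ → FreeGroup α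
  | 0 => 1
  | n + 1 => twistedPow θ g n * (θ ^ n) g

theorem wt_pow_apply {θ : MulAut (FreeGroup α)} (hθ : ∀ x, wt B (θ x) = wt B x) (n : ℕ)
    (x : FreeGroup α) : wt B ((θ ^ n) x) = wt B x := by
  induction n with
  | zero => rfl
  | succ n ih => rw [pow_succ', MulAut.mul_apply, hθ, ih]

/-- The axis of a hyperbolic isometry: consecutive translates of `[1, g]` meet without backtracking,
and local geodesics are geodesic. -/
theorem wt_twistedPow {θ : MulAut (FreeGroup α)} (hθ : ∀ x, wt B (θ x) = wt B x)
    {g : FreeGroup α} (hg : 0 < wt B g) (h : wt B (g * θ g) = 2 * wt B g) (n : ℕ) :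
    wt B (twistedPow θ g n) = n * wt B g := by
  have key : ∀ n, wt B (twistedPow θ g n) = n * wt B g ∧
      wt B (twistedPow θ g (n + 1)) = (n + 1) * wt B g := by
    intro n
    induction n with
    | zero => simp [twistedPow]
    | succ n ih =>
      refine ⟨ih.2, ?_⟩
      have h₁ : wt B ((θ ^ n) g * (θ ^ (n + 1)) g) = 2 * wt B g := by
        rw [pow_succ, MulAut.mul_apply, ← _root_.map_mul, wt_pow_apply B hθ, h]
      have h₂ := ih.2
      rw [twistedPow] at h₂
      have := wt_mul_of_dist B (x := twistedPow θ g n) (y := (θ ^ n) g) (z := (θ ^ (n + 1)) g)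
        (by rw [h₂, ih.1, wt_pow_apply B hθ]; ring)
        (by rw [h₁, wt_pow_apply B hθ, wt_pow_apply B hθ]; ring)
        (by rwa [wt_pow_apply B hθ])
      rw [twistedPow, twistedPow, this, ih.1, wt_pow_apply B hθ, wt_pow_apply B hθ]
      ring
  exact (key n).1

-- The `n`-th power of `c_g θ` is `c_p θⁿ`, where `p` is the twisted power; it fixes whatever `c_g
-- θ` fixes.
omit [DecidableEq α] in
theorem twistedPow_conj {θ : MulAut (FreeGroup α)} {g u : FreeGroup α}
    (hu : g * θ u * g⁻¹ = u) (n : ℕ) :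
    (twistedPow θ g n)⁻¹ * u * twistedPow θ g n = (θ ^ n) u := by
  induction n with
  | zero => simp [twistedPow]
  | succ n ih =>
    have h : g⁻¹ * u * g = θ u := by
      calc g⁻¹ * u * g = g⁻¹ * (g * θ u * g⁻¹) * g := by rw [hu]
        _ = θ u := by group
    calc (twistedPow θ g (n + 1))⁻¹ * u * twistedPow θ g (n + 1)
        = ((θ ^ n) g)⁻¹ * ((twistedPow θ g n)⁻¹ * u * twistedPow θ g n) * (θ ^ n) g := by
          rw [twistedPow]; group
      _ = (θ ^ n) (g⁻¹ * u * g) := by rw [ih]; simp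
      _ = (θ ^ (n + 1)) u := by rw [h, pow_succ, MulAut.mul_apply]

/-- The elements fixed by an automorphism commute with each other. -/
def CommFix {G : Type*} [Group G] (φ : MulAut G) : Prop :=
  ∀ u v, φ u = u → φ v = v → u * v = v * u

/-- Fixed elements keep their weight when conjugated by the arbitrarily long twisted powers, so any
two of them move both ends of a long segment by a bounded amount. -/
theorem commFix_of_hyperbolic {θ : MulAut (FreeGroup α)} (hθ : ∀ x, wt B (θ x) = wt B x)
    {g : FreeGroup α} (hg : 0 < wt B g) (h : wt B (g * θ g) = 2 * wt B g) :
    CommFix (MulAut.conj g * θ) := by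
  intro u v hu hv
  simp only [MulAut.mul_apply, MulAut.conj_apply] at hu hv
  set D := wt B u + wt B v
  refine commute_of_long_segment B (g := twistedPow θ g (4 * D + 4)) (D := D)
    (Nat.le_add_right _ _) ?_ (Nat.le_add_left _ _) ?_ ?_
  · rw [twistedPow_conj hu, wt_pow_apply B hθ]; exact Nat.le_add_right _ _
  · rw [twistedPow_conj hv, wt_pow_apply B hθ]; exact Nat.le_add_left _ _
  · rw [wt_twistedPow B hθ hg h]; exact Nat.le_mul_of_pos_right _ hg

theorem CommFix.of_conj {G : Type*} [Group G] {φ : MulAut G} (α : MulAut G)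
    (h : CommFix (α * φ * α⁻¹)) : CommFix φ := by
  intro u v hu hv
  have := h (α u) (α v) (by simp [hu]) (by simp [hv])
  rw [← _root_.map_mul, ← _root_.map_mul] at this
  exact α.injective this

theorem CommFix.of_pow {G : Type*} [Group G] {φ : MulAut G} (n : ℕ) (h : CommFix (φ ^ n)) :
    CommFix φ := by
  have : ∀ u, φ u = u → (φ ^ n) u = u := by
    intro u hu
    induction n with
    | zero => rfl
    | succ n ih =>
      clear h
      have aux : ∀ m : ℕ, (φ ^ m) u = u := by
        intro m
        induction m with
        | zero => rfl
        | succ m ihm => rw [pow_succ, MulAut.mul_apply, hu, ihm]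
      exact aux _
  exact fun u v hu hv => h u v (this u hu) (this v hv)

/-- Change of base point: conjugating `c_g θ` by `c_w` replaces `g` by `w g θ(w)⁻¹`, whose weight is
the displacement of the point `w⁻¹` under `x ↦ g θ(x)`. -/
theorem conj_mul_conj_mul {G : Type*} [Group G] (θ : MulAut G) (w g : G) :
    MulAut.conj w * (MulAut.conj g * θ) * (MulAut.conj w)⁻¹ =
      MulAut.conj (w * g * (θ w)⁻¹) * θ := by
  ext x
  simp [mul_assoc]

/-- An isometry `x ↦ g θ(x)` of the tree is elliptic, or hyperbolic, or inverts an edge. -/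
theorem elliptic_or_commFix_or_inversion {θ : MulAut (FreeGroup α)}
    (hθ : ∀ x, wt B (θ x) = wt B x) (g : FreeGroup α) :
    (∃ w, wt B (w * g * (θ w)⁻¹) = 0) ∨ CommFix (MulAut.conj g * θ) ∨
      ∃ w, wt B (w * g * (θ w)⁻¹) = 1 ∧
        wt B ((w * g * (θ w)⁻¹) * θ (w * g * (θ w)⁻¹)) = 0 := by
  -- Take a point of minimal displacement.
  obtain ⟨w, hw⟩ : ∃ w, ∀ w', wt B (w * g * (θ w)⁻¹) ≤ wt B (w' * g * (θ w')⁻¹) := by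
    obtain ⟨w, hw⟩ := WellFounded.has_min
      (InvImage.wf (fun w => wt B (w * g * (θ w)⁻¹)) Nat.lt_wfRel.wf) Set.univ ⟨1, trivial⟩
    exact ⟨w, fun w' => not_lt.1 (hw.2 w' trivial)⟩
  set g' := w * g * (θ w)⁻¹ with hg'
  have hmin : ∀ w', wt B g' ≤ wt B (w' * g' * (θ w')⁻¹) := by
    intro w'
    refine (hw (w' * w)).trans (le_of_eq ?_)
    congr 1
    rw [hg', _root_.map_mul]
    group
  by_cases h0 : wt B g' = 0
  · exact Or.inl ⟨w, h0⟩
  have h0' : 0 < wt B g' := Nat.pos_of_ne_zero h0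
  right
  by_cases h2 : wt B (g' * θ g') = 2 * wt B g'
  · left
    refine CommFix.of_conj (MulAut.conj w) ?_
    rw [conj_mul_conj_mul]
    exact commFix_of_hyperbolic B hθ h0' h2
  right
  refine ⟨w, ?_⟩
  change wt B g' = 1 ∧ wt B (g' * θ g') = 0
  have t := wt_mul_le B g' (θ g')
  have par := treeDist_parity B 1 g' (g' * θ g')
  have e : treeDist B g' (g' * θ g') = wt B g' := by rw [treeDist, inv_mul_cancel_left, hθ]
  rw [e, treeDist_one_left, treeDist_one_left] at par
  rw [hθ] at t
  -- There is backtracking at `g'`, by parity along a whole edge. Were the displacement at least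
  -- two, the point `x` at distance one from `1` on the segment `[1, g']` would be displaced by
  -- less, against minimality.
  obtain ⟨x, hx, hxg⟩ := exists_prefix B g' (Nat.one_le_iff_ne_zero.2 h0)
  have hm := hmin x⁻¹
  rw [_root_.map_inv, inv_inv] at hm
  -- the points `g'θ(x)` and `x` both leave `g'` in the direction of `1`
  have p₁ := four_point B g' 1 (g' * θ g') (g' * θ x)
  have p₂ := four_point B g' x 1 (g' * θ x)
  have d₁ : treeDist B g' (g' * θ x) = 1 := by rw [treeDist, inv_mul_cancel_left, hθ, hx]
  have d₂ : treeDist B (g' * θ g') (g' * θ x) = wt B g' - 1 := by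
    rw [treeDist_mul_left, treeDist_comm, treeDist, ← _root_.map_inv, ← _root_.map_mul, hθ]; omega
  have d₃ : treeDist B x (g' * θ x) = wt B (x⁻¹ * g' * θ x) := by rw [treeDist, ← mul_assoc]
  have d₄ : treeDist B g' x = wt B g' - 1 := by rw [treeDist_comm, treeDist]; omega
  rw [d₁, d₂, treeDist_one_left, treeDist_one_left, e, treeDist_one_right] at p₁
  rw [d₁, d₃, d₄, treeDist_one_left, treeDist_one_right, treeDist_one_right, hx] at p₂
  constructor <;> omega

end TreeIsometry

end FreeGroup

/-! ### Explicit automorphisms of `F_2` and the signed permutations of the basis -/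

open FreeGroup

/-- Two automorphisms that agree on the basis are equal. -/
theorem aut_ext {φ ψ : MulAut F2} (h₀ : φ (of 0) = ψ (of 0)) (h₁ : φ (of 1) = ψ (of 1)) :
    φ = ψ := by
  have : φ.toMonoidHom = ψ.toMonoidHom := by
    ext i
    fin_cases i
    · exact h₀
    · exact h₁
  ext x
  exact DFunLike.congr_fun this x

theorem elt_true (i : Fin 2) : Letter.elt (i, true) = of i := rfl

theorem elt_false (i : Fin 2) : Letter.elt (i, false) = (of i)⁻¹ := by
  simp [Letter.elt, of, invRev]

theorem whitehead_coe (S : Finset Letter) (x : Letter) (h₁ : x ∉ S) (h₂ : x.inv ∉ S) (g : F2) :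
    whitehead S x h₁ h₂ g = whiteheadHom S x g := rfl

@[simp] theorem sigma_zero : sigma (of 0) = of 0 * of 1 := by
  rw [sigma, whitehead_coe]
  simp [whiteheadHom, elt_true]

@[simp] theorem sigma_one : sigma (of 1) = of 1 := by
  rw [sigma, whitehead_coe]
  simp [whiteheadHom]

@[simp] theorem tau_zero : tau (of 0) = of 0 := by
  rw [tau, whitehead_coe]
  simp [whiteheadHom]

@[simp] theorem tau_one : tau (of 1) = of 1 * of 0 := by
  rw [tau, whitehead_coe]
  simp [whiteheadHom, elt_true]

@[simp] theorem sigma_symm_one : MulEquiv.symm sigma (of 1) = of 1 := by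
  simp [MulEquiv.symm_apply_eq]

@[simp] theorem sigma_symm_zero : MulEquiv.symm sigma (of 0) = of 0 * (of 1)⁻¹ := by
  simp [MulEquiv.symm_apply_eq]

@[simp] theorem tau_symm_zero : MulEquiv.symm tau (of 0) = of 0 := by
  simp [MulEquiv.symm_apply_eq]

@[simp] theorem tau_symm_one : MulEquiv.symm tau (of 1) = of 1 * (of 0)⁻¹ := by
  simp [MulEquiv.symm_apply_eq]

/-- The automorphism that exchanges the two basis elements. -/
def swapAut : MulAut F2 := freeGroupCongr (Equiv.swap 0 1)

@[simp] theorem swapAut_zero : swapAut (of 0) = of 1 := by simp [swapAut]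

@[simp] theorem swapAut_one : swapAut (of 1) = of 0 := by simp [swapAut]

/-- The automorphism `a ↦ a⁻¹`, `b ↦ b`. -/
def invA : MulAut F2 :=
  MonoidHom.toMulEquiv (FreeGroup.lift ![(of 0)⁻¹, of 1]) (FreeGroup.lift ![(of 0)⁻¹, of 1])
    (by ext i; fin_cases i <;> simp) (by ext i; fin_cases i <;> simp)

theorem invA_coe (g : F2) : invA g = FreeGroup.lift ![(of 0)⁻¹, of 1] g := rfl

@[simp] theorem invA_zero : invA (of 0) = (of 0)⁻¹ := by
  simp [invA_coe]

@[simp] theorem invA_one : invA (of 1) = of 1 := by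
  simp [invA_coe]

/-- The automorphism `a ↦ a`, `b ↦ b⁻¹`. -/
def invB : MulAut F2 := swapAut * invA * swapAut

@[simp] theorem invB_zero : invB (of 0) = of 0 := by simp [invB]

@[simp] theorem invB_one : invB (of 1) = (of 1)⁻¹ := by simp [invB]

theorem swapAut_inv : swapAut⁻¹ = swapAut := by
  rw [inv_eq_iff_mul_eq_one]
  exact aut_ext (by simp) (by simp)

theorem invA_inv : invA⁻¹ = invA := by
  rw [inv_eq_iff_mul_eq_one]
  exact aut_ext (by simp) (by simp)

theorem IsTypeW1.one : IsTypeW1 1 := by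
  have : ((1 : MulAut F2) : F2 → F2) = id := rfl
  simp [IsTypeW1, this]

theorem IsTypeW1.mul {β γ : MulAut F2} (hβ : IsTypeW1 β) (hγ : IsTypeW1 γ) :
    IsTypeW1 (β * γ) := by
  have : ((β * γ : MulAut F2) : F2 → F2) = β ∘ γ := rfl
  rw [IsTypeW1, this, Set.image_comp, hγ, hβ]

theorem IsTypeW1.inv {β : MulAut F2} (hβ : IsTypeW1 β) : IsTypeW1 β⁻¹ := by
  rw [IsTypeW1] at hβ
  rw [IsTypeW1]
  conv_lhs => rw [← hβ, ← Set.image_comp]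
  have : ((β⁻¹ : MulAut F2) : F2 → F2) ∘ β = id := by ext x; simp
  rw [this, Set.image_id]

theorem range_elt : Set.range Letter.elt = {of 0, of 1, (of 0)⁻¹, (of 1)⁻¹} := by
  ext x
  simp only [Set.mem_range, Prod.exists, Set.mem_insert_iff, Set.mem_singleton_iff]
  constructor
  · rintro ⟨i, e, rfl⟩
    fin_cases i <;> cases e <;> simp [elt_true, elt_false]
  · rintro (rfl | rfl | rfl | rfl)
    · exact ⟨0, true, rfl⟩
    · exact ⟨1, true, rfl⟩
    · exact ⟨0, false, elt_false 0⟩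
    · exact ⟨1, false, elt_false 1⟩

theorem isTypeW1_swapAut : IsTypeW1 swapAut := by
  rw [IsTypeW1, range_elt]
  simp only [Set.image_insert_eq, Set.image_singleton, swapAut_zero, swapAut_one,
    _root_.map_inv]
  grind

theorem isTypeW1_invA : IsTypeW1 invA := by
  rw [IsTypeW1, range_elt]
  simp only [Set.image_insert_eq, Set.image_singleton, _root_.map_inv, invA_zero, invA_one,
    inv_inv]
  grind

theorem isTypeW1_invB : IsTypeW1 invB :=
  (isTypeW1_swapAut.mul isTypeW1_invA).mul isTypeW1_swapAut

/-- The automorphisms of type (W1), with explicit parameters. -/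
def signedPerm (k p q : Bool) : MulAut F2 :=
  (if k then swapAut else 1) * (if p then invA else 1) * (if q then invB else 1)

theorem isTypeW1_signedPerm (k p q : Bool) : IsTypeW1 (signedPerm k p q) := by
  refine IsTypeW1.mul (IsTypeW1.mul ?_ ?_) ?_ <;> split_ifs
  exacts [isTypeW1_swapAut, IsTypeW1.one, isTypeW1_invA, IsTypeW1.one, isTypeW1_invB,
    IsTypeW1.one]

theorem of_zero_mul_of_one_ne : (of 0 * of 1 : F2) ≠ of 1 * of 0 := by decide

theorem eq_signedPerm_of_letters {β : MulAut F2} {x y : Letter} (hx : β (of 0) = x.elt)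
    (hy : β (of 1) = y.elt) : ∃ k p q, β = signedPerm k p q := by
  obtain ⟨i, e⟩ := x
  obtain ⟨j, f⟩ := y
  have hij : i ≠ j := by
    rintro rfl
    apply of_zero_mul_of_one_ne
    apply β.injective
    rw [_root_.map_mul, _root_.map_mul, hx, hy]
    cases e <;> cases f <;> simp [elt_true, elt_false]
  refine ⟨decide (i = 1), !e, !f, aut_ext ?_ ?_⟩
  · rw [hx]
    fin_cases i <;> fin_cases j <;> cases e <;> cases f <;>
      simp_all [signedPerm, elt_true, elt_false]
  · rw [hy]
    fin_cases i <;> fin_cases j <;> cases e <;> cases f <;>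
      simp_all [signedPerm, elt_true, elt_false]

theorem IsTypeW1.exists_letter {β : MulAut F2} (hβ : IsTypeW1 β) (x : Letter) :
    ∃ y : Letter, β x.elt = y.elt := by
  have : β x.elt ∈ Set.range Letter.elt := hβ ▸ Set.mem_image_of_mem _ ⟨x, rfl⟩
  obtain ⟨y, hy⟩ := this
  exact ⟨y, hy.symm⟩

theorem IsTypeW1.exists_signedPerm {β : MulAut F2} (hβ : IsTypeW1 β) :
    ∃ k p q, β = signedPerm k p q := by
  obtain ⟨x, hx⟩ := hβ.exists_letter (0, true)
  obtain ⟨y, hy⟩ := hβ.exists_letter (1, true)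
  exact eq_signedPerm_of_letters hx hy

theorem isTypeW1_of_letters {β : MulAut F2} {x y : Letter} (hx : β (of 0) = x.elt)
    (hy : β (of 1) = y.elt) : IsTypeW1 β := by
  obtain ⟨k, p, q, rfl⟩ := eq_signedPerm_of_letters hx hy
  exact isTypeW1_signedPerm k p q

/-! ### Chains and the form (W1) · inner · chain -/

/-- The automorphisms `σ, τ` (if `e`) and their inverses (otherwise). -/
def chainLetter : Bool → Bool → MulAut F2
  | true, true => sigma
  | true, false => tau
  | false, true => sigma⁻¹
  | false, false => tau⁻¹

theorem chainLetter_not (e t : Bool) : chainLetter (!e) t = (chainLetter e t)⁻¹ := by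
  cases e <;> cases t <;> simp [chainLetter]

theorem swapAut_conj_chainLetter (e t : Bool) :
    swapAut⁻¹ * chainLetter e t * swapAut = chainLetter e (!t) := by
  rw [swapAut_inv]
  cases e <;> cases t <;> exact aut_ext (by simp [chainLetter]) (by simp [chainLetter])

theorem invA_conj_chainLetter (e t : Bool) :
    ∃ g, invA⁻¹ * chainLetter e t * invA = MulAut.conj g * chainLetter (!e) t := by
  rw [invA_inv]
  cases e <;> cases t
  · exact ⟨1, aut_ext (by simp [chainLetter]) (by simp [chainLetter])⟩
  · exact ⟨of 1, aut_ext (by simp [chainLetter, mul_assoc]) (by simp [chainLetter])⟩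
  · exact ⟨1, aut_ext (by simp [chainLetter]) (by simp [chainLetter])⟩
  · exact ⟨(of 1)⁻¹, aut_ext (by simp [chainLetter, mul_assoc]) (by simp [chainLetter])⟩

theorem mul_conj_eq (φ : MulAut F2) (g : F2) :
    φ * MulAut.conj g = MulAut.conj (φ g) * φ := by
  ext x
  simp

theorem conj_chainLetter_mul {β γ : MulAut F2}
    (hβ : ∀ e t, ∃ g e' t', β⁻¹ * chainLetter e t * β = MulAut.conj g * chainLetter e' t')
    (hγ : ∀ e t, ∃ g e' t', γ⁻¹ * chainLetter e t * γ = MulAut.conj g * chainLetter e' t')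
    (e t : Bool) :
    ∃ g e' t', (β * γ)⁻¹ * chainLetter e t * (β * γ) = MulAut.conj g * chainLetter e' t' := by
  obtain ⟨g, e₁, t₁, h₁⟩ := hβ e t
  obtain ⟨k, e₂, t₂, h₂⟩ := hγ e₁ t₁
  refine ⟨γ⁻¹ g * k, e₂, t₂, ?_⟩
  calc (β * γ)⁻¹ * chainLetter e t * (β * γ)
      = γ⁻¹ * (β⁻¹ * chainLetter e t * β) * γ := by group
    _ = γ⁻¹ * MulAut.conj g * chainLetter e₁ t₁ * γ := by rw [h₁]; group
    _ = MulAut.conj (γ⁻¹ g) * (γ⁻¹ * chainLetter e₁ t₁ * γ) := by rw [mul_conj_eq]; group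
    _ = _ := by rw [h₂, _root_.map_mul]; group

theorem IsTypeW1.conj_chainLetter {β : MulAut F2} (hβ : IsTypeW1 β) (e t : Bool) :
    ∃ g e' t', β⁻¹ * chainLetter e t * β = MulAut.conj g * chainLetter e' t' := by
  have hs : ∀ e t, ∃ g e' t', swapAut⁻¹ * chainLetter e t * swapAut =
      MulAut.conj g * chainLetter e' t' := fun e t =>
    ⟨1, e, !t, by rw [swapAut_conj_chainLetter]; simp⟩
  have hi : ∀ e t, ∃ g e' t', invA⁻¹ * chainLetter e t * invA =
      MulAut.conj g * chainLetter e' t' := fun e t => by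
    obtain ⟨g, h⟩ := invA_conj_chainLetter e t
    exact ⟨g, !e, t, h⟩
  have h1 : ∀ e t, ∃ g e' t', (1 : MulAut F2)⁻¹ * chainLetter e t * 1 =
      MulAut.conj g * chainLetter e' t' := fun e t => ⟨1, e, t, by simp⟩
  obtain ⟨k, p, q, rfl⟩ := hβ.exists_signedPerm
  refine conj_chainLetter_mul (conj_chainLetter_mul ?_ ?_) ?_ e t <;> split_ifs
  exacts [hs, h1, hi, h1, conj_chainLetter_mul (conj_chainLetter_mul hs hi) hs, h1]

/-- The product of letters `σ, τ` or of letters `σ⁻¹, τ⁻¹`. -/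
def chain (e : Bool) (w : List Bool) : MulAut F2 := (w.map (chainLetter e)).prod

@[simp] theorem chain_nil (e : Bool) : chain e [] = 1 := rfl

@[simp] theorem chain_cons (e t : Bool) (w : List Bool) :
    chain e (t :: w) = chainLetter e t * chain e w := by simp [chain]

/-- The automorphisms `β c_g P` with `β` of type (W1) and `P` a chain of length at most `n`. -/
def chainForm (n : ℕ) : Set (MulAut F2) :=
  {ψ | ∃ β g e w, IsTypeW1 β ∧ List.length w ≤ n ∧ ψ = β * MulAut.conj g * chain e w}

theorem chainForm_mono {m n : ℕ} (h : m ≤ n) : chainForm m ⊆ chainForm n := by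
  rintro _ ⟨β, g, e, w, hβ, hw, rfl⟩
  exact ⟨β, g, e, w, hβ, hw.trans h, rfl⟩

theorem one_mem_chainForm (n : ℕ) : 1 ∈ chainForm n :=
  ⟨1, 1, true, [], IsTypeW1.one, by simp, by simp⟩

theorem IsTypeW1.mul_mem_chainForm {β ψ : MulAut F2} {n : ℕ} (hβ : IsTypeW1 β)
    (hψ : ψ ∈ chainForm n) : β * ψ ∈ chainForm n := by
  obtain ⟨γ, g, e, w, hγ, hw, rfl⟩ := hψ
  exact ⟨β * γ, g, e, w, hβ.mul hγ, hw, by group⟩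

theorem conj_mul_mem_chainForm (k : F2) {ψ : MulAut F2} {n : ℕ} (hψ : ψ ∈ chainForm n) :
    MulAut.conj k * ψ ∈ chainForm n := by
  obtain ⟨γ, g, e, w, hγ, hw, rfl⟩ := hψ
  refine ⟨γ, γ⁻¹ k * g, e, w, hγ, hw, ?_⟩
  have := mul_conj_eq γ (γ⁻¹ k)
  rw [MulAut.apply_inv_self] at this
  rw [_root_.map_mul, ← mul_assoc, ← mul_assoc, ← mul_assoc, this]

/-- The rotation relations: `σ⁻¹τσ⁻¹` and `τ⁻¹στ⁻¹` are inner times (W1), so a product of two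
letters of opposite signs can be traded for one letter. -/
theorem chainLetter_mul_chainLetter (e t : Bool) :
    ∃ β g, IsTypeW1 β ∧ chainLetter (!e) t * chainLetter e (!t) =
      β * MulAut.conj g * chainLetter e t := by
  have hst : sigma⁻¹ * tau * sigma⁻¹ = MulAut.conj (of 1) * (swapAut * invA) :=
    aut_ext (by simp [mul_assoc]) (by simp [mul_assoc])
  have hts : tau⁻¹ * sigma * tau⁻¹ = MulAut.conj (of 0) * (swapAut * invB) :=
    aut_ext (by simp [mul_assoc]) (by simp [mul_assoc])
  have hJ := isTypeW1_swapAut.mul isTypeW1_invA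
  have hK := isTypeW1_swapAut.mul isTypeW1_invB
  have hr : ∀ {x y z β : MulAut F2} {g : F2}, x * y * z = MulAut.conj g * β →
      x * y = β * MulAut.conj (β⁻¹ g) * z⁻¹ := by
    intro x y z β g h
    rw [mul_conj_eq, MulAut.apply_inv_self, ← h]
    group
  have hr' : ∀ {x y z β : MulAut F2} {g : F2}, x⁻¹ * y * z⁻¹ = MulAut.conj g * β →
      z * y⁻¹ = β⁻¹ * MulAut.conj g⁻¹ * x⁻¹ := by
    intro x y z β g h
    rw [_root_.map_inv, ← mul_inv_rev, ← h]
    group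
  cases e <;> cases t
  · exact ⟨_, _, hK.inv, hr' hts⟩
  · exact ⟨_, _, hJ.inv, hr' hst⟩
  · exact ⟨_, _, hK, inv_inv tau ▸ hr hts⟩
  · exact ⟨_, _, hJ, inv_inv sigma ▸ hr hst⟩

/-- A letter of the wrong sign either cancels the first letter of the chain or merges with it by the
rotation relation. So one sign is kept throughout, and the length grows by at most one. -/
theorem chainLetter_mul_chain_mem (e t e' : Bool) (w : List Bool) :
    chainLetter e t * chain e' w ∈ chainForm (w.length + 1) := by
  by_cases he : e' = e
  · subst he
    exact ⟨1, 1, e', t :: w, IsTypeW1.one, by simp, by simp⟩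
  obtain rfl : e' = !e := by cases e <;> cases e' <;> simp_all
  cases w with
  | nil => exact ⟨1, 1, e, [t], IsTypeW1.one, by simp, by simp⟩
  | cons s w =>
    by_cases hs : s = t
    · subst hs
      refine ⟨1, 1, !e, w, IsTypeW1.one, by simp; omega, ?_⟩
      rw [chain_cons, chainLetter_not]
      simp
    · obtain rfl : s = !t := by cases s <;> cases t <;> simp_all
      obtain ⟨β, g, hβ, h⟩ := chainLetter_mul_chainLetter (!e) t
      rw [Bool.not_not] at h
      refine ⟨β, g, !e, t :: w, hβ, by simp, ?_⟩
      rw [chain_cons, chain_cons, ← mul_assoc, h]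
      group

theorem chainLetter_mul_mem_chainForm (e t : Bool) {ψ : MulAut F2} {n : ℕ}
    (hψ : ψ ∈ chainForm n) : chainLetter e t * ψ ∈ chainForm (n + 1) := by
  obtain ⟨β, g, e₁, w, hβ, hw, rfl⟩ := hψ
  obtain ⟨k, e', t', h⟩ := hβ.conj_chainLetter e t
  have : chainLetter e t * (β * MulAut.conj g * chain e₁ w) =
      β * (MulAut.conj (k * chainLetter e' t' g) * (chainLetter e' t' * chain e₁ w)) := by
    calc chainLetter e t * (β * MulAut.conj g * chain e₁ w)
        = β * (β⁻¹ * chainLetter e t * β) * MulAut.conj g * chain e₁ w := by group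
      _ = β * MulAut.conj k * (chainLetter e' t' * MulAut.conj g) * chain e₁ w := by
          rw [h]; group
      _ = _ := by rw [mul_conj_eq (chainLetter e' t'), _root_.map_mul]; simp only [mul_assoc]
  rw [this]
  exact chainForm_mono (by omega) (hβ.mul_mem_chainForm (conj_mul_mem_chainForm _
    (chainLetter_mul_chain_mem e' t' e₁ w)))


/-! ### Nielsen reduction and generators of `Aut F_2` -/

namespace FreeGroup

/-- Word length in the free group, as a special case of `wt`. -/
abbrev len {α : Type*} [DecidableEq α] (g : FreeGroup α) : ℕ := wt (fun _ => true) g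

theorem len_eq_norm {α : Type*} [DecidableEq α] (g : FreeGroup α) : len g = g.norm := by
  simp [len, wt, wordWeight, norm]

theorem len_eq_zero {α : Type*} [DecidableEq α] {g : FreeGroup α} : len g = 0 ↔ g = 1 := by
  rw [len_eq_norm, norm_eq_zero]

/-- Here `c` is the length of the conjugator and `r` that of the cyclically reduced core; powers
repeat only the core. -/
theorem len_pow_succ {α : Type*} [DecidableEq α] {g : FreeGroup α} (hg : g ≠ 1) :
    ∃ c r, 0 < r ∧ ∀ n, len (g ^ (n + 1)) = 2 * c + (n + 1) * r := by
  refine ⟨(reduceCyclically.conjugator g.toWord).length, (reduceCyclically g.toWord).length,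
    ?_, fun n => ?_⟩
  · refine Nat.pos_of_ne_zero fun h => hg ?_
    have := reduceCyclically.conj_conjugator_reduceCyclically g.toWord
    rw [List.length_eq_zero_iff.1 h] at this
    rw [← mk_toWord (x := g), ← this, List.append_nil, ← mul_mk, ← inv_mk, mul_inv_cancel]
  · rw [len_eq_norm, norm, toWord_pow,
      reduceCyclically.reduce_flatten_replicate_succ isReduced_toWord]
    simp
    ring

theorem len_lt_len_mul_self {α : Type*} [DecidableEq α] {g : FreeGroup α} (hg : g ≠ 1) :
    len g < len (g * g) := by
  obtain ⟨c, r, hr, h⟩ := len_pow_succ hg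
  have h₀ := h 0
  have h₁ := h 1
  rw [zero_add, pow_one] at h₀
  rw [one_add_one_eq_two, pow_two] at h₁
  omega

theorem len_le_len_pow {α : Type*} [DecidableEq α] (g : FreeGroup α) (n : ℕ) :
    len g ≤ len (g ^ (n + 1)) := by
  by_cases hg : g = 1
  · simp [hg]
  obtain ⟨c, r, hr, h⟩ := len_pow_succ hg
  have h₀ := h 0
  rw [zero_add, pow_one] at h₀
  rw [h, h₀]
  nlinarith

theorem len_mul_comm_inv {α : Type*} [DecidableEq α] (g h : FreeGroup α) :
    len (g⁻¹ * h⁻¹) = len (h * g) := by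
  rw [← mul_inv_rev, len, wt_inv]

end FreeGroup

theorem Letter.elt_eq_one_iff (x : Letter) : x.elt ≠ 1 := by
  intro h
  have := congrArg FreeGroup.norm h
  rw [Letter.elt, FreeGroup.norm, toWord_mk, reduce_singleton] at this
  simp at this

theorem Letter.len_elt (x : Letter) : len x.elt = 1 := by
  rw [len_eq_norm, Letter.elt, FreeGroup.norm, toWord_mk, reduce_singleton]
  rfl

theorem exists_letter_of_len_eq_one {g : F2} (h : len g = 1) : ∃ x : Letter, g = x.elt := by
  rw [len_eq_norm, FreeGroup.norm, List.length_eq_one_iff] at h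
  obtain ⟨x, hx⟩ := h
  exact ⟨x, by rw [Letter.elt, ← hx, mk_toWord]⟩

/-- Products of the values of a strictly Nielsen reduced map on reduced words. -/
theorem nielsen_reduced_prod (v : Letter → F2)
    (h₁ : ∀ x y : Letter, y ≠ x.inv → len (v x) ≤ len (v x * v y))
    (h₂ : ∀ x y : Letter, y ≠ x.inv → len (v y) ≤ len (v x * v y))
    (h₃ : ∀ x y z : Letter, y ≠ x.inv → z ≠ y.inv →
      len (v x) + len (v z) < len (v x * v y) + len (v y * v z))
    (l : List Letter) (y : Letter) (hl : IsReduced (l ++ [y])) :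
    (∀ z : Letter, z ≠ y.inv → len (((l ++ [y]).map v).prod * v z) + len (v y) =
      len ((l ++ [y]).map v).prod + len (v y * v z)) ∧
    ∀ x ∈ l ++ [y], len (v x) ≤ len ((l ++ [y]).map v).prod := by
  induction l using List.reverseRecOn generalizing y with
  | nil =>
    simp only [List.nil_append, List.map_cons, List.map_nil, List.prod_cons, List.prod_nil,
      mul_one, List.mem_singleton, forall_eq, le_refl, and_true]
    intro z _
    ring
  | append_singleton l t ih =>
    obtain ⟨ih₁, ih₂⟩ := ih t (hl.infix (List.prefix_append _ _).isInfix)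
    have hty : y ≠ t.inv := by
      have h' : IsReduced [t, y] := hl.infix ⟨l, [], by simp⟩
      rw [isReduced_cons_cons] at h'
      rintro rfl
      have := h'.1 rfl
      simp [Letter.inv] at this
    have e : ((l ++ [t] ++ [y]).map v).prod = ((l ++ [t]).map v).prod * v y := by
      simp [mul_assoc]
    rw [e]
    set W := ((l ++ [t]).map v).prod with hW
    have hy := ih₁ y hty
    have ht := ih₂ t (by simp)
    have a₁ := h₁ t y hty
    have a₂ := h₂ t y hty
    constructor
    · intro z hz
      -- This says that the cancellations of `v y` on its two sides do not meet, so what `v z`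
      -- cancels depends on `v y` alone.
      have a₃ := h₃ t y z hty hz
      have p₁ := four_point (fun _ => true) (W * v y) 1 (W * v y * v z) W
      have p₂ := four_point (fun _ => true) (W * v y) 1 W (W * v y * v z)
      have p₃ := four_point (fun _ => true) (W * v y) W 1 (W * v y * v z)
      have e₁ : treeDist (fun _ => true) (W * v y) (W * v y * v z) = len (v z) := by
        rw [treeDist, inv_mul_cancel_left]
      have e₂ : treeDist (fun _ => true) W (W * v y * v z) = len (v y * v z) := by
        rw [treeDist, mul_assoc, inv_mul_cancel_left]
      have e₃ : treeDist (fun _ => true) (W * v y * v z) W = len (v y * v z) := by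
        rw [FreeGroup.treeDist_comm, e₂]
      have e₄ : treeDist (fun _ => true) (W * v y) W = len (v y) := by
        rw [FreeGroup.treeDist_comm, treeDist, inv_mul_cancel_left]
      simp only [treeDist_one_left, treeDist_one_right, e₁, e₂, e₃, e₄] at p₁ p₂ p₃
      simp only [len] at *
      omega
    · intro x hx
      rw [List.mem_append, List.mem_singleton] at hx
      rcases hx with hx | rfl
      · have := ih₂ x hx
        omega
      · omega

/-- The group generated by the elementary automorphisms. -/
def elementary : Subgroup (MulAut F2) :=
  Subgroup.closure ({swapAut, invA, sigma} ∪ Set.range (MulAut.conj : F2 →* MulAut F2))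

theorem swapAut_mem : swapAut ∈ elementary := Subgroup.subset_closure (by simp)

theorem invA_mem : invA ∈ elementary := Subgroup.subset_closure (by simp)

theorem sigma_mem : sigma ∈ elementary := Subgroup.subset_closure (by simp)

theorem conj_mem (g : F2) : MulAut.conj g ∈ elementary := Subgroup.subset_closure (by simp)

theorem IsTypeW1.mem_elementary {β : MulAut F2} (hβ : IsTypeW1 β) : β ∈ elementary := by
  obtain ⟨k, p, q, rfl⟩ := hβ.exists_signedPerm
  have := mul_mem (mul_mem swapAut_mem invA_mem) swapAut_mem
  refine mul_mem (mul_mem ?_ ?_) ?_ <;> split_ifs <;>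
    simp [swapAut_mem, invA_mem, invB, this, one_mem]

theorem exists_typeW1 {x y : Letter} (h : x.1 ≠ y.1) :
    ∃ β, IsTypeW1 β ∧ β (of 0) = x.elt ∧ β (of 1) = y.elt := by
  obtain ⟨i, e⟩ := x
  obtain ⟨j, f⟩ := y
  refine ⟨signedPerm (decide (i = 1)) (!e) (!f), isTypeW1_signedPerm _ _ _, ?_⟩
  fin_cases i <;> fin_cases j <;> cases e <;> cases f <;>
    simp_all [signedPerm, elt_true, elt_false]

/-- The total length of the images of the basis elements. -/
def autCost (φ : MulAut F2) : ℕ := len (φ (of 0)) + len (φ (of 1))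

theorem len_map_inv (φ : MulAut F2) (x : Letter) : len (φ x.inv.elt) = len (φ x.elt) := by
  rw [Letter.elt_inv, _root_.map_inv, len, wt_inv]

theorem autCost_typeW1 (φ : MulAut F2) {β : MulAut F2} {x y : Letter} (h : x.1 ≠ y.1)
    (hx : β (of 0) = x.elt) (hy : β (of 1) = y.elt) :
    autCost φ = len (φ x.elt) + len (φ y.elt) := by
  obtain ⟨i, e⟩ := x
  obtain ⟨j, f⟩ := y
  fin_cases i <;> fin_cases j <;> cases e <;> cases f <;>
    simp_all [autCost, elt_true, elt_false, add_comm]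

/-- An automorphism whose cost is minimal in its double coset. -/
def IsCostMinimal (φ : MulAut F2) : Prop :=
  ∀ γ ∈ elementary, ∀ γ' ∈ elementary, autCost φ ≤ autCost (γ' * φ * γ)

variable {φ : MulAut F2}

/-- The competitor `c_{q⁻¹} φ β σ`, where `β` maps the basis to `x, y`, sends `a` to the conjugate
of `φ(x)φ(y)` and `b` to that of `φ(y)`. Allowing a conjugation is what makes the strict inequality
in `IsCostMinimal.lt_add` possible. -/
theorem IsCostMinimal.conj_le (hφ : IsCostMinimal φ) (q : F2) {x y : Letter} (h : x.1 ≠ y.1) :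
    len (φ x.elt) + len (φ y.elt) ≤
      len (q⁻¹ * (φ x.elt * φ y.elt) * q) + len (q⁻¹ * φ y.elt * q) := by
  obtain ⟨β, hβ, hx, hy⟩ := exists_typeW1 h
  have := hφ _ (mul_mem hβ.mem_elementary sigma_mem) _ (conj_mem q⁻¹)
  rw [autCost_typeW1 φ h hx hy] at this
  simpa [autCost, hx, hy] using this

theorem IsCostMinimal.le_left (hφ : IsCostMinimal φ) {x y : Letter} (h : y ≠ x.inv) :
    len (φ x.elt) ≤ len (φ x.elt * φ y.elt) := by
  by_cases hxy : x.1 = y.1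
  · obtain rfl : y = x := by
      obtain ⟨i, e⟩ := x
      obtain ⟨j, f⟩ := y
      simp only [Letter.inv] at *
      subst hxy
      cases e <;> cases f <;> simp_all
    exact (len_lt_len_mul_self (by simpa using Letter.elt_eq_one_iff y)).le
  · have := hφ.conj_le 1 hxy
    simpa using this

theorem IsCostMinimal.le_right (hφ : IsCostMinimal φ) {x y : Letter} (h : y ≠ x.inv) :
    len (φ y.elt) ≤ len (φ x.elt * φ y.elt) := by
  have := hφ.le_left (x := y.inv) (y := x.inv) (by
    rw [Letter.inv_inv]
    rintro rfl
    exact h rfl)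
  rwa [len_map_inv, Letter.elt_inv, Letter.elt_inv, _root_.map_inv, _root_.map_inv,
    len_mul_comm_inv] at this

/-- The middle factor must not be cancelled completely. Equality would mean that exactly half of it
cancels on each side, with outer factors equal or inverse to each other. In the first case a
conjugation lowers the cost; in the second the middle factor would have a square no longer than
itself. -/
theorem IsCostMinimal.lt_add (hφ : IsCostMinimal φ) {x y z : Letter} (h : y ≠ x.inv)
    (h' : z ≠ y.inv) : len (φ x.elt) + len (φ z.elt) <
      len (φ x.elt * φ y.elt) + len (φ y.elt * φ z.elt) := by
  have hy1 : φ y.elt ≠ 1 := by simpa using Letter.elt_eq_one_iff y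
  have l₁ := hφ.le_left h
  have l₂ := hφ.le_right h'
  by_cases hxy : x = y
  · subst hxy
    have := len_lt_len_mul_self hy1
    omega
  by_cases hyz : y = z
  · subst hyz
    have := len_lt_len_mul_self hy1
    omega
  have l₃ := hφ.le_right h
  by_contra hlt
  have e₁ : len (φ x.elt * φ y.elt) = len (φ x.elt) := by omega
  have e₂ : len (φ y.elt * φ z.elt) = len (φ z.elt) := by omega
  have hsq := len_lt_len_mul_self hy1
  have hx1 : x.1 ≠ y.1 := by
    obtain ⟨i, e⟩ := x
    obtain ⟨j, f⟩ := y
    simp only [Letter.inv] at *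
    rintro rfl
    cases e <;> cases f <;> simp_all
  have hzx : z = x ∨ z = x.inv := by
    obtain ⟨i, e⟩ := x
    obtain ⟨j, f⟩ := y
    obtain ⟨k, g⟩ := z
    simp only [Letter.inv] at *
    fin_cases i <;> fin_cases j <;> fin_cases k <;> cases e <;> cases f <;> cases g <;> simp_all
  have hmin := fun q => hφ.conj_le q hx1
  have hz : len (φ z.elt) = len (φ x.elt) := by
    rcases hzx with rfl | rfl
    · rfl
    · rw [len_map_inv]
  have hz' : φ z.elt = φ x.elt ∨ φ z.elt = (φ x.elt)⁻¹ := by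
    rcases hzx with rfl | rfl
    · exact Or.inl rfl
    · right; rw [Letter.elt_inv, _root_.map_inv]
  rw [hz] at e₂
  generalize φ x.elt = X at *
  generalize φ y.elt = Y at *
  generalize φ z.elt = Z at *
  rcases hz' with rfl | rfl
  -- Equal outer factors. Since `|ZY| = |Z|`, the length of `Y` is even. Conjugation by the first
  -- half `q` of `Y⁻¹` does not lengthen `Y`, but it shortens `ZY` strictly below `|Z|`.
  · have par := treeDist_parity (fun _ => true) 1 Z (Z * Y)
    have e₃ : treeDist (fun _ => true) Z (Z * Y) = len Y := by simp [treeDist]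
    rw [e₃, treeDist_one_left, treeDist_one_left] at par
    obtain ⟨q, hq, hqY⟩ := exists_prefix (fun _ => true) Y⁻¹ (t := len Y / 2) (by
      rw [wt_inv]; exact Nat.div_le_self _ _)
    rw [wt_inv] at hqY
    have hYq : len (Y * q) = len (q⁻¹ * Y⁻¹) := by rw [← mul_inv_rev, len, len, wt_inv]
    have hYpos : len Y ≠ 0 := fun h0 => hy1 (len_eq_zero.1 h0)
    -- `q` lies on the segments from `1` to `Y⁻¹` and to `Z`
    have p₁ := four_point (fun _ => true) 1 q Y⁻¹ Z
    have p₂ := four_point (fun _ => true) 1 (Y * q) Y Z⁻¹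
    have p₃ := four_point (fun _ => true) 1 q Z (Z * (Y * q))
    have f₁ : treeDist (fun _ => true) q Y⁻¹ = len (q⁻¹ * Y⁻¹) := rfl
    have f₂ : treeDist (fun _ => true) Y⁻¹ Z = len (Y * Z) := by simp [treeDist]
    have f₃ : treeDist (fun _ => true) (Y * q) Y = len q := by
      rw [FreeGroup.treeDist_comm, treeDist, inv_mul_cancel_left]
    have f₄ : treeDist (fun _ => true) Y Z⁻¹ = len (Z * Y) := by
      exact len_mul_comm_inv _ _
    have f₅ : treeDist (fun _ => true) (Y * q) Z⁻¹ = len (Z * (Y * q)) := by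
      exact len_mul_comm_inv _ _
    have f₆ : treeDist (fun _ => true) Z (Z * (Y * q)) = len (Y * q) := by
      rw [treeDist, inv_mul_cancel_left]
    have f₇ : treeDist (fun _ => true) q (Z * (Y * q)) = len (q⁻¹ * (Z * Y) * q) := by
      rw [treeDist]; congr 1; group
    have t₁ := wt_mul_le (fun _ => true) q⁻¹ (Y * q)
    rw [← mul_assoc, wt_inv] at t₁
    have hm := hmin q
    simp only [treeDist_one_left, f₁, f₂, f₃, f₄, f₅, f₆, f₇, wt_inv] at p₁ p₂ p₃
    simp only [len] at *
    omega
  -- Inverse outer factors. Both `Y` and `Y⁻¹` share half their length with `X⁻¹`, hence with each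
  -- other, which forces `|YY| ≤ |Y|`.
  · have p₁ := four_point (fun _ => true) 1 Y X⁻¹ Y⁻¹
    have f₁ : treeDist (fun _ => true) Y X⁻¹ = len (X * Y) := by exact len_mul_comm_inv _ _
    have f₂ : treeDist (fun _ => true) Y Y⁻¹ = len (Y * Y) := by exact len_mul_comm_inv _ _
    have f₃ : treeDist (fun _ => true) X⁻¹ Y⁻¹ = len (Y * X⁻¹) := by
      rw [FreeGroup.treeDist_comm, treeDist, inv_inv]
    simp only [treeDist_one_left, f₁, f₂, f₃, wt_inv] at p₁
    simp only [len] at *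
    omega

/-- Nielsen reducedness: no factor is longer than the whole product of the images of the letters of
`g`. -/
theorem IsCostMinimal.len_le_one (hφ : IsCostMinimal φ) (g : F2) (hg : len (φ g) ≤ 1) {x : Letter}
    (hx : x ∈ g.toWord) : len (φ x.elt) ≤ 1 := by
  rcases List.eq_nil_or_concat g.toWord with h | ⟨l, y, h⟩
  · simp [h] at hx
  have hr : IsReduced (l ++ [y]) := by
    rw [← List.concat_eq_append, ← h]
    exact isReduced_toWord
  have := (nielsen_reduced_prod (fun x => φ x.elt) (fun _ _ => hφ.le_left)
    (fun _ _ => hφ.le_right) (fun _ _ _ => hφ.lt_add) l y hr).2 x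
    (by rwa [← List.concat_eq_append, ← h])
  have key : ∀ L : List Letter, (L.map fun x => φ x.elt).prod = φ (mk L) := by
    intro L
    induction L with
    | nil => simp [← one_eq_mk]
    | cons z L ih =>
      rw [List.map_cons, List.prod_cons, ih, ← _root_.map_mul, Letter.elt, mul_mk]
      rfl
  rw [key, ← List.concat_eq_append, ← h, mk_toWord] at this
  exact this.trans hg

theorem commute_of_forall_index {i : Fin 2} {g : F2} (h : ∀ x ∈ g.toWord, x.1 = i) :
    ∃ n : ℤ, g = of i ^ n := by
  rw [← mk_toWord (x := g)]
  generalize g.toWord = L at h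
  induction L with
  | nil => exact ⟨0, rfl⟩
  | cons x L ih =>
    obtain ⟨n, hn⟩ := ih fun y hy => h y (List.mem_cons_of_mem _ hy)
    obtain ⟨j, e⟩ := x
    obtain rfl : j = i := h (j, e) (by simp)
    have : mk ((j, e) :: L) = Letter.elt (j, e) * mk L := by rw [Letter.elt, mul_mk]; rfl
    rw [this, hn]
    cases e
    · exact ⟨-1 + n, by rw [elt_false, zpow_add, zpow_neg_one]⟩
    · exact ⟨1 + n, by rw [elt_true, zpow_add, zpow_one]⟩

theorem IsCostMinimal.isTypeW1 (hφ : IsCostMinimal φ) : IsTypeW1 φ := by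
  have hlet : ∀ i, len (of i : F2) = 1 := fun i => Letter.len_elt (i, true)
  have key : ∀ j : Fin 2, len (φ (of j)) = 1 := by
    intro j
    have hne : len (φ (of j)) ≠ 0 := fun h => by
      have := len_eq_zero.1 h
      simp at this
    suffices h : ∃ g x, len (φ g) ≤ 1 ∧ x ∈ g.toWord ∧ x.1 = j by
      obtain ⟨g, x, hg, hx, rfl⟩ := h
      have := hφ.len_le_one g hg hx
      obtain ⟨i, e⟩ := x
      have : len (φ (of i)) ≤ 1 := by
        cases e
        · rwa [elt_false, _root_.map_inv, len, wt_inv] at this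
        · rwa [elt_true] at this
      exact le_antisymm this (Nat.one_le_iff_ne_zero.2 hne)
    -- If a basis element occurred in neither preimage `φ⁻¹(a)`, `φ⁻¹(b)`, both would be powers of
    -- the other basis element and would commute.
    by_contra! hcon
    obtain ⟨i, hij⟩ : ∃ i : Fin 2, ∀ k : Fin 2, k ≠ j → k = i := by
      fin_cases j
      · exact ⟨1, by decide⟩
      · exact ⟨0, by decide⟩
    have hp : ∀ k, ∃ n : ℤ, φ⁻¹ (of k) = of i ^ n := fun k =>
      commute_of_forall_index fun x hx => hij _ (hcon (φ⁻¹ (of k)) x (by simp [hlet]) hx)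
    obtain ⟨m, hm⟩ := hp 0
    obtain ⟨n, hn⟩ := hp 1
    apply of_zero_mul_of_one_ne
    apply (φ⁻¹).injective
    rw [_root_.map_mul, _root_.map_mul, hm, hn, ← zpow_add, ← zpow_add, add_comm]
  obtain ⟨x, hx⟩ := exists_letter_of_len_eq_one (key 0)
  obtain ⟨y, hy⟩ := exists_letter_of_len_eq_one (key 1)
  exact isTypeW1_of_letters hx hy

/-- An element of least cost in the double coset of `φ` is of type (W1), hence itself elementary. -/
theorem elementary_eq_top : elementary = ⊤ := by
  rw [eq_top_iff]
  intro φ _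
  let S : Set (MulAut F2) := {ψ | ∃ γ ∈ elementary, ∃ γ' ∈ elementary, ψ = γ' * φ * γ}
  obtain ⟨ψ, hψ, hmin⟩ := WellFounded.has_min (InvImage.wf autCost Nat.lt_wfRel.wf) S
    ⟨φ, 1, one_mem _, 1, one_mem _, by simp⟩
  obtain ⟨γ, hγ, γ', hγ', rfl⟩ := hψ
  have : IsCostMinimal (γ' * φ * γ) := by
    intro δ hδ δ' hδ'
    refine not_lt.1 (hmin _ ⟨γ * δ, mul_mem hγ hδ, δ' * γ', mul_mem hδ' hγ', by group⟩)
  have h := this.isTypeW1.mem_elementary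
  have h2 := mul_mem (mul_mem (inv_mem hγ') h) (inv_mem hγ)
  simpa [mul_assoc] using h2

theorem exists_mem_chainForm (φ : MulAut F2) : ∃ n, φ ∈ chainForm n := by
  have hφ : φ ∈ elementary := elementary_eq_top ▸ Subgroup.mem_top φ
  induction hφ using Subgroup.closure_induction_left with
  | one => exact ⟨0, one_mem_chainForm 0⟩
  | mul_left x hx y hy ih =>
    obtain ⟨n, hn⟩ := ih
    rcases hx with (rfl | rfl | rfl) | ⟨g, rfl⟩
    · exact ⟨n, isTypeW1_swapAut.mul_mem_chainForm hn⟩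
    · exact ⟨n, isTypeW1_invA.mul_mem_chainForm hn⟩
    · exact ⟨n + 1, chainLetter_mul_mem_chainForm true true hn⟩
    · exact ⟨n, conj_mul_mem_chainForm g hn⟩
  | inv_mul_cancel x hx y hy ih =>
    obtain ⟨n, hn⟩ := ih
    rcases hx with (rfl | rfl | rfl) | ⟨g, rfl⟩
    · exact ⟨n, isTypeW1_swapAut.inv.mul_mem_chainForm hn⟩
    · exact ⟨n, isTypeW1_invA.inv.mul_mem_chainForm hn⟩
    · exact ⟨n + 1, chainLetter_mul_mem_chainForm false true hn⟩
    · exact ⟨n, by rw [← _root_.map_inv]; exact conj_mul_mem_chainForm g⁻¹ hn⟩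


/-! ### The action on the abelianization and its kernel -/

/-- The exponent sums of an element of `F_2`. -/
def ex (g : F2) : Fin 2 → ℤ :=
  Multiplicative.toAdd (FreeGroup.lift (fun i => Multiplicative.ofAdd (Pi.single i (1 : ℤ))) g)

@[simp] theorem ex_one : ex 1 = 0 := by simp [ex]

@[simp] theorem ex_mul (g h : F2) : ex (g * h) = ex g + ex h := by simp [ex]

@[simp] theorem ex_inv (g : F2) : ex g⁻¹ = -ex g := by simp [ex]

@[simp] theorem ex_of (i : Fin 2) : ex (of i) = Pi.single i 1 := by simp [ex]

@[simp] theorem ex_zpow (g : F2) (n : ℤ) : ex (g ^ n) = n • ex g := by simp [ex]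

/-- The matrix of an automorphism on the abelianization. -/
def abMat (φ : MulAut F2) : Matrix (Fin 2) (Fin 2) ℤ := Matrix.of fun i j => ex (φ (of j)) i

theorem abMat_apply (φ : MulAut F2) (i j : Fin 2) : abMat φ i j = ex (φ (of j)) i := rfl

theorem ex_map (φ : MulAut F2) (g : F2) : ex (φ g) = (abMat φ).mulVec (ex g) := by
  induction g using FreeGroup.induction_on with
  | C1 => simp
  | of i =>
    ext j
    simp [abMat_apply]
  | inv_of i h => rw [_root_.map_inv, ex_inv, h, ex_inv, Matrix.mulVec_neg]
  | mul x y hx hy => rw [_root_.map_mul, ex_mul, hx, hy, ex_mul, Matrix.mulVec_add]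

theorem abMat_mul (φ ψ : MulAut F2) : abMat (φ * ψ) = abMat φ * abMat ψ := by
  ext i j
  rw [abMat_apply, MulAut.mul_apply, ex_map]
  rfl

@[simp] theorem abMat_one : abMat 1 = 1 := by
  ext i j
  rw [abMat_apply, MulAut.one_apply, ex_of, Matrix.one_apply, Pi.single_apply]

@[simp] theorem abMat_conj (g : F2) : abMat (MulAut.conj g) = 1 := by
  ext i j
  rw [abMat_apply, MulAut.conj_apply, ex_mul, ex_mul, ex_inv, ex_of, Matrix.one_apply]
  simp [Pi.single_apply]

theorem abMat_inv_mul (φ : MulAut F2) : abMat φ⁻¹ * abMat φ = 1 := by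
  rw [← abMat_mul, inv_mul_cancel, abMat_one]

theorem abMat_mul_inv (φ : MulAut F2) : abMat φ * abMat φ⁻¹ = 1 := by
  rw [← abMat_mul, mul_inv_cancel, abMat_one]

theorem det_abMat (φ : MulAut F2) : (abMat φ).det = 1 ∨ (abMat φ).det = -1 := by
  have := congrArg Matrix.det (abMat_mul_inv φ)
  rw [Matrix.det_mul, Matrix.det_one] at this
  exact Int.isUnit_iff.1 (IsUnit.of_mul_eq_one _ this)

theorem abMat_sigma : abMat sigma = !![1, 0; 1, 1] := by
  ext i j
  fin_cases i <;> fin_cases j <;> simp [abMat_apply]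

theorem abMat_tau : abMat tau = !![1, 1; 0, 1] := by
  ext i j
  fin_cases i <;> fin_cases j <;> simp [abMat_apply]

theorem abMat_sigma_inv : abMat sigma⁻¹ = !![1, 0; -1, 1] := by
  ext i j
  fin_cases i <;> fin_cases j <;> simp [abMat_apply]

theorem abMat_tau_inv : abMat tau⁻¹ = !![1, -1; 0, 1] := by
  ext i j
  fin_cases i <;> fin_cases j <;> simp [abMat_apply]

/-- The sign of the off-diagonal entries of the matrix of a chain. -/
def chainSign (e : Bool) : ℤ := if e then 1 else -1

theorem abMat_chainLetter (e t : Bool) : abMat (chainLetter e t) =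
    if t then !![1, 0; chainSign e, 1] else !![1, chainSign e; 0, 1] := by
  cases e <;> cases t <;>
    simp [chainLetter, chainSign, abMat_sigma, abMat_tau, abMat_sigma_inv, abMat_tau_inv]

/-- Up to the sign of the off-diagonal entries, a chain has a nonnegative matrix with row sums at
least one. Each further letter adds one row to the other, so the total grows with the length. -/
theorem abMat_chain_bounds (e : Bool) (w : List Bool) :
    0 ≤ abMat (chain e w) 0 0 ∧ 0 ≤ abMat (chain e w) 1 1 ∧
    0 ≤ chainSign e * abMat (chain e w) 0 1 ∧ 0 ≤ chainSign e * abMat (chain e w) 1 0 ∧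
    1 ≤ abMat (chain e w) 0 0 + chainSign e * abMat (chain e w) 0 1 ∧
    1 ≤ abMat (chain e w) 1 1 + chainSign e * abMat (chain e w) 1 0 ∧
    2 + (w.length : ℤ) ≤ abMat (chain e w) 0 0 + chainSign e * abMat (chain e w) 0 1 +
      (abMat (chain e w) 1 1 + chainSign e * abMat (chain e w) 1 0) := by
  induction w with
  | nil => simp
  | cons t w ih =>
    rw [chain_cons, abMat_mul, abMat_chainLetter]
    generalize abMat (chain e w) = M at ih
    have hs : chainSign e * chainSign e = 1 := by cases e <;> simp [chainSign]
    cases t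
    · simp only [Bool.false_eq_true, if_false, Matrix.mul_apply, Fin.sum_univ_two,
        Matrix.of_apply, Matrix.cons_val', Matrix.cons_val_zero, Matrix.cons_val_one,
        Matrix.cons_val_fin_one, List.length_cons, Nat.cast_add, Nat.cast_one, one_mul, zero_mul,
        zero_add]
      have h1 : chainSign e * (M 0 1 + chainSign e * M 1 1) =
        chainSign e * M 0 1 + M 1 1 := by rw [mul_add, ← mul_assoc, hs, one_mul]
      rw [h1]
      omega
    · simp only [if_true, Matrix.mul_apply, Fin.sum_univ_two,
        Matrix.of_apply, Matrix.cons_val', Matrix.cons_val_zero, Matrix.cons_val_one,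
        Matrix.cons_val_fin_one, List.length_cons, Nat.cast_add, Nat.cast_one, one_mul, zero_mul,
        add_zero]
      have h1 : chainSign e * (chainSign e * M 0 0 + M 1 0) =
        M 0 0 + chainSign e * M 1 0 := by rw [mul_add, ← mul_assoc, hs, one_mul]
      rw [h1]
      omega

theorem ex_elt (x : Letter) : |ex x.elt 0| + |ex x.elt 1| = 1 := by
  obtain ⟨i, e⟩ := x
  fin_cases i <;> cases e <;> simp [elt_true, elt_false]

theorem IsTypeW1.abs_abMat {β : MulAut F2} (hβ : IsTypeW1 β) :
    |abMat β 0 0| + |abMat β 1 0| + (|abMat β 0 1| + |abMat β 1 1|) = 2 := by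
  obtain ⟨x, hx⟩ := hβ.exists_letter (0, true)
  obtain ⟨y, hy⟩ := hβ.exists_letter (1, true)
  rw [elt_true] at hx hy
  simp only [abMat_apply, hx, hy, ex_elt]
  norm_num

theorem IsTypeW1.eq_one {β : MulAut F2} (hβ : IsTypeW1 β) (h : abMat β = 1) : β = 1 := by
  have key : ∀ i, β (of i) = of i := by
    intro i
    obtain ⟨⟨j, e⟩, hx⟩ := hβ.exists_letter (i, true)
    have h₀ : abMat β 0 i = ex (Letter.elt (j, e)) 0 := by rw [abMat_apply, ← hx, elt_true]
    have h₁ : abMat β 1 i = ex (Letter.elt (j, e)) 1 := by rw [abMat_apply, ← hx, elt_true]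
    rw [elt_true] at hx
    rw [hx]
    rw [h] at h₀ h₁
    fin_cases i <;> fin_cases j <;> cases e <;>
      simp_all [elt_true, elt_false, Matrix.one_apply]
  exact aut_ext (key 0) (key 1)

/-- An automorphism that acts trivially on the abelianization is inner. -/
theorem exists_conj_of_abMat_eq_one {φ : MulAut F2} (h : abMat φ = 1) :
    ∃ g, φ = MulAut.conj g := by
  obtain ⟨n, β, g, e, w, hβ, -, rfl⟩ := exists_mem_chainForm φ
  rw [abMat_mul, abMat_mul, abMat_conj, mul_one] at h
  have h' : abMat (chain e w) = abMat β⁻¹ := by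
    calc abMat (chain e w) = abMat β⁻¹ * abMat β * abMat (chain e w) := by
          rw [abMat_inv_mul, one_mul]
      _ = _ := by rw [mul_assoc, h, mul_one]
  have b := abMat_chain_bounds e w
  have hs := hβ.inv.abs_abMat
  rw [← h'] at hs
  -- The matrix of a (W1) automorphism has absolute entry sum 2, which leaves no room for a letter.
  have hw : w = [] := by
    rw [← List.length_eq_zero_iff]
    have l₁ : chainSign e * abMat (chain e w) 0 1 ≤ |abMat (chain e w) 0 1| := by
      cases e <;> simp [chainSign, le_abs_self, neg_le_abs]
    have l₂ : chainSign e * abMat (chain e w) 1 0 ≤ |abMat (chain e w) 1 0| := by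
      cases e <;> simp [chainSign, le_abs_self, neg_le_abs]
    have l₃ := le_abs_self (abMat (chain e w) 0 0)
    have l₄ := le_abs_self (abMat (chain e w) 1 1)
    omega
  subst hw
  rw [chain_nil, abMat_one, mul_one] at h
  exact ⟨g, by rw [hβ.eq_one h, chain_nil]; simp⟩

theorem exists_conj_mul_of_abMat_eq {φ ψ : MulAut F2} (h : abMat φ = abMat ψ) :
    ∃ g, φ = MulAut.conj g * ψ := by
  obtain ⟨g, hg⟩ := exists_conj_of_abMat_eq_one (φ := φ * ψ⁻¹)
    (by rw [abMat_mul, h, abMat_mul_inv])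
  exact ⟨g, by rw [← hg]; group⟩

/-! ### Primitive vectors and Euclid's algorithm -/

/-- Multiplication by `α` or `α⁻¹` lengthens chains by at most `n`. -/
def IsShort (n : ℕ) (α : MulAut F2) : Prop :=
  ∀ m, ∀ ψ ∈ chainForm m, α * ψ ∈ chainForm (m + n) ∧ α⁻¹ * ψ ∈ chainForm (m + n)

theorem IsShort.mul {m n : ℕ} {α β : MulAut F2} (hα : IsShort m α) (hβ : IsShort n β) :
    IsShort (m + n) (α * β) := by
  intro k ψ hψ
  constructor
  · rw [mul_assoc, add_comm m, ← add_assoc]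
    exact (hα _ _ (hβ _ _ hψ).1).1
  · rw [mul_inv_rev, mul_assoc, ← add_assoc]
    exact (hβ _ _ (hα _ _ hψ).2).2

theorem IsShort.mono {m n : ℕ} {α : MulAut F2} (hα : IsShort m α) (h : m ≤ n) : IsShort n α :=
  fun k ψ hψ => ⟨chainForm_mono (by omega) (hα k ψ hψ).1, chainForm_mono (by omega) (hα k ψ hψ).2⟩

theorem IsShort.inv {n : ℕ} {α : MulAut F2} (hα : IsShort n α) : IsShort n α⁻¹ :=
  fun k ψ hψ => ⟨(hα k ψ hψ).2, by rw [inv_inv]; exact (hα k ψ hψ).1⟩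

theorem IsTypeW1.isShort {β : MulAut F2} (hβ : IsTypeW1 β) : IsShort 0 β :=
  fun _ _ hψ => ⟨hβ.mul_mem_chainForm hψ, hβ.inv.mul_mem_chainForm hψ⟩

theorem isShort_chainLetter (e t : Bool) : IsShort 1 (chainLetter e t) := fun m ψ hψ =>
  ⟨chainLetter_mul_mem_chainForm e t hψ, by
    rw [← chainLetter_not]; exact chainLetter_mul_mem_chainForm (!e) t hψ⟩

theorem IsShort.mem_chainForm {n : ℕ} {α : MulAut F2} (hα : IsShort n α) : α ∈ chainForm n := by
  have := (hα 0 1 (one_mem_chainForm 0)).1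
  rwa [mul_one, zero_add] at this

/-- Every primitive vector is the image of a primitive element. -/
theorem exists_isShort_of_isCoprime {p q : ℤ} (h : IsCoprime p q) :
    ∃ α, IsShort (p.natAbs + q.natAbs) α ∧ ex (α (of 0)) = ![p, q] := by
  induction hn : p.natAbs + q.natAbs using Nat.strong_induction_on generalizing p q with
  | _ n ih =>
    subst hn
    by_cases hq : q = 0
    · subst hq
      rw [isCoprime_zero_right, Int.isUnit_iff] at h
      rcases h with rfl | rfl
      · exact ⟨1, IsTypeW1.one.isShort.mono (by simp), by ext i; fin_cases i <;> simp⟩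
      · exact ⟨invA, isTypeW1_invA.isShort.mono (by simp), by ext i; fin_cases i <;> simp⟩
    by_cases hp : p = 0
    · subst hp
      rw [isCoprime_zero_left, Int.isUnit_iff] at h
      rcases h with rfl | rfl
      · exact ⟨swapAut, isTypeW1_swapAut.isShort.mono (by simp), by ext i; fin_cases i <;> simp⟩
      · exact ⟨invB * swapAut, (isTypeW1_invB.mul isTypeW1_swapAut).isShort.mono (by simp),
          by ext i; fin_cases i <;> simp⟩
    -- One step of the subtractive Euclidean algorithm costs one chain letter and lowers `|p| +
    -- |q|`; the sign is chosen so that subtracting the smaller coordinate shrinks the larger.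
    obtain ⟨e, he⟩ : ∃ e, 0 < chainSign e * (p * q) := by
      rcases lt_or_gt_of_ne (mul_ne_zero hp hq) with h | h
      · exact ⟨false, by simpa [chainSign] using h⟩
      · exact ⟨true, by simpa [chainSign] using h⟩
    have hs : chainSign e = 1 ∨ chainSign e = -1 := by cases e <;> simp [chainSign]
    by_cases hpq : q.natAbs ≤ p.natAbs
    · have hlt : (p - chainSign e * q).natAbs < p.natAbs := by
        rcases hs with hs | hs <;> rw [hs] at he ⊢
        · rcases (pos_iff_pos_of_mul_pos (by simpa using he) : 0 < p ↔ 0 < q) with h1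
          omega
        · have h2 : 0 < (-p) * q := by linarith
          have h1 : 0 < -p ↔ 0 < q := pos_iff_pos_of_mul_pos h2
          omega
      obtain ⟨α, hα, hv⟩ := ih ((p - chainSign e * q).natAbs + q.natAbs) (by omega)
        (p := p - chainSign e * q) (q := q) (by
          obtain ⟨u, v, huv⟩ := h
          exact ⟨u, v + u * chainSign e, by rw [← huv]; ring⟩) rfl
      refine ⟨chainLetter e false * α, ((isShort_chainLetter e false).mul hα).mono (by omega), ?_⟩
      rw [MulAut.mul_apply, ex_map, hv, abMat_chainLetter]
      ext i
      fin_cases i <;> simp [mul_comm]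
    · have hlt : (q - chainSign e * p).natAbs < q.natAbs := by
        rcases hs with hs | hs <;> rw [hs] at he ⊢
        · rcases (pos_iff_pos_of_mul_pos (by simpa using he) : 0 < p ↔ 0 < q) with h1
          omega
        · have h2 : 0 < (-p) * q := by linarith
          have h1 : 0 < -p ↔ 0 < q := pos_iff_pos_of_mul_pos h2
          omega
      obtain ⟨α, hα, hv⟩ := ih (p.natAbs + (q - chainSign e * p).natAbs) (by omega)
        (p := p) (q := q - chainSign e * p) (by
          obtain ⟨u, v, huv⟩ := h
          exact ⟨u + v * chainSign e, v, by rw [← huv]; ring⟩) rfl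
      refine ⟨chainLetter e true * α, ((isShort_chainLetter e true).mul hα).mono (by omega), ?_⟩
      rw [MulAut.mul_apply, ex_map, hv, abMat_chainLetter]
      ext i
      fin_cases i <;> simp [mul_comm]

theorem tau_zpow_zero (n : ℤ) : (tau ^ n) (of 0) = of 0 := by
  induction n using Int.induction_on with
  | zero => simp
  | succ n ih => rw [zpow_add_one, MulAut.mul_apply, tau_zero, ih]
  | pred n ih =>
    rw [zpow_sub_one, MulAut.mul_apply]
    simpa using ih

theorem tau_zpow_one (n : ℤ) : (tau ^ n) (of 1) = of 1 * of 0 ^ n := by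
  induction n using Int.induction_on with
  | zero => simp
  | succ n ih =>
    rw [zpow_add_one, MulAut.mul_apply, tau_one, _root_.map_mul, ih, tau_zpow_zero, zpow_add_one,
      mul_assoc]
  | pred n ih =>
    have : tau⁻¹ (of 1) = of 1 * (of 0)⁻¹ := by simp
    rw [zpow_sub_one, MulAut.mul_apply, this, _root_.map_mul, ih, _root_.map_inv, tau_zpow_zero,
      zpow_sub_one, mul_assoc]


/-! ### The tree of the letter `b` and the parabolic automorphisms -/

/-- The number of letters `b^{±1}` in the reduced word. -/
abbrev wtB (g : F2) : ℕ := wt (fun i : Fin 2 => decide (i = 1)) g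

theorem wtB_elt (x : Letter) : wtB x.elt = if x.1 = 1 then 1 else 0 := by
  rw [wtB, wt, Letter.elt, toWord_mk, reduce_singleton]
  simp [wordWeight]

theorem wtB_of_zero : wtB (of 0) = 0 := by rw [← elt_true, wtB_elt]; rfl

theorem wtB_of_one : wtB (of 1) = 1 := by rw [← elt_true, wtB_elt]; rfl

theorem wt_zpow_eq_zero {α : Type*} [DecidableEq α] (B : α → Bool) {g : FreeGroup α}
    (h : wt B g = 0) (n : ℤ) : wt B (g ^ n) = 0 := by
  induction n using Int.induction_on with
  | zero => simp
  | succ n ih =>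
    have := wt_mul_le B (g ^ (n : ℤ)) g
    rw [zpow_add_one]
    omega
  | pred n ih =>
    have := wt_mul_le B (g ^ (-(n : ℤ))) g⁻¹
    rw [wt_inv] at this
    rw [zpow_sub_one]
    omega

theorem wtB_zpow (n : ℤ) : wtB (of 0 ^ n) = 0 := wt_zpow_eq_zero _ wtB_of_zero n

theorem exists_zpow_of_wtB_eq_zero {g : F2} (h : wtB g = 0) : ∃ n : ℤ, g = of 0 ^ n := by
  refine commute_of_forall_index fun x hx => ?_
  rw [wtB, wt, wordWeight, List.countP_eq_zero] at h
  have := h x hx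
  obtain ⟨i, e⟩ := x
  fin_cases i <;> simp_all

theorem wt_mul_left_of_zero {α : Type*} [DecidableEq α] (B : α → Bool) {p : FreeGroup α}
    (h : wt B p = 0) (x : FreeGroup α) : wt B (p * x) = wt B x := by
  have h₁ := wt_mul_le B p x
  have h₂ := wt_mul_le B p⁻¹ (p * x)
  rw [inv_mul_cancel_left, wt_inv] at h₂
  omega

theorem exists_first_b {u : F2} (h : 0 < wtB u) : ∃ (i : ℤ) (x u' : F2),
    (x = of 1 ∨ x = (of 1)⁻¹) ∧ u = of 0 ^ i * x * u' ∧ wtB u = 1 + wtB u' ∧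
      wtB (x * u') = 1 + wtB u' := by
  obtain ⟨p, b, q, hpq, hp, hb⟩ : ∃ (p : List Letter) (b : Letter) (q : List Letter), u.toWord = p ++ b :: q ∧
      wordWeight (fun i : Fin 2 => decide (i = 1)) p = 0 ∧ b.1 = 1 := by
    have key : ∀ L : List Letter, 0 < wordWeight (fun i : Fin 2 => decide (i = 1)) L →
        ∃ p b q, L = p ++ b :: q ∧
        wordWeight (fun i : Fin 2 => decide (i = 1)) p = 0 ∧ b.1 = 1 := by
      intro L
      induction L with
      | nil => simp [wordWeight]
      | cons x L ih =>
        intro h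
        by_cases hx : x.1 = 1
        · exact ⟨[], x, L, rfl, rfl, hx⟩
        · obtain ⟨p, b, q, rfl, hp, hb⟩ := ih (by simpa [wordWeight, hx] using h)
          exact ⟨x :: p, b, q, rfl, by simpa [wordWeight, hx] using hp, hb⟩
    exact key _ h
  have hr : IsReduced (p ++ b :: q) := hpq ▸ isReduced_toWord
  have hpr : reduce p = p := (hr.infix ⟨[], b :: q, by simp⟩).reduce_eq
  have hqr : reduce (b :: q) = b :: q := (hr.infix ⟨p, [], by simp⟩).reduce_eq
  have hqr' : reduce q = q := (hr.infix ⟨p ++ [b], [], by simp⟩).reduce_eq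
  obtain ⟨i, hi⟩ := exists_zpow_of_wtB_eq_zero (g := mk p) (by rw [wtB, wt, toWord_mk, hpr, hp])
  have e₁ : mk (b :: q) = b.elt * mk q := by rw [Letter.elt, mul_mk]; rfl
  have e₂ : wtB (mk (b :: q)) = 1 + wtB (mk q) := by
    rw [wtB, wtB, wt, wt, toWord_mk, toWord_mk, hqr, hqr']
    simp [wordWeight, hb, add_comm]
  have e₃ : u = of 0 ^ i * mk (b :: q) := by rw [← hi, mul_mk, ← hpq, mk_toWord]
  refine ⟨i, b.elt, mk q, ?_, by rw [e₃, e₁, mul_assoc], ?_, by rw [← e₁, e₂]⟩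
  · obtain ⟨j, e⟩ := b
    obtain rfl : j = 1 := hb
    cases e <;> simp [elt_true, elt_false]
  · rw [e₃, wtB, wt_mul_left_of_zero _ (wtB_zpow i)]
    exact e₂

/-- Every letter `b^{±1}` contributes `±1` to the exponent sum of `b`. -/
theorem ex_one_parity (g : F2) : |ex g 1| ≤ wtB g ∧ (ex g 1 - wtB g) % 2 = 0 := by
  induction hn : wtB g generalizing g with
  | zero =>
    obtain ⟨n, rfl⟩ := exists_zpow_of_wtB_eq_zero hn
    simp
  | succ n ih =>
    obtain ⟨i, x, u, hx, rfl, hu, -⟩ := exists_first_b (u := g) (by omega)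
    have := ih u (by omega)
    rcases hx with rfl | rfl
    · simp only [ex_mul, ex_zpow, ex_of, Pi.add_apply, Pi.smul_apply] at *
      simp at *
      rw [abs_le] at *
      omega
    · simp only [ex_mul, ex_zpow, ex_of, ex_inv, Pi.add_apply, Pi.smul_apply] at *
      simp at *
      rw [abs_le] at *
      omega

/-- Parity leaves only the weights 0 and 2, and weight 0 would mean that a nontrivial power of `a`
fixes an edge. -/
theorem wtB_conj_zpow {x : F2} (hx : x = of 1 ∨ x = (of 1)⁻¹) {i : ℤ} (hi : i ≠ 0) :
    wtB (x⁻¹ * of 0 ^ i * x) = 2 := by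
  have hx1 : wtB x = 1 := by
    rcases hx with rfl | rfl <;> simp [wtB_of_one]
  have h₁ := wt_mul_le (fun i : Fin 2 => decide (i = 1)) (x⁻¹ * of 0 ^ i) x
  have h₂ := wt_mul_le (fun i : Fin 2 => decide (i = 1)) x⁻¹ (of 0 ^ i)
  have h₃ := wtB_zpow i
  rw [wt_inv] at h₂
  have par := ex_one_parity (x⁻¹ * of 0 ^ i * x)
  simp only [ex_mul, ex_inv, ex_zpow, ex_of, Pi.add_apply, Pi.smul_apply, Pi.neg_apply] at par
  simp at par
  by_contra hne
  have h0 : wtB (x⁻¹ * of 0 ^ i * x) = 0 := by simp only [wtB] at *; omega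
  have := eq_one_of_wt_conj _ h₃ (y := x) (by simp only [wtB] at *; omega) h0
  have := congrArg (fun g => ex g 0) this
  simp at this
  exact hi this

theorem wtB_mul_zpow_mul {x : F2} (hx : x = of 1 ∨ x = (of 1)⁻¹) (i : ℤ) :
    wtB (x * of 0 ^ i * x) = 2 := by
  have hx1 : wtB x = 1 := by
    rcases hx with rfl | rfl <;> simp [wtB_of_one]
  have h₁ := wt_mul_le (fun i : Fin 2 => decide (i = 1)) (x * of 0 ^ i) x
  have h₂ := wt_mul_le (fun i : Fin 2 => decide (i = 1)) x (of 0 ^ i)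
  have h₃ := wtB_zpow i
  have par := (ex_one_parity (x * of 0 ^ i * x)).1
  have : |ex (x * of 0 ^ i * x) 1| = 2 := by
    rcases hx with rfl | rfl <;> simp
  simp only [wtB] at *
  omega

theorem wtB_map_le (f : F2 →* F2) (h₀ : wtB (f (of 0)) = 0) (h₁ : wtB (f (of 1)) ≤ 1) (x : F2) :
    wtB (f x) ≤ wtB x := by
  have key : ∀ L : List Letter, wtB (f (mk L)) ≤
      wordWeight (fun i : Fin 2 => decide (i = 1)) L := by
    intro L
    induction L with
    | nil => simp [← one_eq_mk]
    | cons y L ih =>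
      have : mk (y :: L) = y.elt * mk L := by rw [Letter.elt, mul_mk]; rfl
      rw [this, _root_.map_mul]
      refine (wt_mul_le _ _ _).trans ?_
      obtain ⟨i, e⟩ := y
      have h : wtB (f (Letter.elt (i, e))) = wtB (f (of i)) := by
        cases e
        · rw [elt_false, _root_.map_inv, wtB, wt_inv]
        · rfl
      have h' : wordWeight (fun i : Fin 2 => decide (i = 1)) ((i, e) :: L) =
          wordWeight (fun i : Fin 2 => decide (i = 1)) L + if i = 1 then 1 else 0 := by
        simp [wordWeight, List.countP_cons]
      simp only [wtB] at *
      rw [h', h]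
      fin_cases i <;> simp only [Fin.zero_eta, Fin.mk_one, if_true] at * <;> omega
  have := key x.toWord
  rwa [mk_toWord] at this

theorem wtB_map_eq {θ : MulAut F2} (h₀ : wtB (θ (of 0)) = 0) (h₁ : wtB (θ (of 1)) ≤ 1)
    (h₂ : wtB (θ⁻¹ (of 0)) = 0) (h₃ : wtB (θ⁻¹ (of 1)) ≤ 1) (x : F2) : wtB (θ x) = wtB x := by
  refine le_antisymm (wtB_map_le θ.toMonoidHom h₀ h₁ x) ?_
  have := wtB_map_le (θ⁻¹).toMonoidHom h₂ h₃ (θ x)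
  simpa using this

/-- The automorphism `a ↦ a^{±1}`, `b ↦ (b aⁿ)^{±1}`. -/
def parabolic (n : ℤ) (k l : Bool) : MulAut F2 := tau ^ n * signedPerm false k l

theorem parabolic_zero (n : ℤ) (k l : Bool) :
    parabolic n k l (of 0) = of 0 ^ (if k then -1 else 1 : ℤ) := by
  cases k <;> cases l <;> simp [parabolic, signedPerm, tau_zpow_zero]

theorem parabolic_one (n : ℤ) (k l : Bool) :
    parabolic n k l (of 1) = if l then (of 0 ^ n)⁻¹ * (of 1)⁻¹ else of 1 * of 0 ^ n := by
  cases k <;> cases l <;> simp [parabolic, signedPerm, tau_zpow_one]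

theorem wtB_tau_zpow (n : ℤ) (x : F2) : wtB ((tau ^ n) x) = wtB x := by
  have h : ∀ n : ℤ, wtB ((tau ^ n) (of 1)) ≤ 1 := by
    intro n
    rw [tau_zpow_one]
    refine (wt_mul_le _ _ _).trans ?_
    have h₁ := wtB_of_one
    have h₂ := wtB_zpow n
    simp only [wtB] at *
    omega
  refine wtB_map_eq ?_ (h n) ?_ ?_ x
  · rw [tau_zpow_zero, wtB_of_zero]
  · rw [← zpow_neg, tau_zpow_zero, wtB_of_zero]
  · rw [← zpow_neg]; exact h _

theorem wtB_parabolic (n : ℤ) (k l : Bool) (x : F2) : wtB (parabolic n k l x) = wtB x := by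
  have h₁ := wtB_of_one
  have h₂ := wtB_of_zero
  have hA : ∀ x, wtB (invA x) = wtB x := fun x => by
    refine wtB_map_eq ?_ ?_ ?_ ?_ x <;> simp only [invA_inv, invA_zero, invA_one] <;>
      simp [h₁, h₂]
  have hB : ∀ x, wtB (invB x) = wtB x := fun x => by
    have : invB⁻¹ = invB := by
      simp [invB, mul_inv_rev, swapAut_inv, invA_inv, mul_assoc]
    refine wtB_map_eq ?_ ?_ ?_ ?_ x <;> simp only [this, invB_zero, invB_one] <;>
      simp [h₁, h₂]
  rw [parabolic, MulAut.mul_apply, wtB_tau_zpow]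
  cases k <;> cases l <;> simp [signedPerm, hA, hB]

/-- If `cxu` were fixed, then `u` would be the product of `x⁻¹ · (c⁻¹φ(c)p) · y` and `qφ(u)`. When
the first factor has weight 2, nothing cancels across `y`, and the right side has weight `wt u + 2`.
-/
theorem not_fixed_of_first {φ : MulAut F2} (hφ : ∀ x, wtB (φ x) = wtB x) {c x u p y q : F2}
    (hx : wtB x = 1) (hxu : wtB (x * u) = 1 + wtB u) (hxp : φ x = p * y * q) (hy : wtB y = 1)
    (hp : wtB p = 0) (hq : wtB q = 0) (hc : wtB (c⁻¹ * φ c * p) = 0)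
    (h2 : wtB (x⁻¹ * (c⁻¹ * φ c * p) * y) = 2) : φ (c * x * u) ≠ c * x * u := by
  intro h
  have hu : u = x⁻¹ * (c⁻¹ * φ c * p) * y * (q * φ u) := by
    have h' : u = (c * x)⁻¹ * φ (c * x * u) := by rw [h]; group
    rw [_root_.map_mul, _root_.map_mul, hxp] at h'
    calc u = _ := h'
      _ = _ := by group
  have hz : wtB (q * φ u) = wtB u := by rw [wtB, wt_mul_left_of_zero _ hq]; exact hφ u
  have hA : wtB (x⁻¹ * (c⁻¹ * φ c * p)) ≤ 1 := by
    refine (wt_mul_le _ _ _).trans ?_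
    rw [wt_inv]
    simp only [wtB] at *
    omega
  have hAy := wt_mul_le (fun i : Fin 2 => decide (i = 1)) (x⁻¹ * (c⁻¹ * φ c * p)) y
  have hyz : wtB (y * (q * φ u)) = 1 + wtB u := by
    rw [← hxu, ← hφ (x * u), _root_.map_mul, hxp, mul_assoc, mul_assoc]
    exact (wt_mul_left_of_zero _ hp _).symm
  have := wt_mul_of_dist (fun i : Fin 2 => decide (i = 1)) (x := x⁻¹ * (c⁻¹ * φ c * p)) (y := y)
    (z := q * φ u) (by simp only [wtB] at *; omega) (by simp only [wtB] at *; omega)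
    (by simp only [wtB] at *; omega)
  rw [← hu] at this
  simp only [wtB] at *
  omega

theorem commFix_of_wtB {φ : MulAut F2} (h : ∀ u, φ u = u → wtB u = 0) : CommFix φ := by
  intro u v hu hv
  obtain ⟨m, rfl⟩ := exists_zpow_of_wtB_eq_zero (h u hu)
  obtain ⟨n, rfl⟩ := exists_zpow_of_wtB_eq_zero (h v hv)
  rw [← zpow_add, ← zpow_add, add_comm]

/-- If the exponent of `a` before the first `b^{±1}` always changes, then only powers of `a` are
fixed. -/
theorem commFix_of_first {φ : MulAut F2} (hφ : ∀ x, wtB (φ x) = wtB x)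
    (ha : wtB (φ (of 0)) = 0)
    (h : ∀ x : F2, (x = of 1 ∨ x = (of 1)⁻¹) → ∃ p y q, φ x = p * y * q ∧ wtB y = 1 ∧
      wtB p = 0 ∧ wtB q = 0 ∧ ∀ i : ℤ, wtB (x⁻¹ * ((of 0 ^ i)⁻¹ * φ (of 0 ^ i) * p) * y) = 2) :
    CommFix φ := by
  refine commFix_of_wtB fun u hu => ?_
  by_contra hne
  obtain ⟨i, x, v, hx, rfl, h1, h2⟩ := exists_first_b (Nat.pos_of_ne_zero hne)
  obtain ⟨p, y, q, hp, hy, hp0, hq0, hi⟩ := h x hx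
  refine not_fixed_of_first hφ (c := of 0 ^ i) ?_ h2 hp hy hp0 hq0 ?_ (hi i) hu
  · rcases hx with rfl | rfl <;> simp [wtB_of_one]
  · rw [_root_.map_zpow, ← zpow_neg]
    rw [wtB, mul_assoc, wt_mul_left_of_zero _ (wtB_zpow _),
      wt_mul_left_of_zero _ (wt_zpow_eq_zero _ ha i)]
    exact hp0

theorem wtB_conj_mul {g : F2} (hg : wtB g = 0) {θ : MulAut F2} (hθ : ∀ x, wtB (θ x) = wtB x)
    (x : F2) : wtB ((MulAut.conj g * θ) x) = wtB x := by
  rw [MulAut.mul_apply, MulAut.conj_apply, mul_assoc, wtB, wt_mul_left_of_zero _ hg, ← wt_inv,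
    mul_inv_rev, inv_inv, wt_mul_left_of_zero _ hg, wt_inv]
  exact hθ x

/-- The fixed subgroup of `τ^k` for `k ≠ 0`. -/
theorem tau_zpow_fixed_iff {k : ℤ} (hk : k ≠ 0) (u : F2) :
    (tau ^ k) u = u ↔ u ∈ Subgroup.closure {of 0, of 1 * of 0 * (of 1)⁻¹} := by
  have hb : ∀ m : ℤ, (tau ^ k) (of 1 * of 0 ^ m * (of 1)⁻¹) = of 1 * of 0 ^ m * (of 1)⁻¹ := by
    intro m
    simp only [_root_.map_mul, _root_.map_inv, _root_.map_zpow, tau_zpow_one, tau_zpow_zero]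
    group
  constructor
  · intro h
    induction hn : wtB u using Nat.strong_induction_on generalizing u with
    | _ n ih =>
      subst hn
      have ha : ∀ i : ℤ, (of 0 ^ i : F2) ∈
          Subgroup.closure ({of 0, of 1 * of 0 * (of 1)⁻¹} : Set F2) :=
        fun i => zpow_mem (Subgroup.subset_closure (by simp)) i
      rcases Nat.eq_zero_or_pos (wtB u) with h0 | h0
      · obtain ⟨i, rfl⟩ := exists_zpow_of_wtB_eq_zero h0
        exact ha i
      obtain ⟨i, x, v, hx, rfl, h1, h2⟩ := exists_first_b h0
      have hai : (tau ^ k) (of 0 ^ i) = of 0 ^ i := by rw [_root_.map_zpow, tau_zpow_zero]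
      -- `τ^k` inserts `a^k` after each `b` and `a^{-k}` before each `b⁻¹`. Hence words starting
      -- with `a^i b⁻¹` or with `a^i b a^m b`, and the words `a^i b a^m`, are not fixed. In `a^i b
      -- a^m b⁻¹ w` the insertions around `a^m` cancel, and the fixed part before `w` can be peeled
      -- off.
      rcases hx with rfl | rfl
      · rcases Nat.eq_zero_or_pos (wtB v) with h3 | h3
        · obtain ⟨m, rfl⟩ := exists_zpow_of_wtB_eq_zero h3
          exfalso
          simp only [_root_.map_mul, _root_.map_zpow, tau_zpow_one, tau_zpow_zero] at h
          have := congrArg (fun g => ex g 0) h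
          simp at this
          exact hk this
        obtain ⟨m, y, w, hy, rfl, h4, h5⟩ := exists_first_b h3
        rcases hy with rfl | rfl
        · exfalso
          have e : of 0 ^ i * of 1 * (of 0 ^ m * of 1 * w) =
            (of 0 ^ i * of 1 * of 0 ^ m) * of 1 * w := by group
          rw [e] at h
          have e2 : (of 0 ^ i * of 1 * of 0 ^ m)⁻¹ * (tau ^ k) (of 0 ^ i * of 1 * of 0 ^ m) * 1 =
              of 0 ^ k := by
            simp only [_root_.map_mul, _root_.map_zpow, tau_zpow_one, tau_zpow_zero]
            group
          refine not_fixed_of_first (wtB_tau_zpow k) (p := 1) (y := of 1) (q := of 0 ^ k)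
            wtB_of_one h5 (by rw [tau_zpow_one, one_mul]) wtB_of_one (by simp) (wtB_zpow k)
            ?_ ?_ h
          · rw [e2]; exact wtB_zpow k
          · rw [e2]; exact wtB_conj_zpow (Or.inl rfl) hk
        · have e : of 0 ^ i * of 1 * (of 0 ^ m * (of 1)⁻¹ * w) =
            of 0 ^ i * ((of 1 * of 0 ^ m * (of 1)⁻¹) * w) := by group
          rw [e] at h ⊢
          rw [_root_.map_mul, _root_.map_mul, hai, hb, mul_right_inj, mul_right_inj] at h
          refine mul_mem (ha i) (mul_mem ?_ (ih _ (by omega) w h rfl))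
          rw [← conj_zpow]
          exact zpow_mem (Subgroup.subset_closure (by simp)) m
      · exfalso
        have e2 : (of 0 ^ i)⁻¹ * (tau ^ k) (of 0 ^ i) * of 0 ^ (-k) = of 0 ^ (-k) := by
          rw [hai]; group
        refine not_fixed_of_first (wtB_tau_zpow k) (p := of 0 ^ (-k)) (y := (of 1)⁻¹) (q := 1)
          (c := of 0 ^ i) (by simp [wtB_of_one]) h2 ?_ (by simp [wtB_of_one]) (wtB_zpow _)
          (by simp) ?_ ?_ h
        · rw [_root_.map_inv, tau_zpow_one]; group
        · rw [e2]; exact wtB_zpow _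
        · rw [e2]; exact wtB_conj_zpow (Or.inr rfl) (neg_ne_zero.2 hk)
  · intro h
    induction h using Subgroup.closure_induction with
    | mem x hx =>
      rcases hx with rfl | rfl
      · exact tau_zpow_zero k
      · simpa using hb 1
    | one => simp
    | mul x y _ _ hx hy => rw [_root_.map_mul, hx, hy]
    | inv x _ hx => rw [_root_.map_inv, hx]

/-- Either fixed elements commute, or the automorphism is trivial, or it has the same fixed
elements as a conjugate of `τ`. -/
def FixClassified (φ : MulAut F2) : Prop :=
  CommFix φ ∨ φ = 1 ∨ ∃ α : MulAut F2, ∀ g, φ g = g ↔ (α * tau * α⁻¹) g = g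

theorem FixClassified.of_conj {φ : MulAut F2} (α : MulAut F2)
    (h : FixClassified (α * φ * α⁻¹)) : FixClassified φ := by
  rcases h with h | h | ⟨β, h⟩
  · exact Or.inl (h.of_conj α)
  · refine Or.inr (Or.inl ?_)
    rw [mul_inv_eq_one] at h
    simpa using h
  · refine Or.inr (Or.inr ⟨α⁻¹ * β, fun g => ?_⟩)
    have := h (α g)
    constructor
    · intro hg
      have h1 := this.1 (by simp [hg])
      simpa [mul_inv_rev, MulEquiv.symm_apply_eq] using h1
    · intro hg
      have h1 := congrArg α hg
      have h2 := this.2 (by simpa [mul_inv_rev] using h1)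
      simpa using h2

theorem fixClassified_tau_zpow {k : ℤ} : FixClassified (tau ^ k) := by
  by_cases hk : k = 0
  · exact Or.inr (Or.inl (by simp [hk]))
  · refine Or.inr (Or.inr ⟨1, fun g => ?_⟩)
    rw [tau_zpow_fixed_iff hk]
    simpa using (tau_zpow_fixed_iff one_ne_zero g).symm

/-- The map is `a ↦ a`, `b ↦ a^j b a^{n-j}`. If one of the two exponents vanishes it is conjugate to
a power of `τ`; if neither does, the exponent before the first `b^{±1}` always changes and only
powers of `a` are fixed. -/
theorem fixClassified_conj_tau_zpow (j n : ℤ) :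
    FixClassified (MulAut.conj (of 0 ^ j) * tau ^ n) := by
  obtain ⟨φ, hφ⟩ : ∃ φ : MulAut F2, φ = MulAut.conj (of 0 ^ j) * tau ^ n := ⟨_, rfl⟩
  have h0 : φ (of 0) = of 0 := by
    rw [hφ, MulAut.mul_apply, tau_zpow_zero, MulAut.conj_apply]; group
  have h1 : φ (of 1) = of 0 ^ j * of 1 * of 0 ^ (n - j) := by
    rw [hφ, MulAut.mul_apply, tau_zpow_one, MulAut.conj_apply]; group
  rw [← hφ]
  by_cases hj : j = 0
  · rw [hφ, hj]
    simpa using fixClassified_tau_zpow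
  by_cases hk : n - j = 0
  -- Replacing `b` by `b⁻¹` turns `b ↦ a^j b` into `b ↦ b a^{-j}`.
  · refine FixClassified.of_conj invB ?_
    have : invB * φ * invB⁻¹ = tau ^ (-j) := by
      rw [mul_inv_eq_iff_eq_mul]
      refine aut_ext ?_ ?_
      · simp only [MulAut.mul_apply, h0, invB_zero, tau_zpow_zero]
      · rw [MulAut.mul_apply, h1, hk, MulAut.mul_apply, invB_one, _root_.map_inv, tau_zpow_one]
        simp
    rw [this]
    exact fixClassified_tau_zpow
  · left
    refine commFix_of_first ?_ ?_ ?_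
    · rw [hφ]; exact wtB_conj_mul (wtB_zpow j) (wtB_tau_zpow n)
    · rw [h0, wtB_of_zero]
    · have e : ∀ (i : ℤ) (p : F2), (of 0 ^ i : F2)⁻¹ * φ (of 0 ^ i) * p = p := by
        intro i p
        rw [_root_.map_zpow, h0]; group
      simp only [e]
      rintro x (rfl | rfl)
      · exact ⟨_, _, _, h1, wtB_of_one, wtB_zpow _, wtB_zpow _,
          fun _ => wtB_conj_zpow (Or.inl rfl) hj⟩
      · refine ⟨of 0 ^ (-(n - j)), (of 1)⁻¹, of 0 ^ (-j), ?_, ?_, wtB_zpow _, wtB_zpow _,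
          fun _ => wtB_conj_zpow (Or.inr rfl) (neg_ne_zero.2 hk)⟩
        · rw [_root_.map_inv, h1]; group
        · simp [wtB_of_one]

/-- Inverting `b` changes the sign of the first letter `b^{±1}`, so no word containing `b` is fixed.
-/
theorem commFix_conj_parabolic_inv (j n : ℤ) (k : Bool) :
    CommFix (MulAut.conj (of 0 ^ j) * parabolic n k true) := by
  obtain ⟨φ, hφ⟩ : ∃ φ : MulAut F2, φ = MulAut.conj (of 0 ^ j) * parabolic n k true := ⟨_, rfl⟩
  rw [← hφ]
  obtain ⟨s, h0⟩ : ∃ s : ℤ, φ (of 0) = of 0 ^ s := by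
    refine ⟨if k then -1 else 1, ?_⟩
    rw [hφ, MulAut.mul_apply, parabolic_zero, MulAut.conj_apply]
    group
  have h1 : φ (of 1) = of 0 ^ (j - n) * (of 1)⁻¹ * of 0 ^ (-j) := by
    rw [hφ, MulAut.mul_apply, parabolic_one, MulAut.conj_apply, if_pos rfl]
    group
  refine commFix_of_first ?_ ?_ ?_
  · rw [hφ]; exact wtB_conj_mul (wtB_zpow j) (wtB_parabolic n k true)
  · rw [h0]; exact wtB_zpow s
  · have e : ∀ i m : ℤ, (of 0 ^ i : F2)⁻¹ * φ (of 0 ^ i) * of 0 ^ m = of 0 ^ (-i + s * i + m) := by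
      intro i m
      rw [_root_.map_zpow, h0]; group
    rintro x (rfl | rfl)
    · refine ⟨_, _, _, h1, by simp [wtB_of_one], wtB_zpow _, wtB_zpow _, fun i => ?_⟩
      rw [e]
      exact wtB_mul_zpow_mul (Or.inr rfl) _
    · refine ⟨of 0 ^ j, of 1, of 0 ^ (-(j - n)), ?_, wtB_of_one, wtB_zpow _, wtB_zpow _,
        fun i => ?_⟩
      · rw [_root_.map_inv, h1]; group
      · rw [e, inv_inv]
        exact wtB_mul_zpow_mul (Or.inl rfl) _

theorem ex_parabolic_one (n : ℤ) (k l : Bool) (g : F2) :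
    ex (parabolic n k l g) 1 = (if l then -1 else 1) * ex g 1 := by
  rw [ex_map, Matrix.mulVec, dotProduct, Fin.sum_univ_two, abMat_apply, abMat_apply,
    parabolic_zero, parabolic_one]
  cases k <;> cases l <;> simp

theorem commFix_conj_parabolic (g : F2) (n : ℤ) (k : Bool) :
    CommFix (MulAut.conj g * parabolic n k true) := by
  have hθ := wtB_parabolic n k true
  rcases elliptic_or_commFix_or_inversion (fun i : Fin 2 => decide (i = 1)) hθ g with
    ⟨w, hw⟩ | hc | ⟨w, hw, hw'⟩
  · refine CommFix.of_conj (MulAut.conj w) ?_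
    rw [conj_mul_conj_mul]
    obtain ⟨j, hj⟩ := exists_zpow_of_wtB_eq_zero hw
    rw [hj]
    exact commFix_conj_parabolic_inv j n k
  · exact hc
  · refine CommFix.of_conj (MulAut.conj w) ?_
    rw [conj_mul_conj_mul]
    generalize w * g * (parabolic n k true w)⁻¹ = c at hw hw'
    have p₁ := (ex_one_parity c).2
    have p₂ := (ex_one_parity (c * parabolic n k true c)).1
    rw [ex_mul, Pi.add_apply, ex_parabolic_one] at p₂
    have hw2 : wtB c = 1 := hw
    have hw3 : wtB (c * parabolic n k true c) = 0 := hw'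
    rw [hw2] at p₁
    rw [hw3] at p₂
    refine commFix_of_wtB fun u hu => ?_
    have hu1 := congrArg (fun x => ex x 1) hu
    simp only [MulAut.mul_apply, MulAut.conj_apply, ex_mul, ex_inv, Pi.add_apply,
      ex_parabolic_one, Pi.neg_apply, if_true] at hu1
    have p₃ := (ex_one_parity u).2
    -- `x ↦ c θ(x)` exchanges the vertices of `1` and `c`, and of `u` and `u c`
    set θ := parabolic n k true
    have hΦ : c * θ u = u * c := by
      rw [MulAut.mul_apply, MulAut.conj_apply, mul_inv_eq_iff_eq_mul] at hu
      exact hu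
    let B : Fin 2 → Bool := fun i => decide (i = 1)
    have hB : ∀ x, wt B (θ x) = wt B x := hθ
    have hw2' : wt B c = 1 := hw
    have hw3' : wt B (c * θ c) = 0 := hw'
    have d₁ : treeDist B c (u * c) = wt B u := by
      rw [← hΦ, treeDist, inv_mul_cancel_left, hB]
    have d₂ : treeDist B u (u * c) = 1 := by rw [treeDist, inv_mul_cancel_left, hw2']
    have d₃ : treeDist B 1 (u * c) = treeDist B c u := by
      have e1 : treeDist B (c * θ 1) (c * θ (u * c)) = treeDist B 1 (u * c) := by
        rw [treeDist_mul_left, treeDist, treeDist, ← _root_.map_inv, ← _root_.map_mul, hB]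
      have e2 : c * θ (u * c) = u * (c * θ c) := by
        rw [_root_.map_mul, ← mul_assoc, hΦ, mul_assoc]
      rw [e2, _root_.map_one, mul_one] at e1
      have t₁ := treeDist_triangle B c (u * (c * θ c)) u
      have t₂ := treeDist_triangle B c u (u * (c * θ c))
      have e3 : treeDist B u (u * (c * θ c)) = 0 := by
        rw [treeDist, inv_mul_cancel_left, hw3']
      rw [treeDist_comm B (u * (c * θ c)) u] at t₁
      omega
    -- The isometry inverts the edges `[1, c]` and `[u, uc]`, but in a tree at most one edge is
    -- inverted, so `wt u ≤ 1`. The exponent sum of `b` in `u` equals its own negative, so `wt u` is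
    -- even and thus zero.
    have q₁ := four_point B 1 c u (u * c)
    have q₂ := four_point B 1 u c (u * c)
    have q₃ := four_point B c 1 u (u * c)
    have par := treeDist_parity B 1 c u
    have hu0 : wtB u = wt B u := rfl
    simp only [treeDist_one_left, treeDist_one_right, d₁, d₂, d₃, treeDist_comm B u c, hw2'] at *
    omega

/-- Inversions do not occur here: `c` would have odd exponent sum in `b`, whereas `cθ(c)`, with
twice that sum, would have to contain no letter `b`. -/
theorem fixClassified_conj_parabolic_false (g : F2) (n : ℤ) :
    FixClassified (MulAut.conj g * parabolic n false false) := by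
  rcases elliptic_or_commFix_or_inversion (fun i : Fin 2 => decide (i = 1))
    (wtB_parabolic n false false) g with ⟨w, hw⟩ | hc | ⟨w, hw, hw'⟩
  · refine FixClassified.of_conj (MulAut.conj w) ?_
    rw [conj_mul_conj_mul]
    obtain ⟨j, hj⟩ := exists_zpow_of_wtB_eq_zero hw
    have : parabolic n false false = tau ^ n := by simp [parabolic, signedPerm]
    rw [hj, this]
    exact fixClassified_conj_tau_zpow j n
  · exact Or.inl hc
  · exfalso
    generalize w * g * (parabolic n false false w)⁻¹ = c at hw hw'
    have p₁ := (ex_one_parity c).2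
    have p₂ := (ex_one_parity (c * parabolic n false false c)).1
    rw [ex_mul, Pi.add_apply, ex_parabolic_one] at p₂
    have hw2 : wtB c = 1 := hw
    have hw3 : wtB (c * parabolic n false false c) = 0 := hw'
    rw [hw2] at p₁
    rw [hw3, abs_le] at p₂
    simp at p₂
    omega

/-- The excluded pair of signs, `-1` on `a` and `+1` on `b`, has determinant `-1`; there the
eigenvalue `+1` can be used instead. -/
theorem fixClassified_conj_parabolic (g : F2) (n : ℤ) (k l : Bool) (h : k = false ∨ l = true) :
    FixClassified (MulAut.conj g * parabolic n k l) := by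
  cases l
  · obtain rfl : k = false := by simpa using h
    exact fixClassified_conj_parabolic_false g n
  · exact Or.inl (commFix_conj_parabolic g n k)


/-! ### Basis permutations and automorphisms of order three on the abelianization -/

section Permutation

variable {α : Type*} [DecidableEq α]

theorem toWord_freeGroupCongr (e : Equiv.Perm α) (u : FreeGroup α) :
    (freeGroupCongr e u).toWord = u.toWord.map fun x => (e x.1, x.2) := by
  have h : IsReduced (u.toWord.map fun x => (e x.1, x.2)) := by
    have := isReduced_toWord (x := u)
    rw [FreeGroup.IsReduced] at this
    rw [FreeGroup.IsReduced, List.isChain_map]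
    exact this.imp fun a b hab h => hab (e.injective h)
  conv_lhs => rw [← mk_toWord (x := u)]
  rw [freeGroupCongr_apply, map.mk, toWord_mk]
  exact h.reduce_eq

theorem len_freeGroupCongr (e : Equiv.Perm α) (u : FreeGroup α) :
    len (freeGroupCongr e u) = len u := by
  rw [len_eq_norm, len_eq_norm, FreeGroup.norm, FreeGroup.norm, toWord_freeGroupCongr,
    List.length_map]

/-- The first letter of a nontrivial word would be changed. -/
theorem eq_one_of_freeGroupCongr_eq {e : Equiv.Perm α} (he : ∀ i, e i ≠ i) {u : FreeGroup α}
    (h : freeGroupCongr e u = u) : u = 1 := by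
  have := toWord_freeGroupCongr e u
  rw [h] at this
  rw [← toWord_eq_nil_iff]
  generalize u.toWord = L at this
  cases L with
  | nil => rfl
  | cons x L =>
    rw [List.map_cons, List.cons.injEq] at this
    exact absurd (congrArg Prod.fst this.1).symm (he _)

end Permutation

/-- The automorphism of the free group of rank three that permutes the basis cyclically. -/
def basisRotation : MulAut (FreeGroup (Fin 3)) := freeGroupCongr (finRotate 3)

theorem basisRotation_of (i : Fin 3) : basisRotation (of i) = of (i + 1) := by
  simp [basisRotation, finRotate_apply]

theorem eq_one_of_basisRotation_eq {u : FreeGroup (Fin 3)} (h : basisRotation u = u) : u = 1 :=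
  eq_one_of_freeGroupCongr_eq (by decide) h

/-- In the elliptic case the map is conjugate to the rotation itself, which fixes only `1`. An
inversion would give a nontrivial `c` with `ρ(c) = c⁻¹`, and `ρ³ = 1` then forces `ρ(c) = c`. -/
theorem commFix_conj_basisRotation (g : FreeGroup (Fin 3)) : CommFix (MulAut.conj g * basisRotation) := by
  have h3 : ∀ x, basisRotation (basisRotation (basisRotation x)) = x := by
    intro x
    have : (basisRotation.toMonoidHom.comp (basisRotation.toMonoidHom.comp basisRotation.toMonoidHom)) =
        MonoidHom.id _ := by
      ext i
      fin_cases i <;> simp [basisRotation_of]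
    exact DFunLike.congr_fun this x
  have hl : ∀ x, len (basisRotation x) = len x := len_freeGroupCongr _
  rcases elliptic_or_commFix_or_inversion (fun _ => true) hl g with ⟨w, hw⟩ | hc | ⟨w, hw, hw'⟩
  · refine CommFix.of_conj (MulAut.conj w) ?_
    rw [conj_mul_conj_mul, len_eq_zero.1 hw]
    intro u v hu hv
    rw [_root_.map_one, one_mul] at hu hv
    rw [eq_one_of_basisRotation_eq hu, eq_one_of_basisRotation_eq hv]
  · exact hc
  · exfalso
    generalize w * g * (basisRotation w)⁻¹ = c at hw hw'
    have h1 : c * basisRotation c = 1 := len_eq_zero.1 hw'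
    have h2 : basisRotation c = c⁻¹ := eq_inv_of_mul_eq_one_right h1
    have h4 := h3 c
    rw [h2, _root_.map_inv, h2, inv_inv] at h4
    have h5 := eq_one_of_basisRotation_eq h4
    rw [h5] at hw
    simp at hw

/-- The automorphism `a ↦ b`, `b ↦ (ab)⁻¹` of order three. -/
def orderThree : MulAut F2 := sigma * (invA * swapAut)

/-- An embedding under which `orderThree` becomes `basisRotation`. -/
def rankThreeHom : F2 →* FreeGroup (Fin 3) :=
  FreeGroup.lift ![of 0 * (of 1)⁻¹, of 1 * (of 2)⁻¹]

theorem rankThreeHom_injective : Function.Injective rankThreeHom := by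
  let ρ : FreeGroup (Fin 3) →* F2 := FreeGroup.lift ![of 0 * of 1, of 1, 1]
  have : ρ.comp rankThreeHom = MonoidHom.id _ := by
    ext i
    fin_cases i <;> simp [ρ, rankThreeHom]
  exact Function.LeftInverse.injective (g := ρ) fun x => DFunLike.congr_fun this x


theorem rankThreeHom_orderThree (u : F2) :
    rankThreeHom (orderThree u) = basisRotation (rankThreeHom u) := by
  have : rankThreeHom.comp orderThree.toMonoidHom =
      basisRotation.toMonoidHom.comp rankThreeHom := by
    ext i
    fin_cases i <;> simp [orderThree, rankThreeHom, basisRotation_of]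
  exact DFunLike.congr_fun this u

theorem commFix_conj_orderThree (g : F2) : CommFix (MulAut.conj g * orderThree) := by
  have h := commFix_conj_basisRotation (rankThreeHom g)
  have key : ∀ u, (MulAut.conj g * orderThree) u = u →
      (MulAut.conj (rankThreeHom g) * basisRotation) (rankThreeHom u) = rankThreeHom u := by
    intro u hu
    conv_rhs => rw [← hu]
    simp [rankThreeHom_orderThree]
  intro u v hu hv
  apply rankThreeHom_injective
  rw [_root_.map_mul, _root_.map_mul]
  exact h _ _ (key u hu) (key v hv)

theorem abMat_tau_zpow (n : ℤ) : abMat (tau ^ n) = !![1, n; 0, 1] := by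
  ext i j
  fin_cases i <;> fin_cases j <;> simp [abMat_apply, tau_zpow_zero, tau_zpow_one]

theorem abMat_swapAut : abMat swapAut = !![0, 1; 1, 0] := by
  ext i j
  fin_cases i <;> fin_cases j <;> simp [abMat_apply]

theorem abMat_invB : abMat invB = !![1, 0; 0, -1] := by
  ext i j
  fin_cases i <;> fin_cases j <;> simp [abMat_apply]

theorem abMat_orderThree : abMat orderThree = !![0, -1; 1, -1] := by
  ext i j
  fin_cases i <;> fin_cases j <;> simp [abMat_apply, orderThree]

theorem abMat_parabolic (n : ℤ) (k l : Bool) : abMat (parabolic n k l) =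
    !![if k then -1 else 1, if l then -n else n; 0, if l then -1 else 1] := by
  ext i j
  fin_cases i <;> fin_cases j <;> cases k <;> cases l <;>
    simp [abMat_apply, parabolic_zero, parabolic_one]

theorem abMat_conj_tau_zpow (φ : MulAut F2) (n : ℤ) :
    abMat (tau ^ (-n) * φ * tau ^ n) =
      !![abMat φ 0 0 - n * abMat φ 1 0,
        n * (abMat φ 0 0 - n * abMat φ 1 0) + (abMat φ 0 1 - n * abMat φ 1 1);
        abMat φ 1 0, n * abMat φ 1 0 + abMat φ 1 1] := by
  rw [abMat_mul, abMat_mul, abMat_tau_zpow, abMat_tau_zpow]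
  ext i j
  fin_cases i <;> fin_cases j <;> simp [Matrix.mul_apply, Fin.sum_univ_two, Matrix.vecMul, dotProduct] <;> ring

theorem abMat_conj_swapAut (φ : MulAut F2) : abMat (swapAut⁻¹ * φ * swapAut) =
    !![abMat φ 1 1, abMat φ 1 0; abMat φ 0 1, abMat φ 0 0] := by
  rw [swapAut_inv, abMat_mul, abMat_mul, abMat_swapAut]
  ext i j
  fin_cases i <;> fin_cases j <;> simp [Matrix.mul_apply, Fin.sum_univ_two, Matrix.vecMul, dotProduct]

theorem abMat_conj_invB (φ : MulAut F2) : abMat (invB * φ * invB⁻¹) =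
    !![abMat φ 0 0, -abMat φ 0 1; -abMat φ 1 0, abMat φ 1 1] := by
  have : invB⁻¹ = invB := by simp [invB, mul_inv_rev, swapAut_inv, invA_inv, mul_assoc]
  rw [this, abMat_mul, abMat_mul, abMat_invB]
  ext i j
  fin_cases i <;> fin_cases j <;> simp [Matrix.mul_apply, Fin.sum_univ_two, Matrix.vecMul, dotProduct]

theorem CommFix.of_conj_inv {φ : MulAut F2} (α : MulAut F2) (h : CommFix (α⁻¹ * φ * α)) :
    CommFix φ := CommFix.of_conj α⁻¹ (by rwa [inv_inv])

theorem exists_int_shift (A B : ℤ) (hA : A ≠ 0) : ∃ n : ℤ, |B + 2 * n * A| ≤ |A| := by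
  have h1 := Int.emod_nonneg (B + |A|) (b := 2 * A) (by omega)
  have h2 := Int.emod_lt_abs (B + |A|) (b := 2 * A) (by omega)
  have h3 := Int.emod_add_mul_ediv (B + |A|) (2 * A)
  rw [abs_mul, abs_two] at h2
  refine ⟨-((B + |A|) / (2 * A)), ?_⟩
  have : B + 2 * -((B + |A|) / (2 * A)) * A = (B + |A|) % (2 * A) - |A| := by linear_combination -h3
  rw [this, abs_le]
  omega

/-- Reduction as for binary quadratic forms: conjugating by powers of `τ` and by the swap decreases
the lower left entry to `±1`, where the matrix is conjugate to that of `orderThree`. Equal matrices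
differ by an inner factor, which `commFix_conj_orderThree` permits. -/
theorem commFix_of_trace_neg_one {φ : MulAut F2} (hd : (abMat φ).det = 1)
    (ht : abMat φ 0 0 + abMat φ 1 1 = -1) : CommFix φ := by
  induction hn : (abMat φ 1 0).natAbs using Nat.strong_induction_on generalizing φ with
  | _ m ih =>
    subst hn
    rw [Matrix.det_fin_two] at hd
    have hA : abMat φ 1 0 ≠ 0 := by
      intro h
      rw [h] at hd
      have : abMat φ 1 1 = -1 - abMat φ 0 0 := by linarith
      rw [this] at hd
      nlinarith [sq_nonneg (2 * abMat φ 0 0 + 1)]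
    by_cases h1 : (abMat φ 1 0).natAbs = 1
    -- If the lower left entry is 1, conjugation by `τ` to the power of the upper left entry clears
    -- that entry; determinant and trace fix the rest. The entry `-1` is made positive by `invB`.
    · have key : ∀ ψ : MulAut F2, (abMat ψ 0 0 * abMat ψ 1 1 - abMat ψ 0 1 * abMat ψ 1 0 = 1) →
          abMat ψ 0 0 + abMat ψ 1 1 = -1 → abMat ψ 1 0 = 1 → CommFix ψ := by
        intro ψ hd ht h1
        refine CommFix.of_conj_inv (tau ^ (abMat ψ 0 0)) ?_
        obtain ⟨g, hg⟩ := exists_conj_mul_of_abMat_eq (ψ := orderThree)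
          (φ := (tau ^ (abMat ψ 0 0))⁻¹ * ψ * tau ^ (abMat ψ 0 0)) (by
            rw [← zpow_neg, abMat_conj_tau_zpow, abMat_orderThree, h1]
            rw [h1] at hd
            ext i j
            fin_cases i <;> fin_cases j <;> simp <;> linarith)
        rw [hg]
        exact commFix_conj_orderThree g
      rcases Int.natAbs_eq_iff.1 h1 with h1 | h1
      · exact key φ hd ht (by simpa using h1)
      · refine CommFix.of_conj invB (key _ ?_ ?_ ?_) <;> rw [abMat_conj_invB]
        · simpa using hd
        · simpa using ht
        · simp [h1]
    · obtain ⟨n, hn⟩ := exists_int_shift (abMat φ 1 0) (abMat φ 1 1 - abMat φ 0 0) hA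
      refine CommFix.of_conj_inv (tau ^ n) (CommFix.of_conj_inv swapAut ?_)
      rw [← zpow_neg]
      have e := abMat_conj_tau_zpow φ n
      generalize tau ^ (-n) * φ * tau ^ n = ψ at e
      have hd' : abMat ψ 0 0 * abMat ψ 1 1 - abMat ψ 0 1 * abMat ψ 1 0 = 1 := by
        rw [e]; simp; linear_combination hd
      have ht' : abMat ψ 0 0 + abMat ψ 1 1 = -1 := by
        rw [e]; simp; linear_combination ht
      have h10 : abMat ψ 1 0 = abMat φ 1 0 := by rw [e]; simp
      have hB : |abMat ψ 1 1 - abMat ψ 0 0| ≤ |abMat φ 1 0| := by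
        have : abMat ψ 1 1 - abMat ψ 0 0 = abMat φ 1 1 - abMat φ 0 0 + 2 * n * abMat φ 1 0 := by
          rw [e]; simp; ring
        rwa [this]
      refine ih _ ?_ ?_ ?_ rfl
      · rw [abMat_conj_swapAut]
        simp only [Matrix.of_apply, Matrix.cons_val', Matrix.cons_val_zero, Matrix.cons_val_one,
          Matrix.cons_val_fin_one]
        by_contra hlt
        have hA2 : 2 ≤ |abMat φ 1 0| := by rw [Int.abs_eq_natAbs]; omega
        have hC : |abMat φ 1 0| ≤ |abMat ψ 0 1| := by
          rw [Int.abs_eq_natAbs, Int.abs_eq_natAbs]; omega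
        have hsq : (abMat ψ 1 1 - abMat ψ 0 0) ^ 2 ≤ abMat φ 1 0 ^ 2 := sq_le_sq.2 hB
        -- The discriminant `t² - 4` is `-3`. With `|d - a| ≤ |c|` and `|b| ≥ |c|` it would give
        -- `4c² ≤ 3 + c²`, against `|c| ≥ 2`; so the swap decreases the lower left entry.
        have hdisc : (abMat ψ 1 1 - abMat ψ 0 0) ^ 2 + 4 * (abMat ψ 0 1 * abMat φ 1 0) = -3 := by
          rw [← h10]
          have : abMat ψ 1 1 = -1 - abMat ψ 0 0 := by linarith
          rw [this] at hd' ⊢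
          linear_combination -4 * hd'
        have h4 : |abMat ψ 0 1 * abMat φ 1 0| = |abMat ψ 0 1| * |abMat φ 1 0| := abs_mul _ _
        have h5 : -(abMat ψ 0 1 * abMat φ 1 0) ≤ |abMat ψ 0 1 * abMat φ 1 0| := neg_le_abs _
        have h6 : |abMat ψ 0 1 * abMat φ 1 0| = -(abMat ψ 0 1 * abMat φ 1 0) := by
          rw [abs_of_nonpos]
          nlinarith [sq_nonneg (abMat ψ 1 1 - abMat ψ 0 0)]
        rw [← sq_abs (abMat φ 1 0)] at hsq
        nlinarith
      · rw [Matrix.det_fin_two, abMat_conj_swapAut]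
        simp
        linear_combination hd'
      · rw [abMat_conj_swapAut]
        simp
        linarith

/-- An automorphism with eigenvalue `±1` on the abelianization is conjugate to an inner
automorphism times a parabolic one. -/
theorem exists_conj_parabolic {φ : MulAut F2} (k : Bool)
    (h : (abMat φ - (if k then -1 else 1 : ℤ) • (1 : Matrix (Fin 2) (Fin 2) ℤ)).det = 0) :
    ∃ (α : MulAut F2) (g : F2) (n : ℤ) (l : Bool),
      α⁻¹ * φ * α = MulAut.conj g * parabolic n k l ∧
      (abMat φ).det = (if k then -1 else 1) * (if l then -1 else 1) := by
  obtain ⟨ε, hε, hε2⟩ : ∃ ε : ℤ, ε = (if k then -1 else 1) ∧ ε * ε = 1 :=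
    ⟨_, rfl, by cases k <;> simp⟩
  rw [← hε] at h ⊢
  obtain ⟨v, hv, hMv⟩ := Matrix.exists_mulVec_eq_zero_iff.2 h
  rw [Matrix.sub_mulVec, Matrix.smul_mulVec, Matrix.one_mulVec, sub_eq_zero] at hMv
  have hv' : v 0 ≠ 0 ∨ v 1 ≠ 0 := by
    by_contra hc
    push Not at hc
    exact hv (by ext i; fin_cases i; exacts [hc.1, hc.2])
  -- Dividing the eigenvector by its content makes it primitive, so that it is the class of `α(a)`
  -- for some automorphism `α`.
  have hd : 0 < Int.gcd (v 0) (v 1) := Int.gcd_pos_iff.2 hv'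
  obtain ⟨p, q, hpq, h0, h1⟩ := Int.exists_gcd_one hd
  obtain ⟨α, -, hα⟩ := exists_isShort_of_isCoprime (Int.isCoprime_iff_gcd_eq_one.2 hpq)
  have hvd : v = (Int.gcd (v 0) (v 1) : ℤ) • ![p, q] := by
    ext i
    fin_cases i
    · simpa [mul_comm] using h0
    · simpa [mul_comm] using h1
  have hM : (abMat φ).mulVec ![p, q] = ε • ![p, q] := by
    rw [hvd, Matrix.mulVec_smul, smul_comm] at hMv
    exact smul_right_injective _ (by exact_mod_cast hd.ne') hMv
  have hcol : ex ((α⁻¹ * φ * α) (of 0)) = ε • Pi.single 0 1 := by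
    rw [MulAut.mul_apply, MulAut.mul_apply, ex_map, ex_map φ, hα, hM, Matrix.mulVec_smul, ← hα,
      ← ex_map, MulAut.inv_apply_self, ex_of]
  have h00 : abMat (α⁻¹ * φ * α) 0 0 = ε := by rw [abMat_apply, hcol]; simp
  have h10 : abMat (α⁻¹ * φ * α) 1 0 = 0 := by rw [abMat_apply, hcol]; simp
  have hdet : (abMat (α⁻¹ * φ * α)).det = (abMat φ).det := by
    have := congrArg Matrix.det (abMat_inv_mul α)
    rw [Matrix.det_mul, Matrix.det_one] at this
    rw [abMat_mul, abMat_mul, Matrix.det_mul, Matrix.det_mul]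
    linear_combination (abMat φ).det * this
  have hdet2 : (abMat φ).det = ε * abMat (α⁻¹ * φ * α) 1 1 := by
    rw [← hdet, Matrix.det_fin_two, h00, h10]; ring
  obtain ⟨l, hl⟩ : ∃ l : Bool, abMat (α⁻¹ * φ * α) 1 1 = if l then -1 else 1 := by
    have h11 : abMat (α⁻¹ * φ * α) 1 1 = ε * (abMat φ).det := by
      rw [hdet2, ← mul_assoc, hε2, one_mul]
    rw [h11]
    rcases det_abMat φ with hd | hd <;> rw [hd, hε] <;> cases k
    exacts [⟨false, by simp⟩, ⟨true, by simp⟩, ⟨true, by simp⟩, ⟨false, by simp⟩]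
  obtain ⟨g, hg⟩ := exists_conj_mul_of_abMat_eq (φ := α⁻¹ * φ * α)
    (ψ := parabolic ((if l then -1 else 1) * abMat (α⁻¹ * φ * α) 0 1) k l) (by
      rw [abMat_parabolic]
      ext i j
      fin_cases i <;> fin_cases j
      · simpa [hε] using h00
      · cases l <;> simp
      · simpa using h10
      · simpa using hl)
  exact ⟨α, g, _, l, hg, by rw [hdet2, hl]⟩


/-! ### The commutator subgroup as a free group on `ℤ²` -/

/-- The commutator of the basis elements. -/
def comm2 : F2 := (of 0)⁻¹ * (of 1)⁻¹ * of 0 * of 1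

/-- It suffices to check the generators of `Aut F_2`, because the property is closed under products
and inverses. -/
theorem map_comm2 (φ : MulAut F2) : ∃ (k : F2) (s : ℤ), (s = 1 ∨ s = -1) ∧
    φ comm2 = k * comm2 ^ s * k⁻¹ := by
  have hφ : φ ∈ elementary := by rw [elementary_eq_top]; trivial
  induction hφ using Subgroup.closure_induction with
  | mem φ hφ =>
    rcases hφ with (rfl | rfl | rfl) | ⟨g, rfl⟩
    · exact ⟨1, -1, Or.inr rfl, by simp [comm2, mul_assoc]⟩
    · exact ⟨of 0, -1, Or.inr rfl, by simp [comm2, mul_assoc]⟩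
    · exact ⟨(of 1)⁻¹, 1, Or.inl rfl, by simp [comm2, mul_assoc]⟩
    · exact ⟨g, 1, Or.inl rfl, by simp⟩
  | one => exact ⟨1, 1, Or.inl rfl, by simp⟩
  | mul φ ψ _ _ hφ hψ =>
    obtain ⟨k, s, hs, h⟩ := hφ
    obtain ⟨l, t, ht, h'⟩ := hψ
    refine ⟨φ l * k, s * t, ?_, ?_⟩
    · rcases hs with rfl | rfl <;> rcases ht with rfl | rfl <;> simp
    · rw [MulAut.mul_apply, h', _root_.map_mul, _root_.map_mul, _root_.map_zpow, h, conj_zpow,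
        _root_.map_inv, zpow_mul]
      group
  | inv φ _ hφ =>
    obtain ⟨k, s, hs, h⟩ := hφ
    refine ⟨φ⁻¹ k⁻¹, s, hs, ?_⟩
    have h2 : φ⁻¹ (φ comm2 ^ s) = comm2 ^ s := by rw [_root_.map_zpow, MulAut.inv_apply_self]
    rw [h, conj_zpow, ← zpow_mul] at h2
    have hss : s * s = 1 := by rcases hs with rfl | rfl <;> rfl
    rw [hss, zpow_one, _root_.map_mul, _root_.map_mul, _root_.map_inv] at h2
    rw [← h2, _root_.map_inv]
    group

section CommutatorSubgroup

/-- The exponent vectors, which index a basis of the commutator subgroup. -/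
abbrev Vec2 : Type := Fin 2 → ℤ

/-- A representative of the coset with given exponent sums. -/
def cosetRep (v : Vec2) : F2 := of 1 ^ v 1 * of 0 ^ v 0

@[simp] theorem ex_cosetRep (v : Vec2) : ex (cosetRep v) = v := by
  ext i
  fin_cases i <;> simp [cosetRep]

/-- The homomorphism from a free group of infinite rank onto the commutator subgroup. -/
def commHom : FreeGroup Vec2 →* F2 :=
  FreeGroup.lift fun v => (cosetRep v)⁻¹ * comm2 * cosetRep v

theorem commHom_of (v : Vec2) : commHom (of v) = (cosetRep v)⁻¹ * comm2 * cosetRep v := by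
  simp [commHom]

theorem exists_partial_prod {G : Type*} [Group G] (f : ℤ → G) :
    ∃ γ : ℤ → G, γ 0 = 1 ∧ ∀ j, γ (j + 1) = γ j * f j := by
  let p : ℕ → G := fun n => Nat.rec 1 (fun k x => x * f k) n
  let q : ℕ → G := fun n => Nat.rec 1 (fun k x => x * (f (-(k + 1 : ℤ)))⁻¹) n
  refine ⟨fun j => match j with | .ofNat n => p n | .negSucc n => q (n + 1), rfl, ?_⟩
  rintro (n | n)
  · rfl
  · cases n with
    | zero =>
      change (1 : G) = 1 * (f (-((0 : ℕ) + 1 : ℤ)))⁻¹ * f (-1)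
      simp
    | succ n =>
      have : Int.negSucc (n + 1) + 1 = Int.negSucc n := by omega
      rw [this]
      change q (n + 1) = q (n + 1) * (f (-((n + 1 : ℕ) + 1 : ℤ)))⁻¹ * f (Int.negSucc (n + 1))
      have : (-((n + 1 : ℕ) + 1 : ℤ)) = Int.negSucc (n + 1) := by omega
      rw [this]
      simp

/-- `γ v` is to be the correction in `a · rep(v) = rep(v + e₀) · commHom (γ v)`. With the
representatives `b^j a^i` it is trivial for `j = 0`, and raising `j` by one contributes the basis
element of `v`; multiplication by `b` needs no correction. -/
theorem exists_schreier : ∃ γ : Vec2 → FreeGroup Vec2, (∀ v, v 1 = 0 → γ v = 1) ∧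
    ∀ v, γ (v + Pi.single 1 1) = γ v * of v := by
  choose G h0 h1 using fun i : ℤ => exists_partial_prod fun j => (of ![i, j] : FreeGroup Vec2)
  refine ⟨fun v => G (v 0) (v 1), fun v hv => by simp only [hv, h0], fun v => ?_⟩
  have hv : ![v 0, v 1] = v := by ext i; fin_cases i <;> rfl
  simpa [hv] using h1 (v 0) (v 1)

/-- A coefficient of the action on cosets. -/
noncomputable def schreier : Vec2 → FreeGroup Vec2 := exists_schreier.choose

theorem schreier_eq_one {v : Vec2} (hv : v 1 = 0) : schreier v = 1 :=
  exists_schreier.choose_spec.1 v hv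

theorem schreier_add (v : Vec2) : schreier (v + Pi.single 1 1) = schreier v * of v :=
  exists_schreier.choose_spec.2 v

/-- Multiplication by `a` on cosets. -/
noncomputable def cosetPermA : Equiv.Perm (FreeGroup Vec2 × Vec2) where
  toFun p := (schreier p.2 * p.1, p.2 + Pi.single 0 1)
  invFun p := ((schreier (p.2 - Pi.single 0 1))⁻¹ * p.1, p.2 - Pi.single 0 1)
  left_inv p := by simp
  right_inv p := by simp

/-- Multiplication by `b` on cosets. -/
noncomputable def cosetPermB : Equiv.Perm (FreeGroup Vec2 × Vec2) where
  toFun p := (p.1, p.2 + Pi.single 1 1)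
  invFun p := (p.1, p.2 - Pi.single 1 1)
  left_inv p := by simp
  right_inv p := by simp

/-- The left multiplication of `F_2` on `F_2`, in coordinates. -/
noncomputable def cosetAction : F2 →* Equiv.Perm (FreeGroup Vec2 × Vec2) :=
  FreeGroup.lift ![cosetPermA, cosetPermB]

theorem cosetPermA_zpow (n : ℤ) (x : FreeGroup Vec2) {v : Vec2} (hv : v 1 = 0) :
    (cosetPermA ^ n) (x, v) = (x, v + n • Pi.single 0 1) := by
  induction n using Int.induction_on with
  | zero => simp
  | succ n ih =>
    rw [add_comm, zpow_add, zpow_one, Equiv.Perm.mul_apply, ih]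
    have : schreier (v + (n : ℤ) • Pi.single 0 1) = 1 := schreier_eq_one (by simp [hv])
    ext1
    · change schreier (v + (n : ℤ) • Pi.single 0 1) * x = x
      rw [this, one_mul]
    · change v + (n : ℤ) • Pi.single 0 1 + Pi.single 0 1 = _
      rw [add_smul, one_smul, add_assoc, add_comm (Pi.single 0 1)]
  | pred n ih =>
    rw [sub_eq_add_neg, add_comm, zpow_add, zpow_neg_one, Equiv.Perm.mul_apply, ih]
    have : schreier (v + (-(n : ℤ)) • Pi.single 0 1 - Pi.single 0 1) = 1 :=
      schreier_eq_one (by simp [hv])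
    ext1
    · change (schreier (v + (-(n : ℤ)) • Pi.single 0 1 - Pi.single 0 1))⁻¹ * x = x
      rw [this]; simp
    · change v + (-(n : ℤ)) • Pi.single 0 1 - Pi.single 0 1 = _
      rw [add_smul, neg_one_smul]; abel_nf

theorem cosetPermB_zpow (n : ℤ) (x : FreeGroup Vec2) (v : Vec2) :
    (cosetPermB ^ n) (x, v) = (x, v + n • Pi.single 1 1) := by
  induction n using Int.induction_on with
  | zero => simp
  | succ n ih =>
    rw [add_comm, zpow_add, zpow_one, Equiv.Perm.mul_apply, ih]
    ext1
    · rfl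
    · change v + (n : ℤ) • Pi.single 1 1 + Pi.single 1 1 = _
      rw [add_smul, one_smul, add_assoc, add_comm (Pi.single 1 1)]
  | pred n ih =>
    rw [sub_eq_add_neg, add_comm, zpow_add, zpow_neg_one, Equiv.Perm.mul_apply, ih]
    ext1
    · rfl
    · change v + (-(n : ℤ)) • Pi.single 1 1 - Pi.single 1 1 = _
      rw [add_smul, neg_one_smul]; abel_nf

theorem cosetAction_cosetRep (v : Vec2) (x : FreeGroup Vec2) :
    cosetAction (cosetRep v) (x, 0) = (x, v) := by
  have h0 : cosetAction (of 0) = cosetPermA := by simp [cosetAction]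
  have h1 : cosetAction (of 1) = cosetPermB := by simp [cosetAction]
  rw [cosetRep, _root_.map_mul, _root_.map_zpow, _root_.map_zpow, h0, h1, Equiv.Perm.mul_apply,
    cosetPermA_zpow _ _ rfl, cosetPermB_zpow]
  ext1
  · rfl
  · ext i
    fin_cases i <;> simp

/-- Over the coset `v` the commutator acts as left multiplication by the basis element of `v`;
conjugation by the representative moves this to the coset `0`. Injectivity of `commHom` follows at
once. -/
theorem cosetAction_commHom (y x : FreeGroup Vec2) :
    cosetAction (commHom y) (x, 0) = (y * x, 0) := by
  have h0 : cosetAction (of 0) = cosetPermA := by simp [cosetAction]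
  have h1 : cosetAction (of 1) = cosetPermB := by simp [cosetAction]
  have hc : ∀ x v, cosetAction comm2 (x, v) = (of v * x, v) := by
    intro x v
    rw [comm2, _root_.map_mul, _root_.map_mul, _root_.map_mul, _root_.map_inv, _root_.map_inv,
      h0, h1]
    simp only [Equiv.Perm.mul_apply]
    rw [Equiv.Perm.inv_eq_iff_eq, Equiv.Perm.inv_eq_iff_eq]
    ext1
    · change schreier (v + Pi.single 1 1) * x = schreier v * (of v * x)
      rw [schreier_add, mul_assoc]
    · change v + Pi.single 1 1 + Pi.single 0 1 = v + Pi.single 0 1 + Pi.single 1 1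
      abel
  induction y using FreeGroup.induction_on generalizing x with
  | C1 => simp
  | of v =>
    rw [commHom_of, _root_.map_mul, _root_.map_mul, _root_.map_inv, Equiv.Perm.mul_apply,
      Equiv.Perm.mul_apply, cosetAction_cosetRep, hc, Equiv.Perm.inv_eq_iff_eq,
      cosetAction_cosetRep]
  | inv_of v h =>
    rw [_root_.map_inv, _root_.map_inv, Equiv.Perm.inv_eq_iff_eq, h, mul_inv_cancel_left]
  | mul y z hy hz => rw [_root_.map_mul, _root_.map_mul, Equiv.Perm.mul_apply, hz, hy, mul_assoc]

theorem commHom_injective : Function.Injective commHom := by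
  intro x y h
  have hx := cosetAction_commHom x 1
  rw [h, cosetAction_commHom, mul_one, mul_one, Prod.mk.injEq] at hx
  exact hx.1.symm

theorem commHom_schreier (v : Vec2) : commHom (schreier v) =
    (cosetRep (v + Pi.single 0 1))⁻¹ * of 0 * cosetRep v := by
  obtain ⟨i, j, rfl⟩ : ∃ i j : ℤ, v = ![i, j] := ⟨v 0, v 1, by ext i; fin_cases i <;> rfl⟩
  have hs : ∀ j : ℤ, ![i, j + 1] = ![i, j] + Pi.single 1 1 := by
    intro j; ext k; fin_cases k <;> simp
  have key : ∀ j : ℤ, commHom (schreier ![i, j + 1]) =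
      commHom (schreier ![i, j]) * ((cosetRep ![i, j])⁻¹ * comm2 * cosetRep ![i, j]) := by
    intro j
    rw [hs, schreier_add, _root_.map_mul, commHom_of]
  induction j using Int.induction_on with
  | zero =>
    rw [schreier_eq_one rfl]
    simp [cosetRep, zpow_add]
    group
  | succ n ih =>
    rw [key, ih]
    simp only [cosetRep, comm2, Pi.add_apply, Matrix.cons_val_zero, Matrix.cons_val_one,
      Pi.single_eq_same, Pi.single_apply]
    simp
    group
  | pred n ih =>
    have := key (-(n : ℤ) - 1)
    rw [sub_add_cancel, ih, ← mul_inv_eq_iff_eq_mul] at this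
    rw [← this]
    simp only [cosetRep, comm2, Pi.add_apply, Matrix.cons_val_zero, Matrix.cons_val_one,
      Pi.single_eq_same, Pi.single_apply]
    simp
    group

/-- The pair `(x, v)` stands for the element `rep(v) · commHom x`, and the action is left
multiplication. Acting on the pair of `1` writes every element in this form. -/
theorem cosetRep_cosetAction (g : F2) (p : FreeGroup Vec2 × Vec2) :
    cosetRep (cosetAction g p).2 * commHom (cosetAction g p).1 =
      g * (cosetRep p.2 * commHom p.1) := by
  have h0 : cosetAction (of 0) = cosetPermA := by simp [cosetAction]
  have h1 : cosetAction (of 1) = cosetPermB := by simp [cosetAction]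
  induction g using FreeGroup.induction_on generalizing p with
  | C1 => simp
  | of i =>
    fin_cases i
    · change cosetRep (cosetAction (of 0) p).2 * commHom (cosetAction (of 0) p).1 = of 0 * _
      rw [h0]
      change cosetRep (p.2 + Pi.single 0 1) * commHom (schreier p.2 * p.1) = _
      rw [_root_.map_mul, commHom_schreier]
      group
    · change cosetRep (cosetAction (of 1) p).2 * commHom (cosetAction (of 1) p).1 = of 1 * _
      rw [h1]
      change cosetRep (p.2 + Pi.single 1 1) * commHom p.1 = _
      simp only [cosetRep, Pi.add_apply, Pi.single_eq_same]
      simp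
      group
  | inv_of i h =>
    have := h (cosetAction (of i)⁻¹ p)
    have e : cosetAction (of i) (cosetAction (of i)⁻¹ p) = p := by simp
    rw [e] at this
    rw [this]
    group
  | mul x y hx hy => rw [_root_.map_mul, Equiv.Perm.mul_apply, hx, hy, mul_assoc]

theorem exists_cosetRep_mul (g : F2) : ∃ x, g = cosetRep (ex g) * commHom x := by
  have h := cosetRep_cosetAction g (1, 0)
  have h0 : cosetRep 0 = 1 := by simp [cosetRep]
  rw [_root_.map_one, h0, mul_one, mul_one] at h
  generalize cosetAction g (1, 0) = p at h
  have hex : ∀ x, ex (commHom x) = 0 := by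
    intro x
    induction x using FreeGroup.induction_on with
    | C1 => simp
    | of v => simp [commHom_of, comm2]
    | inv_of v h => rw [_root_.map_inv, ex_inv, h, neg_zero]
    | mul x y hx hy => rw [_root_.map_mul, ex_mul, hx, hy, add_zero]
  have : ex g = p.2 := by rw [← h, ex_mul, hex, ex_cosetRep, add_zero]
  exact ⟨p.1, by rw [this, h]⟩

theorem exists_commHom_eq {g : F2} (h : ex g = 0) : ∃ x, g = commHom x := by
  obtain ⟨x, hx⟩ := exists_cosetRep_mul g
  exact ⟨x, by rw [h] at hx; simpa [cosetRep] using hx⟩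

end CommutatorSubgroup

/-! ### Hyperbolic action on the abelianization -/

section Killing

/-- The endomorphism that kills the basis elements outside of `S`. -/
def killOutside (S : Finset Vec2) : FreeGroup Vec2 →* FreeGroup Vec2 :=
  FreeGroup.lift fun v => if v ∈ S then of v else 1

theorem killOutside_of (S : Finset Vec2) (v : Vec2) :
    killOutside S (of v) = if v ∈ S then of v else 1 := by simp [killOutside]

theorem killOutside_killOutside (S T : Finset Vec2) (y : FreeGroup Vec2) :
    killOutside S (killOutside T y) = killOutside (S ∩ T) y := by
  have : (killOutside S).comp (killOutside T) = killOutside (S ∩ T) := by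
    ext v
    rw [MonoidHom.comp_apply, killOutside_of, killOutside_of]
    by_cases hS : v ∈ S <;> by_cases hT : v ∈ T <;> simp [hS, hT, killOutside_of]
  exact DFunLike.congr_fun this y

theorem exists_killOutside_eq (y : FreeGroup Vec2) : ∃ S, killOutside S y = y := by
  induction y using FreeGroup.induction_on with
  | C1 => exact ⟨∅, by simp⟩
  | of v => exact ⟨{v}, by simp [killOutside_of]⟩
  | inv_of v _ => exact ⟨{v}, by rw [_root_.map_inv]; simp [killOutside_of]⟩
  | mul x y hx hy =>
    obtain ⟨S, hS⟩ := hx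
    obtain ⟨T, hT⟩ := hy
    refine ⟨S ∪ T, ?_⟩
    have h1 : killOutside (S ∪ T) x = x := by
      conv_lhs => rw [← hS]
      rw [killOutside_killOutside, Finset.inter_eq_right.2 Finset.subset_union_left, hS]
    have h2 : killOutside (S ∪ T) y = y := by
      conv_lhs => rw [← hT]
      rw [killOutside_killOutside, Finset.inter_eq_right.2 Finset.subset_union_right, hT]
    rw [_root_.map_mul, h1, h2]

theorem killOutside_singleton_mem (p : Vec2) (y : FreeGroup Vec2) :
    killOutside {p} y ∈ Subgroup.zpowers (of p) := by
  induction y using FreeGroup.induction_on with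
  | C1 => rw [_root_.map_one]; exact one_mem _
  | of v =>
    rw [killOutside_of]
    split_ifs with h
    · rw [Finset.mem_singleton.1 h]; exact Subgroup.mem_zpowers _
    · exact one_mem _
  | inv_of v h => rw [_root_.map_inv]; exact inv_mem h
  | mul x y hx hy => rw [_root_.map_mul]; exact mul_mem hx hy

/-- If `f` maps each basis element to a conjugate of a power of another one, as given by an
injective map `σ`, then the sets not killing a fixed element are closed under preimages. -/
theorem killOutside_ne_one_of_map {f : FreeGroup Vec2 →* FreeGroup Vec2} {σ : Vec2 → Vec2}
    {x : Vec2 → FreeGroup Vec2} {s : ℤ}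
    (hf : ∀ v, f (of v) = (x v)⁻¹ * of (σ v) ^ s * x v) {S T : Finset Vec2}
    (hST : ∀ v, σ v ∈ S → v ∈ T) {y : FreeGroup Vec2} (hy : f y = y) (hS : killOutside S y ≠ 1) :
    killOutside T y ≠ 1 := by
  intro hT
  apply hS
  have : ((killOutside S).comp f) = ((killOutside S).comp f).comp (killOutside T) := by
    ext v
    simp only [MonoidHom.comp_apply, killOutside_of]
    split_ifs with h
    · rfl
    · have h' : σ v ∉ S := fun h' => h (hST v h')
      rw [hf]
      simp [killOutside_of, h']
  have := DFunLike.congr_fun this y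
  simpa [hy, hT] using this

/-- The finite set of differences of `U` is invariant under `N`, hence under `M = N⁻¹`. At a
difference `m` maximising one coordinate, `Mm + Nm = tm` gives `3|mᵢ| ≤ 2|mᵢ|`. -/
theorem eq_of_mem_invariant {U : Finset Vec2} {M N : Matrix (Fin 2) (Fin 2) ℤ} (hMN : M * N = 1)
    {t : ℤ} (ht : 3 ≤ |t|) (hsum : M + N = t • (1 : Matrix (Fin 2) (Fin 2) ℤ)) {c : Vec2}
    (hU : ∀ u ∈ U, N.mulVec (u - c) ∈ U) {p q : Vec2} (hp : p ∈ U) (hq : q ∈ U) : p = q := by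
  classical
  let D : Finset Vec2 := (U ×ˢ U).image fun x => x.1 - x.2
  have hD : ∀ {d}, d ∈ D ↔ ∃ u ∈ U, ∃ v ∈ U, u - v = d := by
    intro d
    simp only [D, Finset.mem_image, Finset.mem_product, Prod.exists]
    exact ⟨fun ⟨u, v, ⟨hu, hv⟩, h⟩ => ⟨u, hu, v, hv, h⟩,
      fun ⟨u, hu, v, hv, h⟩ => ⟨u, v, ⟨hu, hv⟩, h⟩⟩
  have hN : ∀ d ∈ D, N.mulVec d ∈ D := by
    intro d hd
    obtain ⟨u, hu, v, hv, rfl⟩ := hD.1 hd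
    refine hD.2 ⟨_, hU u hu, _, hU v hv, ?_⟩
    rw [← Matrix.mulVec_sub]
    congr 1
    abel
  have hinj : Function.Injective (N.mulVec) := by
    intro a b h
    have := congrArg M.mulVec h
    simpa only [Matrix.mulVec_mulVec, hMN, Matrix.one_mulVec] using this
  have hM : ∀ d ∈ D, M.mulVec d ∈ D := by
    intro d hd
    obtain ⟨d', hd', h⟩ := Finset.surjOn_of_injOn_of_card_le N.mulVec hN hinj.injOn le_rfl hd
    rw [← h, Matrix.mulVec_mulVec, hMN, Matrix.one_mulVec]
    exact hd'
  have hzero : ∀ i, ∀ d ∈ D, d i = 0 := by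
    intro i d hd
    obtain ⟨m, hm, hmax⟩ := Finset.exists_max_image D (fun d => |d i|) ⟨d, hd⟩
    have e := congrArg (fun A : Matrix (Fin 2) (Fin 2) ℤ => A.mulVec m i) hsum
    simp only [Matrix.add_mulVec, Matrix.smul_mulVec, Matrix.one_mulVec, Pi.add_apply,
      Pi.smul_apply, smul_eq_mul] at e
    have h1 := hmax _ (hM m hm)
    have h2 := hmax _ (hN m hm)
    have h3 := abs_add_le (M.mulVec m i) (N.mulVec m i)
    rw [e, abs_mul] at h3
    have h4 : 3 * |m i| ≤ |t| * |m i| := mul_le_mul_of_nonneg_right ht (abs_nonneg _)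
    have h5 := hmax d hd
    have h6 := abs_nonneg (m i)
    have h7 : |d i| = 0 := le_antisymm (by linarith) (abs_nonneg _)
    exact abs_eq_zero.1 h7
  ext i
  exact sub_eq_zero.1 (hzero i (p - q) (hD.2 ⟨p, hp, q, hq, rfl⟩))

/-- An automorphism that is hyperbolic on the abelianization has a commutative fixed subgroup. -/
theorem commFix_of_three_le_trace {φ : MulAut F2} (hd : (abMat φ).det = 1)
    (ht : 3 ≤ |abMat φ 0 0 + abMat φ 1 1|) : CommFix φ := by
  classical
  have hMN : abMat φ * abMat φ⁻¹ = 1 := abMat_mul_inv φ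
  have hNM : abMat φ⁻¹ * abMat φ = 1 := abMat_inv_mul φ
  have hsum : abMat φ + abMat φ⁻¹ =
      (abMat φ 0 0 + abMat φ 1 1) • (1 : Matrix (Fin 2) (Fin 2) ℤ) := by
    have hadj : abMat φ⁻¹ = (abMat φ).adjugate := by
      calc abMat φ⁻¹ = abMat φ⁻¹ * (abMat φ * (abMat φ).adjugate) := by
            rw [Matrix.mul_adjugate, hd, one_smul, mul_one]
        _ = _ := by rw [← mul_assoc, hNM, one_mul]
    rw [hadj, Matrix.adjugate_fin_two]
    ext i j
    fin_cases i <;> fin_cases j <;> simp [add_comm]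
  -- A vector fixed by `M` is fixed by `M⁻¹`, so `M + M⁻¹ = t` gives `(t - 2)v = 0` with `t ≠ 2`.
  have hex : ∀ u, φ u = u → ex u = 0 := by
    intro u hu
    have h1 : (abMat φ).mulVec (ex u) = ex u := by rw [← ex_map, hu]
    have h2 : (abMat φ⁻¹).mulVec (ex u) = ex u := by
      conv_lhs => rw [← h1]
      rw [Matrix.mulVec_mulVec, hNM, Matrix.one_mulVec]
    have h3 := congrArg (fun A : Matrix (Fin 2) (Fin 2) ℤ => A.mulVec (ex u)) hsum
    simp only [Matrix.add_mulVec, Matrix.smul_mulVec, Matrix.one_mulVec, h1, h2] at h3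
    ext i
    have h4 := congrFun h3 i
    simp only [Pi.add_apply, Pi.smul_apply, smul_eq_mul] at h4
    have h5 : (abMat φ 0 0 + abMat φ 1 1 - 2) * ex u i = 0 := by linear_combination -h4
    rcases mul_eq_zero.1 h5 with h6 | h6
    · rw [sub_eq_zero.1 h6] at ht
      norm_num at ht
    · exact h6
  obtain ⟨k, s, -, hk⟩ := map_comm2 φ
  let σ : Vec2 → Vec2 := fun v => (abMat φ).mulVec v - ex k
  -- Since `φ([a,b]) = k[a,b]^s k⁻¹`, the basis element of `v` goes to a conjugate of the `s`-th
  -- power of the one indexed by the coset of `k⁻¹φ(rep v)`, an affine function of `v`.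
  have hbasis : ∀ v, ∃ x, φ (commHom (of v)) = commHom (x⁻¹ * of (σ v) ^ s * x) := by
    intro v
    obtain ⟨x, hx⟩ := exists_cosetRep_mul (k⁻¹ * φ (cosetRep v))
    have hv : ex (k⁻¹ * φ (cosetRep v)) = σ v := by
      rw [ex_mul, ex_map, ex_cosetRep, ex_inv, neg_add_eq_sub]
    rw [hv] at hx
    refine ⟨x, ?_⟩
    calc φ (commHom (of v))
        = (k⁻¹ * φ (cosetRep v))⁻¹ * comm2 ^ s * (k⁻¹ * φ (cosetRep v)) := by
          rw [commHom_of, _root_.map_mul, _root_.map_mul, _root_.map_inv, hk]; group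
      _ = (commHom x)⁻¹ * ((cosetRep (σ v))⁻¹ * comm2 ^ s * cosetRep (σ v)) * commHom x := by
          rw [hx]; group
      _ = _ := by
          rw [_root_.map_mul, _root_.map_mul, _root_.map_inv, _root_.map_zpow, commHom_of]
          congr 2
          have := (conj_zpow (i := s) (a := (cosetRep (σ v))⁻¹) (b := comm2)).symm
          rwa [inv_inv] at this
  choose x hx using hbasis
  let f : FreeGroup Vec2 →* FreeGroup Vec2 :=
    FreeGroup.lift fun v => (x v)⁻¹ * of (σ v) ^ s * x v
  have hf : ∀ v, f (of v) = (x v)⁻¹ * of (σ v) ^ s * x v := fun v => by simp [f]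
  have hfφ : ∀ y, commHom (f y) = φ (commHom y) := by
    have : commHom.comp f = φ.toMonoidHom.comp commHom := by
      ext v
      simpa [hf] using (hx v).symm
    exact fun y => DFunLike.congr_fun this y
  intro u v hu hv
  obtain ⟨y, rfl⟩ := exists_commHom_eq (hex u hu)
  obtain ⟨z, rfl⟩ := exists_commHom_eq (hex v hv)
  have hy : f y = y := commHom_injective (by rw [hfφ, hu])
  have hz : f z = z := commHom_injective (by rw [hfφ, hv])
  rw [← _root_.map_mul, ← _root_.map_mul]
  congr 1
  -- A nontrivial commutator `h` of two fixed elements is fixed. Consider the smallest sets `S` of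
  -- indices such that `h` survives killing all other basis elements.
  by_contra hne
  obtain ⟨h, hh⟩ : ∃ h, h = y * z * y⁻¹ * z⁻¹ := ⟨_, rfl⟩
  have hh1 : h ≠ 1 := by
    intro h1
    rw [hh, mul_inv_eq_one, mul_inv_eq_iff_eq_mul] at h1
    exact hne h1
  have hfh : f h = h := by simp [hh, hy, hz]
  obtain ⟨S₀, hS₀⟩ := exists_killOutside_eq h
  have hex0 : ∃ m, ∃ S, killOutside S h ≠ 1 ∧ S.card = m :=
    ⟨_, S₀, by rwa [hS₀], rfl⟩
  obtain ⟨S, hS1, hScard⟩ := Nat.find_spec hex0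
  have hmin : ∀ T, killOutside T h ≠ 1 → S.card ≤ T.card := by
    intro T hT
    rw [hScard]
    exact Nat.find_min' hex0 ⟨T, hT, rfl⟩
  have hsub : ∀ T, killOutside T h ≠ 1 → T.card = S.card → T ⊆ S₀ := by
    intro T hT hc
    rw [← hS₀, killOutside_killOutside] at hT
    have := hmin _ hT
    rw [← hc] at this
    rw [← Finset.eq_of_subset_of_card_le Finset.inter_subset_left this]
    exact Finset.inter_subset_right
  -- The union of the minimal sets. Each of them lies in the finite support `S₀`, and preimages
  -- under the affine index map of minimal sets are again minimal.
  let U : Finset Vec2 := S₀.filter fun u => ∃ T, killOutside T h ≠ 1 ∧ T.card = S.card ∧ u ∈ T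
  have hU : ∀ u, u ∈ U ↔ ∃ T, killOutside T h ≠ 1 ∧ T.card = S.card ∧ u ∈ T := by
    intro u
    rw [Finset.mem_filter]
    exact ⟨fun h => h.2, fun ⟨T, h1, h2, h3⟩ => ⟨hsub T h1 h2 h3, T, h1, h2, h3⟩⟩
  have hUinv : ∀ u ∈ U, (abMat φ⁻¹).mulVec (u - -ex k) ∈ U := by
    intro u hu
    obtain ⟨T, h1, h2, h3⟩ := (hU u).1 hu
    rw [hU]
    refine ⟨T.image fun u => (abMat φ⁻¹).mulVec (u - -ex k), ?_, ?_,
      Finset.mem_image_of_mem _ h3⟩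
    · refine killOutside_ne_one_of_map hf (fun v hv => ?_) hfh h1
      rw [Finset.mem_image]
      refine ⟨σ v, hv, ?_⟩
      rw [sub_neg_eq_add, sub_add_cancel, Matrix.mulVec_mulVec, hNM, Matrix.one_mulVec]
    · rw [Finset.card_image_of_injective, h2]
      intro a b hab
      have := congrArg (abMat φ).mulVec hab
      simpa only [Matrix.mulVec_mulVec, hMN, Matrix.one_mulVec, sub_left_inj] using this
  have hSne : S.Nonempty := by
    rw [Finset.nonempty_iff_ne_empty]
    rintro rfl
    apply hS1
    have : killOutside ∅ = 1 := by ext v; simp [killOutside_of]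
    rw [this, MonoidHom.one_apply]
  obtain ⟨p, hp⟩ := hSne
  have hSp : S = {p} := by
    refine Finset.eq_singleton_iff_unique_mem.2 ⟨hp, fun q hq => ?_⟩
    -- Thus a minimal set has a single point; but with a single surviving basis element the images
    -- of `y` and `z` commute and `h` dies.
    exact eq_of_mem_invariant hMN ht hsum hUinv ((hU q).2 ⟨S, hS1, rfl, hq⟩)
      ((hU p).2 ⟨S, hS1, rfl, hp⟩)
  apply hS1
  rw [hSp, hh]
  obtain ⟨i, hi⟩ := killOutside_singleton_mem p y
  obtain ⟨j, hj⟩ := killOutside_singleton_mem p z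
  simp only [_root_.map_mul, _root_.map_inv, ← hi, ← hj]
  group

end Killing


/-! ### Classification of fixed subgroups by determinant and trace -/

theorem commFix_of_trace_neg_two {φ : MulAut F2} (hd : (abMat φ).det = 1)
    (ht : abMat φ 0 0 + abMat φ 1 1 = -2) : CommFix φ := by
  obtain ⟨α, g, n, l, h, hl⟩ := exists_conj_parabolic (φ := φ) true (by
    rw [Matrix.det_fin_two] at hd ⊢
    simp
    linear_combination hd + ht)
  refine CommFix.of_conj_inv α ?_
  rw [h]
  cases l
  · rw [hd] at hl; norm_num at hl
  · exact commFix_conj_parabolic g n true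

/-- Either the fixed elements commute, or the automorphism is trivial, or its fixed subgroup is
that of a conjugate of `τ`. -/
theorem fixClassified (φ : MulAut F2) : FixClassified φ := by
  have hsq00 : abMat (φ ^ 2) 0 0 = abMat φ 0 0 * abMat φ 0 0 + abMat φ 0 1 * abMat φ 1 0 := by
    rw [pow_two, abMat_mul, Matrix.mul_apply, Fin.sum_univ_two]
  have hsq11 : abMat (φ ^ 2) 1 1 = abMat φ 1 0 * abMat φ 0 1 + abMat φ 1 1 * abMat φ 1 1 := by
    rw [pow_two, abMat_mul, Matrix.mul_apply, Fin.sum_univ_two]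
  have hsq01 : abMat (φ ^ 2) 0 1 = abMat φ 0 0 * abMat φ 0 1 + abMat φ 0 1 * abMat φ 1 1 := by
    rw [pow_two, abMat_mul, Matrix.mul_apply, Fin.sum_univ_two]
  have hsq10 : abMat (φ ^ 2) 1 0 = abMat φ 1 0 * abMat φ 0 0 + abMat φ 1 1 * abMat φ 1 0 := by
    rw [pow_two, abMat_mul, Matrix.mul_apply, Fin.sum_univ_two]
  have hdsq : (abMat (φ ^ 2)).det = (abMat φ).det * (abMat φ).det := by
    rw [pow_two, abMat_mul, Matrix.det_mul]
  have hpar : ∀ k : Bool, (k = false ∨ (abMat φ).det = 1) →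
      (abMat φ - (if k then -1 else 1 : ℤ) • (1 : Matrix (Fin 2) (Fin 2) ℤ)).det = 0 →
      FixClassified φ := by
    intro k hk h
    obtain ⟨α, g, n, l, h, hl⟩ := exists_conj_parabolic (φ := φ) k h
    refine FixClassified.of_conj α⁻¹ ?_
    rw [inv_inv, h]
    refine fixClassified_conj_parabolic g n k l ?_
    rcases hk with hk | hk
    · exact Or.inl hk
    · rw [hk] at hl
      cases k <;> cases l <;> revert hl <;> decide
  have hfin := Matrix.det_fin_two (abMat φ)
  rcases det_abMat φ with hd | hd
  · rw [hd] at hfin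
    by_cases h3 : 3 ≤ |abMat φ 0 0 + abMat φ 1 1|
    · exact Or.inl (commFix_of_three_le_trace hd h3)
    have ht : abMat φ 0 0 + abMat φ 1 1 = 2 ∨ abMat φ 0 0 + abMat φ 1 1 = 1 ∨
        abMat φ 0 0 + abMat φ 1 1 = 0 ∨ abMat φ 0 0 + abMat φ 1 1 = -1 ∨
        abMat φ 0 0 + abMat φ 1 1 = -2 := by
      rw [Int.abs_eq_natAbs] at h3
      omega
    rcases ht with ht | ht | ht | ht | ht
    · refine hpar false (Or.inl rfl) ?_
      rw [Matrix.det_fin_two]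
      simp
      linear_combination -hfin - ht
    -- By Cayley–Hamilton a matrix of determinant 1 and trace 1 satisfies `M³ = -1`, which has trace
    -- `-2`.
    · refine Or.inl (CommFix.of_pow 3 (commFix_of_trace_neg_two ?_ ?_))
      · rw [pow_succ, abMat_mul, Matrix.det_mul, hdsq, hd]; rfl
      · have h11 : abMat φ 1 1 = 1 - abMat φ 0 0 := by linarith
        rw [pow_succ, abMat_mul, Matrix.mul_apply, Matrix.mul_apply, Fin.sum_univ_two,
          Fin.sum_univ_two, hsq00, hsq01, hsq10, hsq11]
        rw [h11] at hfin ⊢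
        linear_combination 3 * hfin
    -- Here `M² = -1`.
    · refine Or.inl (CommFix.of_pow 2 (commFix_of_trace_neg_two ?_ ?_))
      · rw [hdsq, hd]; rfl
      · have h11 : abMat φ 1 1 = - abMat φ 0 0 := by linarith
        rw [hsq00, hsq11]
        rw [h11] at hfin ⊢
        linear_combination 2 * hfin
    · exact Or.inl (commFix_of_trace_neg_one hd ht)
    · exact Or.inl (commFix_of_trace_neg_two hd ht)
  · rw [hd] at hfin
    by_cases ht : abMat φ 0 0 + abMat φ 1 1 = 0
    -- Determinant `-1` and trace 0: the eigenvalues are `1` and `-1`, and the eigenvalue `1` is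
    -- used.
    · refine hpar false (Or.inl rfl) ?_
      rw [Matrix.det_fin_two]
      simp
      linear_combination -hfin - ht
    -- For determinant `-1` and trace `t ≠ 0`, the square is hyperbolic, with determinant 1 and
    -- trace `t² + 2 ≥ 3`.
    · refine Or.inl (CommFix.of_pow 2 (commFix_of_three_le_trace ?_ ?_))
      · rw [hdsq, hd]; rfl
      · have : abMat (φ ^ 2) 0 0 + abMat (φ ^ 2) 1 1 =
            (abMat φ 0 0 + abMat φ 1 1) ^ 2 + 2 := by
          rw [hsq00, hsq11]; linear_combination 2 * hfin
        rw [this]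
        have : 0 < (abMat φ 0 0 + abMat φ 1 1) ^ 2 := by positivity
        rw [abs_of_pos] <;> omega

/-! ### Commuting elements and roots in free groups -/

section Commute

/-- Two different basis elements can be sent to noncommuting transpositions of three points. -/
theorem FreeGroup.eq_of_commute_of {α : Type*} {x y : α}
    (h : (of x : FreeGroup α) * of y = of y * of x) : x = y := by
  classical
  by_contra hxy
  have := congrArg (FreeGroup.lift fun z => if z = x then Equiv.swap (0 : Fin 3) 1 else
    Equiv.swap 1 2) h
  simp only [_root_.map_mul, lift_apply_of, if_true, if_neg (Ne.symm hxy)] at this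
  revert this
  decide

/-- Commuting elements of a free group are powers of a common element. -/
theorem FreeGroup.exists_zpow_of_commute {α : Type*} {g r : FreeGroup α} (h : g * r = r * g) :
    ∃ (c : FreeGroup α) (i j : ℤ), g = c ^ i ∧ r = c ^ j := by
  let C := Subgroup.closure {g, r}
  have hC : ∀ x y : C, x * y = y * x := by
    have := Subgroup.isMulCommutative_closure (k := {g, r}) (by
      rintro x (rfl | rfl) y (rfl | rfl) <;> simp [h])
    exact fun x y => mul_comm' x y
  let e := IsFreeGroup.mulEquiv C
  -- By Nielsen–Schreier the subgroup is free; being commutative it has at most one free generator.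
  have hsub : ∀ x y : IsFreeGroup.Generators C, x = y := fun x y =>
    eq_of_commute_of (e.injective (by rw [_root_.map_mul, _root_.map_mul, hC]))
  have hcyc : ∃ c : C, ∀ x : C, ∃ i : ℤ, x = c ^ i := by
    have : ∃ c : FreeGroup (IsFreeGroup.Generators C), ∀ x, ∃ i : ℤ, x = c ^ i := by
      by_cases hne : Nonempty (IsFreeGroup.Generators C)
      · obtain ⟨z⟩ := hne
        refine ⟨of z, fun x => ?_⟩
        induction x using FreeGroup.induction_on with
        | C1 => exact ⟨0, by simp⟩
        | of y => exact ⟨1, by rw [hsub y z, zpow_one]⟩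
        | inv_of y _ => exact ⟨-1, by rw [hsub y z, zpow_neg_one]⟩
        | mul x y hx hy =>
          obtain ⟨i, rfl⟩ := hx
          obtain ⟨j, rfl⟩ := hy
          exact ⟨i + j, by rw [zpow_add]⟩
      · refine ⟨1, fun x => ⟨0, ?_⟩⟩
        have : IsEmpty (IsFreeGroup.Generators C) := not_nonempty_iff.1 hne
        exact Subsingleton.elim _ _
    obtain ⟨c, hc⟩ := this
    refine ⟨e c, fun x => ?_⟩
    obtain ⟨i, hi⟩ := hc (e.symm x)
    exact ⟨i, by rw [← _root_.map_zpow, ← hi, MulEquiv.apply_symm_apply]⟩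
  obtain ⟨c, hc⟩ := hcyc
  obtain ⟨i, hi⟩ := hc ⟨g, Subgroup.subset_closure (by simp)⟩
  obtain ⟨j, hj⟩ := hc ⟨r, Subgroup.subset_closure (by simp)⟩
  exact ⟨c, i, j, by simpa using congrArg Subtype.val hi, by simpa using congrArg Subtype.val hj⟩

/-- An element commuting with a nontrivial fixed element is fixed. -/
theorem FreeGroup.map_eq_of_commute {α : Type*} {φ : MulAut (FreeGroup α)} {g r : FreeGroup α}
    (hr : r ≠ 1) (hφ : φ r = r) (h : g * r = r * g) : φ g = g := by
  obtain ⟨c, i, j, rfl, rfl⟩ := exists_zpow_of_commute h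
  have hj : j ≠ 0 := by rintro rfl; simp at hr
  rw [_root_.map_zpow] at hφ ⊢
  rw [zpow_left_injective hj hφ]

end Commute

/-! ### Length estimates for chains and signed permutations -/

section Length

theorem FreeGroup.len_map_le {α β : Type*} [DecidableEq α] [DecidableEq β]
    (f : FreeGroup α →* FreeGroup β) {C : ℕ} (h : ∀ i, len (f (of i)) ≤ C) (x : FreeGroup α) :
    len (f x) ≤ C * len x := by
  have key : ∀ L : List (α × Bool), len (f (mk L)) ≤ C * L.length := by
    intro L
    induction L with
    | nil => simp [← one_eq_mk]
    | cons y L ih =>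
      have e : mk (y :: L) = mk [y] * mk L := by rw [mul_mk]; rfl
      have hy : len (f (mk [y])) ≤ C := by
        obtain ⟨i, b⟩ := y
        cases b
        · have : (mk [(i, false)] : FreeGroup α) = (of i)⁻¹ := by simp [of, invRev]
          rw [this, _root_.map_inv, len, wt_inv]
          exact h i
        · exact h i
      rw [e, _root_.map_mul]
      refine (wt_mul_le _ _ _).trans ?_
      rw [List.length_cons, mul_add, mul_one, add_comm]
      exact add_le_add ih hy
  have := key x.toWord
  rwa [mk_toWord, ← FreeGroup.norm, ← len_eq_norm] at this

theorem len_chain_le (e : Bool) (w : List Bool) (x : F2) :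
    len (chain e w x) ≤ 2 ^ w.length * len x := by
  induction w with
  | nil => simp
  | cons t w ih =>
    rw [chain_cons, MulAut.mul_apply]
    refine (len_map_le (chainLetter e t).toMonoidHom (C := 2) ?_ _).trans ?_
    · intro i
      have h0 : ∀ i : Fin 2, len (of i : F2) = 1 := fun i => by rw [len_eq_norm, norm_of]
      have h1 : ∀ i : Fin 2, len ((of i)⁻¹ : F2) = 1 := fun i => by rw [len, wt_inv]; exact h0 i
      have h2 : ∀ x y : F2, len x = 1 → len y = 1 → len (x * y) ≤ 2 := fun x y hx hy =>
        (wt_mul_le _ x y).trans (add_le_add hx.le hy.le)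
      fin_cases i <;> cases e <;> cases t <;> simp [chainLetter] <;>
        first
          | exact h2 _ _ (h0 _) (h0 _)
          | exact h2 _ _ (h0 _) (h1 _)
          | exact (h0 _).trans_le one_le_two
    · rw [List.length_cons, pow_succ, mul_comm (2 ^ _) 2, mul_assoc]
      exact Nat.mul_le_mul_left 2 ih

theorem IsTypeW1.len_apply {β : MulAut F2} (hβ : IsTypeW1 β) (x : F2) : len (β x) = len x := by
  have key : ∀ {β : MulAut F2}, IsTypeW1 β → ∀ x, len (β x) ≤ len x := by
    intro β hβ x
    have := len_map_le β.toMonoidHom (C := 1) (fun i => by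
      obtain ⟨y, hy⟩ := hβ.exists_letter (i, true)
      rw [elt_true] at hy
      change len (β (of i)) ≤ 1
      rw [hy, Letter.len_elt]) x
    simpa using this
  refine le_antisymm (key hβ x) ?_
  simpa using key hβ.inv (β x)

theorem abs_ex_le_len (g : F2) : |ex g 0| + |ex g 1| ≤ len g := by
  have key : ∀ L : List Letter, |ex (mk L) 0| + |ex (mk L) 1| ≤ L.length := by
    intro L
    induction L with
    | nil => simp [← one_eq_mk]
    | cons y L ih =>
      have e : mk (y :: L) = y.elt * mk L := by rw [Letter.elt, mul_mk]; rfl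
      have h0 := ex_elt y
      have h1 := abs_add_le (ex y.elt 0) (ex (mk L) 0)
      have h2 := abs_add_le (ex y.elt 1) (ex (mk L) 1)
      rw [e, ex_mul, Pi.add_apply, Pi.add_apply, List.length_cons]
      push_cast
      linarith
  have := key g.toWord
  rwa [mk_toWord, ← FreeGroup.norm, ← len_eq_norm] at this

end Length

/-! ### The set `Ω`: the `δ_i` are the conjugations by letters -/

section Omega

theorem delta_eq_conj (i : Fin 4) :
    delta i = MulAut.conj (Letter.elt (![1, 1, 0, 0] i, ![false, true, false, true] i)) := by
  have hd : ∀ (i j : Fin 2) (e : Bool) (h₁ h₂), i ≠ j →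
      whitehead {(i, true), (i, false)} (j, e) h₁ h₂ = MulAut.conj (Letter.elt (j, !e)) := by
    intro i j e h₁ h₂ hij
    have : ∀ k : Fin 2, whitehead {(i, true), (i, false)} (j, e) h₁ h₂ (of k) =
        MulAut.conj (Letter.elt (j, !e)) (of k) := by
      intro k
      rw [whitehead_coe]
      fin_cases i <;> fin_cases j <;> fin_cases k <;> cases e <;>
        simp_all [whiteheadHom, elt_true, elt_false]
    exact aut_ext (this 0) (this 1)
  fin_cases i <;> exact hd _ _ _ (by decide) (by decide) (by decide)

theorem conj_elt_eq_delta (x : Letter) : ∃ i, MulAut.conj x.elt = delta i := by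
  obtain ⟨j, e⟩ := x
  fin_cases j <;> cases e
  exacts [⟨2, (delta_eq_conj 2).symm⟩, ⟨3, (delta_eq_conj 3).symm⟩, ⟨0, (delta_eq_conj 0).symm⟩,
    ⟨1, (delta_eq_conj 1).symm⟩]

theorem conj_mem_deltaCompositionsUpTo {g : F2} {N : ℕ} (h : len g ≤ N) :
    MulAut.conj g ∈ deltaCompositionsUpTo N := by
  have key : ∀ L : List Letter, ∃ w : List (Fin 4), w.length = L.length ∧
      MulAut.conj (mk L : F2) = (w.map delta).prod := by
    intro L
    induction L with
    | nil => exact ⟨[], rfl, by simp [← one_eq_mk]⟩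
    | cons y L ih =>
      obtain ⟨w, hw, h⟩ := ih
      obtain ⟨i, hi⟩ := conj_elt_eq_delta y
      have e : mk (y :: L) = y.elt * mk L := by rw [Letter.elt, mul_mk]; rfl
      exact ⟨i :: w, by simp [hw], by rw [e, _root_.map_mul, hi, h]; simp⟩
  obtain ⟨w, hw, h'⟩ := key g.toWord
  rw [mk_toWord] at h'
  rw [len_eq_norm, FreeGroup.norm] at h
  exact ⟨w, by omega, h'⟩

theorem chainC1_append (l : List (ℕ × ℕ)) (x y : ℕ) :
    chainC1 (l ++ [(x, y)]) = tau ^ y * sigma ^ x * chainC1 l := by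
  induction l with
  | nil => simp [chainC1]
  | cons p l ih => rw [List.cons_append, chainC1, ih, chainC1, mul_assoc]

theorem chainC2_append (l : List (ℕ × ℕ)) (x y : ℕ) :
    chainC2 (l ++ [(x, y)]) = tau⁻¹ ^ y * sigma⁻¹ ^ x * chainC2 l := by
  induction l with
  | nil => simp [chainC2]
  | cons p l ih => rw [List.cons_append, chainC2, ih, chainC2, mul_assoc]

theorem chain_mem_chainsUpTo (e : Bool) {w : List Bool} {N : ℕ} (h : w.length ≤ N) :
    chain e w ∈ chainsUpTo N := by
  have key : ∃ l, chainLength l = w.length ∧ chain e w = if e then chainC1 l else chainC2 l := by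
    clear h
    induction w with
    | nil => exact ⟨[], rfl, by cases e <;> rfl⟩
    | cons t w ih =>
      obtain ⟨l, hl, h⟩ := ih
      refine ⟨l ++ [if t then (1, 0) else (0, 1)], ?_, ?_⟩
      · rw [chainLength] at hl ⊢
        cases t <;> simp [hl]
      · rw [chain_cons, h]
        cases e <;> cases t <;> simp [chainLetter, chainC1_append, chainC2_append]
  obtain ⟨l, hl, h'⟩ := key
  refine ⟨l, hl.trans_le h, ?_⟩
  cases e
  · exact Or.inr (by simpa using h')
  · exact Or.inl (by simpa using h')

theorem mul_conj_mul_chain_mem_Omega {h : ℕ} {β : MulAut F2} (hβ : IsTypeW1 β) {g : F2}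
    (hg : len g ≤ (2 ^ (4 * h + 4) + 1) * h) (e : Bool) {w : List Bool}
    (hw : w.length ≤ 4 * h + 4) : β * MulAut.conj g * chain e w ∈ Omega h :=
  ⟨_, _, _, hβ, conj_mem_deltaCompositionsUpTo hg, chain_mem_chainsUpTo e hw, rfl⟩

/-- An automorphism without nontrivial fixed elements. -/
theorem eq_one_of_invA_swapAut_sigma {u : F2} (h : (invA * swapAut * sigma) u = u) : u = 1 := by
  have h1 : orderThree ((invA * swapAut)⁻¹ u) = (invA * swapAut)⁻¹ u := by
    rw [MulAut.mul_apply] at h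
    rw [orderThree, MulAut.mul_apply, MulAut.apply_inv_self]
    conv_rhs => rw [← h]
    rw [MulAut.inv_apply_self]
  have h2 := rankThreeHom_orderThree ((invA * swapAut)⁻¹ u)
  rw [h1] at h2
  have h3 := rankThreeHom_injective ((eq_one_of_basisRotation_eq h2.symm).trans
    (_root_.map_one _).symm)
  simpa using h3

end Omega

/-! ### The bounded realisation of a fixed point group -/

section FirstPart

theorem norm_le_maxLength {k : ℕ} (u : Fin k → F2) (i : Fin k) : len (u i) ≤ maxLength u := by
  rw [len_eq_norm]
  exact Finset.le_sup (f := fun i => (u i).norm) (Finset.mem_univ i)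

/-- Modulo inner automorphisms `α τ α⁻¹` depends, up to replacing `τ` by `τ⁻¹`, only on the class of
`α(a)`. So `α` may be replaced by the short `α₀` with the same class, and `α₀ τ^{±1} α₀⁻¹` costs `n
+ 1 + n` letters. -/
theorem conj_tau_mem_chainForm {α : MulAut F2} {n : ℕ}
    (hn : (ex (α (of 0)) 0).natAbs + (ex (α (of 0)) 1).natAbs ≤ n) :
    α * tau * α⁻¹ ∈ chainForm (2 * n + 1) := by
  have hcop : IsCoprime (ex (α (of 0)) 0) (ex (α (of 0)) 1) := by
    have := Matrix.det_fin_two (abMat α)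
    rcases det_abMat α with h | h <;> rw [h] at this
    · exact ⟨abMat α 1 1, -abMat α 0 1, by rw [← abMat_apply, ← abMat_apply]; linarith⟩
    · exact ⟨-abMat α 1 1, abMat α 0 1, by rw [← abMat_apply, ← abMat_apply]; linarith⟩
  obtain ⟨α₀, hα₀, hex⟩ := exists_isShort_of_isCoprime hcop
  have hex' : ex (α₀ (of 0)) = ex (α (of 0)) := by
    rw [hex]; ext i; fin_cases i <;> rfl
  obtain ⟨κ, hκ⟩ : ∃ κ, κ = α₀⁻¹ * α := ⟨_, rfl⟩
  have hα : α = α₀ * κ := by rw [hκ, mul_inv_cancel_left]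
  have hcol : ex (κ (of 0)) = Pi.single 0 1 := by
    rw [hκ, MulAut.mul_apply, ex_map, ← hex', ← ex_map, MulAut.inv_apply_self, ex_of]
  have h00 : abMat κ 0 0 = 1 := by rw [abMat_apply, hcol]; simp
  have h10 : abMat κ 1 0 = 0 := by rw [abMat_apply, hcol]; simp
  obtain ⟨e, he, hee⟩ : ∃ e, abMat κ 1 1 = chainSign e ∧ chainSign e * chainSign e = 1 := by
    have := Matrix.det_fin_two (abMat κ)
    rw [h00, h10] at this
    rcases det_abMat κ with h | h <;> rw [h] at this
    · exact ⟨true, by simp [chainSign]; linarith, rfl⟩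
    · exact ⟨false, by simp [chainSign]; linarith, rfl⟩
  have hcomm : abMat κ * abMat tau = abMat (chainLetter e false) * abMat κ := by
    rw [abMat_tau, abMat_chainLetter]
    ext i j
    fin_cases i <;> fin_cases j <;>
      simp [Matrix.mul_apply, Fin.sum_univ_two, h00, h10, he, hee, add_comm]
  obtain ⟨g, hg⟩ := exists_conj_mul_of_abMat_eq (φ := κ * tau * κ⁻¹) (ψ := chainLetter e false) (by
    rw [abMat_mul, abMat_mul, hcomm, mul_assoc, abMat_mul_inv, mul_one])
  have key : α * tau * α⁻¹ =
      MulAut.conj (α₀ g) * (α₀ * (chainLetter e false * α₀⁻¹)) := by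
    calc α * tau * α⁻¹ = α₀ * (κ * tau * κ⁻¹) * α₀⁻¹ := by rw [hα]; group
      _ = α₀ * MulAut.conj g * chainLetter e false * α₀⁻¹ := by rw [hg]; group
      _ = _ := by rw [mul_conj_eq]; simp only [mul_assoc]
  rw [key]
  have h1 : α₀⁻¹ ∈ chainForm n := chainForm_mono hn hα₀.inv.mem_chainForm
  have h2 := chainLetter_mul_mem_chainForm e false h1
  have h3 := (hα₀ _ _ h2).1
  exact conj_mul_mem_chainForm _ (chainForm_mono (by omega) h3)

theorem exists_mem_Omega {k : ℕ} (u : Fin k → F2) (H : Subgroup F2)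
    (hH : H = Subgroup.closure (Set.range u)) {φ : MulAut F2} (hφ : IsFixedPointGroup H φ) :
    ∃ ψ ∈ Omega (maxLength u), IsFixedPointGroup H ψ := by
  have hu : ∀ i, u i ∈ H := fun i => hH ▸ Subgroup.subset_closure ⟨i, rfl⟩
  have htriv : ∀ {w : List Bool} (e : Bool) {β : MulAut F2}, IsTypeW1 β →
      w.length ≤ 4 * maxLength u + 4 → β * chain e w ∈ Omega (maxLength u) := by
    intro w e β hβ hw
    simpa using mul_conj_mul_chain_mem_Omega hβ (g := 1) (h := maxLength u) (by simp) e hw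
  by_cases h1 : ∀ i, u i = 1
  · have hbot : H = ⊥ := by
      rw [hH, Subgroup.closure_eq_bot_iff]
      rintro _ ⟨i, rfl⟩
      exact h1 i
    refine ⟨invA * swapAut * sigma, ?_, fun g => ?_⟩
    · simpa [chainLetter] using htriv (w := [true]) true (isTypeW1_invA.mul isTypeW1_swapAut)
        (by simp)
    · rw [hbot, Subgroup.mem_bot]
      exact ⟨fun h => by rw [h, _root_.map_one], eq_one_of_invA_swapAut_sigma⟩
  push Not at h1
  obtain ⟨i₀, hi₀⟩ := h1
  have hcomm : CommFix φ → ∃ ψ ∈ Omega (maxLength u), IsFixedPointGroup H ψ := by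
    intro hc
    -- When the fixed elements commute, the fixed subgroup is the centraliser of the nontrivial
    -- generator `u i₀`: whatever commutes with a nontrivial fixed element is fixed.
    refine ⟨MulAut.conj (u i₀), ?_, fun g => ?_⟩
    · have hlen := norm_le_maxLength u i₀
      simpa using mul_conj_mul_chain_mem_Omega IsTypeW1.one (g := u i₀) (h := maxLength u)
        (hlen.trans (Nat.le_mul_of_pos_left _ (by positivity))) true (w := []) (by simp)
    · have hfix : φ (u i₀) = u i₀ := (hφ _).1 (hu i₀)
      rw [hφ, MulAut.conj_apply, mul_inv_eq_iff_eq_mul]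
      exact ⟨fun h => hc _ _ hfix h, fun h => map_eq_of_commute hi₀ hfix h.symm⟩
  by_cases hab : ∀ i j, u i * u j = u j * u i
  · refine hcomm fun x y hx hy => ?_
    have := Subgroup.isMulCommutative_closure (k := Set.range u) (by
      rintro _ ⟨i, rfl⟩ _ ⟨j, rfl⟩; exact hab i j)
    have hx' : x ∈ Subgroup.closure (Set.range u) := hH ▸ (hφ x).2 hx
    have hy' : y ∈ Subgroup.closure (Set.range u) := hH ▸ (hφ y).2 hy
    exact congrArg Subtype.val (mul_comm' (⟨x, hx'⟩ : Subgroup.closure (Set.range u)) ⟨y, hy'⟩)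
  push Not at hab
  obtain ⟨i, j, hij⟩ := hab
  rcases fixClassified φ with hc | rfl | ⟨α, hα⟩
  · exact hcomm hc
  · exact ⟨1, by simpa using htriv (w := []) true IsTypeW1.one (by simp), hφ⟩
  have hψ : IsFixedPointGroup H (α * tau * α⁻¹) := fun g => (hφ g).trans (hα g)
  refine ⟨_, ?_, hψ⟩
  obtain ⟨h, hh⟩ : ∃ h, h = maxLength u := ⟨_, rfl⟩
  have hpos : 0 < h := by
    rw [hh]
    refine lt_of_lt_of_le (Nat.pos_of_ne_zero fun h0 => hi₀ (len_eq_zero.1 h0))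
      (norm_le_maxLength u i₀)
  -- some generator has nonzero exponent sums
  have hex : ∀ g ∈ H, ∃ m : ℤ, ex g = m • ex (α (of 0)) := by
    intro g hg
    have h2 := (hψ g).1 hg
    have h3 : (tau ^ (1 : ℤ)) (α⁻¹ g) = α⁻¹ g := by
      rw [zpow_one]
      rw [MulAut.mul_apply, MulAut.mul_apply] at h2
      conv_rhs => rw [← h2]
      rw [MulAut.inv_apply_self]
    rw [tau_zpow_fixed_iff one_ne_zero] at h3
    have h4 : ∃ m : ℤ, ex (α⁻¹ g) = m • Pi.single 0 1 := by
      generalize α⁻¹ g = y at h3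
      induction h3 using Subgroup.closure_induction with
      | mem x hx => rcases hx with rfl | rfl <;> exact ⟨1, by simp⟩
      | one => exact ⟨0, by simp⟩
      | mul x y _ _ hx hy =>
        obtain ⟨m, hm⟩ := hx
        obtain ⟨n, hn⟩ := hy
        exact ⟨m + n, by rw [ex_mul, hm, hn, add_smul]⟩
      | inv x _ hx =>
        obtain ⟨m, hm⟩ := hx
        exact ⟨-m, by rw [ex_inv, hm, neg_smul]⟩
    obtain ⟨m, hm⟩ := h4
    refine ⟨m, ?_⟩
    have h5 : g = α (α⁻¹ g) := by rw [MulAut.apply_inv_self]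
    rw [h5, ex_map, hm, Matrix.mulVec_smul, ← ex_of, ← ex_map]
  have hbound : (ex (α (of 0)) 0).natAbs + (ex (α (of 0)) 1).natAbs ≤ h := by
    by_contra hlt
    have hzero : ∀ i, ex (u i) = 0 := by
      intro i
      obtain ⟨m, hm⟩ := hex _ (hu i)
      have h2 := abs_ex_le_len (u i)
      have h3 := norm_le_maxLength u i
      rw [hm] at h2
      simp only [Pi.smul_apply, smul_eq_mul, abs_mul] at h2
      rcases eq_or_ne m 0 with rfl | hm0
      · rw [hm, zero_smul]
      · exfalso
        have h4 : 1 ≤ |m| := Int.one_le_abs hm0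
        have h5 : (h : ℤ) < |ex (α (of 0)) 0| + |ex (α (of 0)) 1| := by
          rw [Int.abs_eq_natAbs, Int.abs_eq_natAbs]; omega
        have h6 : (len (u i) : ℤ) ≤ h := by rw [hh]; exact_mod_cast h3
        nlinarith [abs_nonneg (ex (α (of 0)) 0), abs_nonneg (ex (α (of 0)) 1)]
    have hall : ∀ g ∈ H, ex g = 0 := by
      intro g hg
      rw [hH] at hg
      induction hg using Subgroup.closure_induction with
      | mem x hx => obtain ⟨i, rfl⟩ := hx; exact hzero i
      | one => exact ex_one
      | mul x y _ _ hx hy => rw [ex_mul, hx, hy, add_zero]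
      | inv x _ hx => rw [ex_inv, hx, neg_zero]
    have ha := hall (α (of 0)) ((hψ _).2 (by simp))
    rw [ha] at hlt
    simp at hlt
  obtain ⟨β, g, e, w, hβ, hw, hψ'⟩ := conj_tau_mem_chainForm hbound
  rw [hψ'] at hψ ⊢
  rw [← hh]
  refine mul_conj_mul_chain_mem_Omega hβ ?_ e (by omega)
  -- Since `β c_g P` fixes each generator `u`, both `P(u)` and its conjugate by `g` have length at
  -- most `D`, the conjugate being `β⁻¹(u)`. For `g` of length at least `4 * D + 4` the elements
  -- `P(u i)` and `P(u j)` would commute, hence so would `u i` and `u j`.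
  by_contra hlong
  obtain ⟨D, hD⟩ : ∃ D, D = 2 ^ (2 * h + 1) * h := ⟨_, rfl⟩
  have hlen : ∀ i, len (chain e w (u i)) ≤ D := by
    intro i
    refine (len_chain_le e w (u i)).trans ?_
    rw [hD]
    exact Nat.mul_le_mul (Nat.pow_le_pow_right (by norm_num) hw) (hh ▸ norm_le_maxLength u i)
  have hlen' : ∀ i, len (g⁻¹⁻¹ * chain e w (u i) * g⁻¹) ≤ D := by
    intro i
    have h2 := (hψ _).1 (hu i)
    rw [MulAut.mul_apply, MulAut.mul_apply, MulAut.conj_apply] at h2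
    rw [inv_inv, ← hβ.len_apply, h2]
    refine (hh ▸ norm_le_maxLength u i).trans ?_
    rw [hD]
    exact Nat.le_mul_of_pos_left _ (by positivity)
  have := commute_of_long_segment (fun _ => true) (hlen i) (hlen' i) (hlen j) (hlen' j) (by
    rw [wt_inv]
    change _ ≤ len g
    have e1 : 2 ^ (4 * h + 4) = 2 ^ (2 * h + 1) * 2 ^ (2 * h + 3) := by
      rw [← pow_add]; congr 1; omega
    have e2 : 8 ≤ 2 ^ (2 * h + 3) := by
      calc 8 = 2 ^ 3 := rfl
        _ ≤ 2 ^ (2 * h + 3) := Nat.pow_le_pow_right (by norm_num) (by omega)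
    have e3 : 1 ≤ 2 ^ (2 * h + 1) := Nat.one_le_two_pow
    rw [e1] at hlong
    rw [hD]
    nlinarith [Nat.mul_le_mul (Nat.mul_le_mul e2 e3) hpos,
      Nat.mul_le_mul_right h (Nat.mul_le_mul_left (2 ^ (2 * h + 1)) e2)])
  rw [← _root_.map_mul, ← _root_.map_mul] at this
  exact hij ((chain e w).injective this)

end FirstPart


/-! ### Permutations of `ℕ` coded by lists of transpositions -/

section SwapLists

/-- The transposition of two natural numbers, applied to a third one. -/
def swapApply (p : ℕ × ℕ) (n : ℕ) : ℕ := if n = p.1 then p.2 else if n = p.2 then p.1 else n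

theorem swapApply_eq (p : ℕ × ℕ) (n : ℕ) : swapApply p n = Equiv.swap p.1 p.2 n := by
  rw [swapApply, Equiv.swap_apply_def]

/-- The product of a list of transpositions. -/
def swapProd {α : Type*} [DecidableEq α] (l : List (α × α)) : Equiv.Perm α :=
  (l.map fun p => Equiv.swap p.1 p.2).prod

theorem swapProd_cons {α : Type*} [DecidableEq α] (p : α × α) (l : List (α × α)) :
    swapProd (p :: l) = Equiv.swap p.1 p.2 * swapProd l := by simp [swapProd]

theorem swapProd_apply (l : List (ℕ × ℕ)) (n : ℕ) : swapProd l n = l.foldr swapApply n := by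
  induction l with
  | nil => rfl
  | cons p l ih => rw [swapProd_cons, Equiv.Perm.mul_apply, ih, List.foldr_cons, swapApply_eq]

theorem swapProd_reverse {α : Type*} [DecidableEq α] (l : List (α × α)) :
    swapProd l.reverse = (swapProd l)⁻¹ := by
  rw [swapProd, swapProd, List.prod_inv_reverse, List.map_reverse, List.map_map]
  congr 2

theorem swapProd_map {α : Type*} [DecidableEq α] {e : α → ℕ} (he : Function.Injective e)
    (l : List (α × α)) (x : α) : swapProd (l.map (Prod.map e e)) (e x) = e (swapProd l x) := by
  induction l with
  | nil => rfl
  | cons p l ih =>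
    rw [List.map_cons, swapProd_cons, swapProd_cons, Equiv.Perm.mul_apply, Equiv.Perm.mul_apply, ih]
    exact he.swap_apply _ _ _

/-- Each transposition can be chosen to shrink the support, so the number of points bounds the
length of the list. -/
theorem exists_swapProd_eq {α : Type*} [DecidableEq α] [Fintype α] (f : Equiv.Perm α) :
    ∃ l : List (α × α), l.length ≤ Fintype.card α ∧ swapProd l = f := by
  suffices h : ∃ l : List (α × α), l.length ≤ f.support.card ∧ swapProd l = f by
    obtain ⟨l, hl, hf⟩ := h
    exact ⟨l, hl.trans (Finset.card_le_univ _), hf⟩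
  induction hn : f.support.card using Nat.strong_induction_on generalizing f with
  | _ n ih =>
    subst hn
    by_cases hf : f = 1
    · exact ⟨[], by simp, by rw [hf]; rfl⟩
    · obtain ⟨x, hx⟩ : ∃ x, f x ≠ x := by
        by_contra hc
        push Not at hc
        exact hf (Equiv.ext hc)
      have hlt := Equiv.Perm.card_support_swap_mul hx
      obtain ⟨l, hl, h⟩ := ih _ hlt _ rfl
      refine ⟨(x, f x) :: l, ?_, ?_⟩
      · rw [List.length_cons]; omega
      · rw [swapProd_cons, h, ← mul_assoc, Equiv.swap_mul_self, one_mul]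

/-- The action of a letter, when the basis elements act by given products of transpositions. -/
def letterAct (s : List (ℕ × ℕ) × List (ℕ × ℕ)) (x : Letter) (n : ℕ) : ℕ :=
  if x.2 = true then (if x.1 = 0 then s.1 else s.2).foldr swapApply n
  else (if x.1 = 0 then s.1 else s.2).reverse.foldr swapApply n

/-- The action of a word. -/
def wordAct (s : List (ℕ × ℕ) × List (ℕ × ℕ)) (w : List Letter) (n : ℕ) : ℕ :=
  w.foldr (letterAct s) n

/-- The permutation representation given by two lists of transpositions. -/
def permRep (s : List (ℕ × ℕ) × List (ℕ × ℕ)) : F2 →* Equiv.Perm ℕ :=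
  FreeGroup.lift ![swapProd s.1, swapProd s.2]

theorem permRep_elt (s : List (ℕ × ℕ) × List (ℕ × ℕ)) (x : Letter) (n : ℕ) :
    permRep s x.elt n = letterAct s x n := by
  obtain ⟨i, e⟩ := x
  simp only [letterAct, ← swapProd_apply, swapProd_reverse]
  fin_cases i <;> cases e <;> simp [permRep, elt_true, elt_false]

theorem mk_cons_eq (x : Letter) (w : List Letter) : (mk (x :: w) : F2) = x.elt * mk w := by
  rw [Letter.elt, mul_mk]; rfl

theorem permRep_mk (s : List (ℕ × ℕ) × List (ℕ × ℕ)) (w : List Letter) (n : ℕ) :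
    permRep s (mk w) n = wordAct s w n := by
  induction w with
  | nil => simp [← one_eq_mk, wordAct]
  | cons x w ih =>
    rw [mk_cons_eq, _root_.map_mul, Equiv.Perm.mul_apply, ih, permRep_elt]
    rfl

end SwapLists

/-! ### Finite enumerations -/

section BoundedLists

/-- The lists of length at most `k` with entries in `A`. -/
def listsUpTo {α : Type*} (A : List α) : ℕ → List (List α)
  | 0 => [[]]
  | k + 1 => [] :: A.flatMap fun a => (listsUpTo A k).map (a :: ·)

theorem mem_listsUpTo {α : Type*} {A : List α} {k : ℕ} {l : List α} :
    l ∈ listsUpTo A k ↔ l.length ≤ k ∧ ∀ x ∈ l, x ∈ A := by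
  induction k generalizing l with
  | zero =>
    rw [listsUpTo, List.mem_singleton, Nat.le_zero, List.length_eq_zero_iff]
    exact ⟨fun h => ⟨h, by simp [h]⟩, fun h => h.1⟩
  | succ k ih =>
    cases l with
    | nil => simp [listsUpTo]
    | cons x l =>
      simp only [listsUpTo, List.mem_cons, reduceCtorEq, List.mem_flatMap, List.mem_map,
        List.cons.injEq, false_or, List.length_cons, Nat.add_le_add_iff_right, forall_eq_or_imp]
      constructor
      · rintro ⟨a, ha, l', hl', rfl, rfl⟩
        exact ⟨(ih.1 hl').1, ha, (ih.1 hl').2⟩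
      · rintro ⟨h1, h2, h3⟩
        exact ⟨x, h2, l, ih.2 ⟨h1, h3⟩, rfl, rfl⟩

/-- The pairs of natural numbers below `n`. -/
def pairsBelow (n : ℕ) : List (ℕ × ℕ) :=
  (List.range n).flatMap fun i => (List.range n).map fun j => (i, j)

theorem mem_pairsBelow {n : ℕ} {p : ℕ × ℕ} : p ∈ pairsBelow n ↔ p.1 < n ∧ p.2 < n := by
  obtain ⟨i, j⟩ := p
  simp [pairsBelow]

/-- All letters. -/
def allLetters : List Letter := [(0, true), (0, false), (1, true), (1, false)]

theorem mem_allLetters (x : Letter) : x ∈ allLetters := by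
  obtain ⟨i, e⟩ := x
  fin_cases i <;> cases e <;> simp [allLetters]

theorem mem_listsUpTo_allLetters {k : ℕ} {w : List Letter} :
    w ∈ listsUpTo allLetters k ↔ w.length ≤ k := by
  rw [mem_listsUpTo]
  exact ⟨fun h => h.1, fun h => ⟨h, fun x _ => mem_allLetters x⟩⟩

end BoundedLists

/-! ### Membership in finitely generated subgroups by separability -/

section Membership

theorem mk_mem_subgroupOfWords {L : List (List Letter)} {u : List Letter} (hu : u ∈ L) :
    mk u ∈ subgroupOfWords L := Subgroup.subset_closure ⟨u, hu, rfl⟩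

/-- A bound for the size of the permutations that detect membership. -/
def sepBound (c : List Letter) (L : List (List Letter)) : ℕ :=
  (c :: L).flatten.length + (c :: L).length

/-- Every permutation representation with a point fixed by the words in `L` fixes it under `c`. -/
def Unseparated (c : List Letter) (L : List (List Letter)) : Prop :=
  ∀ sa ∈ listsUpTo (pairsBelow (sepBound c L)) (sepBound c L),
    ∀ sb ∈ listsUpTo (pairsBelow (sepBound c L)) (sepBound c L),
    ∀ p ∈ List.range (sepBound c L),
      (∀ u ∈ L, wordAct (sa, sb) u p = p) → wordAct (sa, sb) c p = p

theorem length_flatMap_tails {α : Type*} (L : List (List α)) :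
    (L.flatMap List.tails).length = L.flatten.length + L.length := by
  induction L with
  | nil => rfl
  | cons u L ih =>
    rw [List.flatMap_cons, List.length_append, ih, List.length_tails, List.flatten_cons,
      List.length_append, List.length_cons]
    omega

/-- The part of the action of `g` that stays inside `Q` is a partial injection of a finite set, so
it extends to a permutation. -/
theorem exists_perm_extension {G X : Type*} [Group G] [MulAction G X] [DecidableEq X]
    (Q : Finset X) (g : G) : ∃ f : Equiv.Perm Q, (∀ x : Q, g • (x : X) ∈ Q →
      (f x : X) = g • (x : X)) ∧ ∀ x : Q, g⁻¹ • (x : X) ∈ Q → (f⁻¹ x : X) = g⁻¹ • (x : X) := by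
  obtain ⟨f, hf⟩ := Finset.exists_equiv_extend_of_card_eq (α := Q) (t := Q) (by simp)
    (s := Finset.univ.filter fun x : Q => g • (x : X) ∈ Q) (f := fun x => g • (x : X))
    (by
      intro y hy
      obtain ⟨x, hx, rfl⟩ := Finset.mem_image.1 hy
      exact (Finset.mem_filter.1 hx).2)
    (fun x _ y _ h => Subtype.ext (MulAction.injective g h))
  have h1 : ∀ x : Q, g • (x : X) ∈ Q → (f x : X) = g • (x : X) := fun x hx =>
    hf x (Finset.mem_filter.2 ⟨Finset.mem_univ _, hx⟩)
  refine ⟨f, h1, fun x hx => ?_⟩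
  have h2 : f ⟨g⁻¹ • (x : X), hx⟩ = x := by
    apply Subtype.ext
    rw [h1 _ (by simp)]
    simp
  have h3 : (f⁻¹ : Equiv.Perm Q) x = ⟨g⁻¹ • (x : X), hx⟩ := by
    rw [Equiv.Perm.inv_eq_iff_eq]
    exact h2.symm
  rw [h3]

/-- Finitely generated subgroups of `F_2` are separable, with an explicit bound. -/
theorem mk_mem_subgroupOfWords_iff (c : List Letter) (L : List (List Letter)) :
    mk c ∈ subgroupOfWords L ↔ Unseparated c L := by
  classical
  constructor
  · intro h sa _ sb _ p _ hu
    rw [← permRep_mk]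
    refine Subgroup.closure_induction (p := fun g _ => permRep (sa, sb) g p = p) ?_ ?_ ?_ ?_ h
    · rintro _ ⟨u, hmem, rfl⟩
      rw [permRep_mk, hu u hmem]
    · simp
    · intro x y _ _ hx hy
      rw [_root_.map_mul, Equiv.Perm.mul_apply, hy, hx]
    · intro x _ hx
      rw [_root_.map_inv, Equiv.Perm.inv_eq_iff_eq, hx]
  · intro h
    -- A word acts on the left cosets letter by letter from its right end, so starting from the
    -- trivial coset it visits the cosets of its suffixes. `Q` collects these for `c` and all words
    -- of `L`; `sepBound` counts the suffixes.
    let q : List Letter → F2 ⧸ subgroupOfWords L := fun w => ((mk w : F2) : F2 ⧸ subgroupOfWords L)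
    let Q : Finset (F2 ⧸ subgroupOfWords L) := (((c :: L).flatMap List.tails).map q).toFinset
    have hQ : ∀ u ∈ c :: L, ∀ w, w <:+ u → q w ∈ Q := by
      intro u hu w hw
      rw [List.mem_toFinset]
      exact List.mem_map_of_mem (List.mem_flatMap.2 ⟨u, hu, (List.mem_tails w u).2 hw⟩)
    have hcard : Fintype.card Q ≤ sepBound c L := by
      rw [Fintype.card_coe]
      refine (List.toFinset_card_le _).trans ?_
      rw [List.length_map, length_flatMap_tails]
      exact le_rfl
    obtain ⟨e⟩ : Nonempty (Q ≃ Fin (Fintype.card Q)) := ⟨Fintype.equivFin Q⟩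
    let ε : Q → ℕ := fun x => e x
    have hε : Function.Injective ε := Fin.val_injective.comp e.injective
    have hεlt : ∀ x, ε x < sepBound c L := fun x => (e x).2.trans_le hcard
    -- The partial action of each basis element on `Q` is completed to a permutation, with the
    -- points of `Q` numbered below `sepBound`.
    have hex : ∀ g : F2, ∃ s ∈ listsUpTo (pairsBelow (sepBound c L)) (sepBound c L),
        (∀ x y : Q, g • (x : F2 ⧸ subgroupOfWords L) = y → swapProd s (ε x) = ε y) ∧
        ∀ x y : Q, g⁻¹ • (x : F2 ⧸ subgroupOfWords L) = y →
          (swapProd s)⁻¹ (ε x) = ε y := by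
      intro g
      obtain ⟨f, hf, hf'⟩ := exists_perm_extension Q g
      obtain ⟨l, hl, hlf⟩ := exists_swapProd_eq f
      refine ⟨l.map (Prod.map ε ε), ?_, ?_, ?_⟩
      · rw [mem_listsUpTo]
        refine ⟨by rw [List.length_map]; exact hl.trans hcard, fun p hp => ?_⟩
        obtain ⟨p', -, rfl⟩ := List.mem_map.1 hp
        exact mem_pairsBelow.2 ⟨hεlt _, hεlt _⟩
      · intro x y hxy
        rw [swapProd_map hε, hlf]
        congr 1
        apply Subtype.ext
        rw [hf x (by rw [hxy]; exact y.2), hxy]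
      · intro x y hxy
        rw [← swapProd_reverse, ← List.map_reverse, swapProd_map hε, swapProd_reverse, hlf]
        congr 1
        apply Subtype.ext
        rw [hf' x (by rw [hxy]; exact y.2), hxy]
    obtain ⟨sa, hsa, ha, ha'⟩ := hex (of 0)
    obtain ⟨sb, hsb, hb, hb'⟩ := hex (of 1)
    have hnil : q [] ∈ Q := hQ c (by simp) [] (List.nil_suffix)
    have hact : ∀ u (hu : u ∈ c :: L) w (hw : w <:+ u),
        wordAct (sa, sb) w (ε ⟨q [], hnil⟩) = ε ⟨q w, hQ u hu w hw⟩ := by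
      intro u hu w
      induction w with
      | nil => intro hw; rfl
      | cons x w ih =>
        intro hw
        have hw' : w <:+ u := (List.suffix_cons x w).trans hw
        have h1 : wordAct (sa, sb) (x :: w) (ε ⟨q [], hnil⟩) =
            letterAct (sa, sb) x (ε ⟨q w, hQ u hu w hw'⟩) := by
          rw [← ih hw']; rfl
        have h2 : x.elt • q w = q (x :: w) := by
          change ((x.elt * mk w : F2) : F2 ⧸ subgroupOfWords L) = ((mk (x :: w) : F2) : _)
          rw [mk_cons_eq]
        rw [h1, ← permRep_elt]
        obtain ⟨i, b⟩ := x
        fin_cases i <;> cases b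
        · simp only [Fin.zero_eta, elt_false] at h2 ⊢
          rw [_root_.map_inv]
          simpa [permRep] using ha' ⟨q w, hQ u hu w hw'⟩ ⟨_, hQ u hu _ hw⟩ h2
        · simp only [Fin.zero_eta, elt_true] at h2 ⊢
          simpa [permRep] using ha ⟨q w, hQ u hu w hw'⟩ ⟨_, hQ u hu _ hw⟩ h2
        · simp only [Fin.mk_one, elt_false] at h2 ⊢
          rw [_root_.map_inv]
          simpa [permRep] using hb' ⟨q w, hQ u hu w hw'⟩ ⟨_, hQ u hu _ hw⟩ h2
        · simp only [Fin.mk_one, elt_true] at h2 ⊢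
          simpa [permRep] using hb ⟨q w, hQ u hu w hw'⟩ ⟨_, hQ u hu _ hw⟩ h2
    -- For these words the modified action agrees with the coset action along the whole path, so
    -- returning to the base point means membership.
    have key : ∀ u ∈ c :: L, (wordAct (sa, sb) u (ε ⟨q [], hnil⟩) = ε ⟨q [], hnil⟩ ↔
        mk u ∈ subgroupOfWords L) := by
      intro u hu
      rw [hact u hu u (List.suffix_refl u), hε.eq_iff, Subtype.mk.injEq, eq_comm]
      change ((mk [] : F2) : F2 ⧸ subgroupOfWords L) = ((mk u : F2) : F2 ⧸ subgroupOfWords L) ↔ _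
      rw [QuotientGroup.eq, ← one_eq_mk, inv_one, one_mul]
    rw [← key c (by simp)]
    exact h sa hsa sb hsb _ (List.mem_range.2 (hεlt _)) fun u hu =>
      (key u (by simp [hu])).2 (mk_mem_subgroupOfWords hu)

end Membership


/-! ### Primitive recursiveness of membership and of the word problem -/

section PrimitiveRecursion

variable {α β γ : Type*} [Primcodable α] [Primcodable β] [Primcodable γ]

theorem PrimrecPred.exists_mem {f : α → List β} {R : α → β → Prop} (hf : Primrec f)
    (hR : PrimrecPred fun p : α × β => R p.1 p.2) : PrimrecPred fun x => ∃ b ∈ f x, R x b := by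
  have h : PrimrecRel fun (b : β) (x : α) => R x b := hR.comp (Primrec.pair .snd .fst)
  exact (PrimrecRel.exists_mem_list h).comp hf .id

theorem PrimrecPred.forall_mem {f : α → List β} {R : α → β → Prop} (hf : Primrec f)
    (hR : PrimrecPred fun p : α × β => R p.1 p.2) : PrimrecPred fun x => ∀ b ∈ f x, R x b := by
  have h : PrimrecRel fun (b : β) (x : α) => R x b := hR.comp (Primrec.pair .snd .fst)
  exact (PrimrecRel.forall_mem_list h).comp hf .id

theorem PrimrecPred.imp {p q : α → Prop} (hp : PrimrecPred p) (hq : PrimrecPred q) :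
    PrimrecPred fun x => p x → q x :=
  (hp.not.or hq).of_eq fun x => by tauto

/-- Unbounded search. -/
theorem REPred.exists_of_primrec {R : α → β → Prop}
    (hR : PrimrecPred fun p : α × β => R p.1 p.2) : REPred fun x => ∃ b, R x b := by
  classical
  have h1 : PrimrecPred fun p : α × ℕ => ∃ b ∈ (Encodable.decode (α := β) p.2).toList, R p.1 b := by
    refine PrimrecPred.exists_mem (R := fun (p : α × ℕ) b => R p.1 b) ?_ ?_
    · exact Primrec.optionToList.comp (Primrec.decode.comp .snd)
    · exact hR.comp (Primrec.pair (Primrec.fst.comp .fst) .snd)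
  have h2 : Partrec fun x : α => Nat.rfind fun n => Part.some
      (decide (∃ b ∈ (Encodable.decode (α := β) n).toList, R x b)) :=
    Partrec.rfind h1.computablePred.decide.partrec
  refine h2.dom_re.of_eq fun x => Nat.rfind_dom.trans ?_
  constructor
  · rintro ⟨n, hn, -⟩
    simp only [Part.mem_some_iff, true_eq_decide_iff] at hn
    obtain ⟨b, -, hb⟩ := hn
    exact ⟨b, hb⟩
  · rintro ⟨b, hb⟩
    refine ⟨Encodable.encode b, ?_, fun _ => trivial⟩
    simp only [Part.mem_some_iff, true_eq_decide_iff]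
    exact ⟨b, by simp, hb⟩

theorem primrec_swapApply : Primrec₂ swapApply := by
  have h1 : Primrec fun p : (ℕ × ℕ) × ℕ => p.1.1 := Primrec.fst.comp .fst
  have h2 : Primrec fun p : (ℕ × ℕ) × ℕ => p.1.2 := Primrec.snd.comp .fst
  exact Primrec.ite (Primrec.eq.comp .snd h1) h2
    (Primrec.ite (Primrec.eq.comp .snd h2) h1 .snd)

theorem primrec_letterAct : Primrec fun p : (List (ℕ × ℕ) × List (ℕ × ℕ)) × Letter × ℕ =>
    letterAct p.1 p.2.1 p.2.2 := by
  have hl : Primrec fun p : (List (ℕ × ℕ) × List (ℕ × ℕ)) × Letter × ℕ =>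
      if p.2.1.1 = 0 then p.1.1 else p.1.2 :=
    Primrec.ite (Primrec.eq.comp (Primrec.fst.comp (Primrec.fst.comp .snd)) (.const 0))
      (Primrec.fst.comp .fst) (Primrec.snd.comp .fst)
  have hn : Primrec fun p : (List (ℕ × ℕ) × List (ℕ × ℕ)) × Letter × ℕ => p.2.2 :=
    Primrec.snd.comp .snd
  have hs : Primrec₂ fun (_ : (List (ℕ × ℕ) × List (ℕ × ℕ)) × Letter × ℕ)
      (b : (ℕ × ℕ) × ℕ) => swapApply b.1 b.2 := primrec_swapApply.comp
    (Primrec.fst.comp .snd) (Primrec.snd.comp .snd)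
  exact Primrec.ite (Primrec.eq.comp (Primrec.snd.comp (Primrec.fst.comp .snd)) (.const true))
    (Primrec.list_foldr hl hn hs) (Primrec.list_foldr (Primrec.list_reverse.comp hl) hn hs)

theorem primrec_wordAct : Primrec fun p : (List (ℕ × ℕ) × List (ℕ × ℕ)) × List Letter × ℕ =>
    wordAct p.1 p.2.1 p.2.2 := by
  refine Primrec.list_foldr (h := fun p (b : Letter × ℕ) => letterAct p.1 b.1 b.2)
    (Primrec.fst.comp .snd) (Primrec.snd.comp .snd) ?_
  exact primrec_letterAct.comp (Primrec.pair (Primrec.fst.comp .fst) .snd)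

theorem primrec_listsUpTo : Primrec₂ (listsUpTo : List α → ℕ → List (List α)) := by
  have h : Primrec₂ fun (A : List α) (p : ℕ × List (List α)) =>
      [] :: A.flatMap fun a => p.2.map (a :: ·) := by
    refine Primrec.list_cons.comp (.const []) (Primrec.list_flatMap .fst ?_)
    refine Primrec.list_map (Primrec.snd.comp (Primrec.snd.comp .fst)) ?_
    exact Primrec.list_cons.comp (Primrec.snd.comp .fst) .snd
  refine (Primrec.nat_rec (.const [[]]) h).of_eq fun A k => ?_
  induction k with
  | zero => rfl
  | succ k ih => rw [listsUpTo, ← ih]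

theorem primrec_pairsBelow : Primrec pairsBelow := by
  refine Primrec.list_flatMap Primrec.list_range ?_
  refine Primrec.list_map (Primrec.list_range.comp .fst) ?_
  exact Primrec.pair (Primrec.snd.comp .fst) .snd

theorem primrec_sepBound : Primrec₂ sepBound := by
  have h : Primrec₂ fun (c : List Letter) (L : List (List Letter)) => c :: L := Primrec.list_cons
  exact Primrec.nat_add.comp (Primrec.list_length.comp (Primrec.list_flatten.comp h))
    (Primrec.list_length.comp h)

/-- The given permutation representation with base point does not separate a word from a list. -/
def UnseparatedBy (t : (List (ℕ × ℕ) × List (ℕ × ℕ)) × ℕ)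
    (q : List Letter × List (List Letter)) : Prop :=
  (∀ u ∈ q.2, wordAct t.1 u t.2 = t.2) → wordAct t.1 q.1 t.2 = t.2

theorem primrecRel_unseparatedBy : PrimrecRel UnseparatedBy := by
  have h : PrimrecRel fun (t : (List (ℕ × ℕ) × List (ℕ × ℕ)) × ℕ) (u : List Letter) =>
      wordAct t.1 u t.2 = t.2 :=
    Primrec.eq.comp (primrec_wordAct.comp (Primrec.pair (Primrec.fst.comp .fst)
      (Primrec.pair .snd (Primrec.snd.comp .fst)))) (Primrec.snd.comp .fst)
  refine PrimrecPred.imp (PrimrecPred.forall_mem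
    (f := fun x : ((List (ℕ × ℕ) × List (ℕ × ℕ)) × ℕ) × List Letter × List (List Letter) => x.2.2)
    (R := fun x u => wordAct x.1.1 u x.1.2 = x.1.2) (Primrec.snd.comp .snd) ?_) ?_
  · exact h.comp (Primrec.fst.comp .fst) .snd
  · exact h.comp .fst (Primrec.fst.comp .snd)

/-- The permutation representations that suffice to separate a word from a list of words. -/
def sepReps (q : List Letter × List (List Letter)) :
    List ((List (ℕ × ℕ) × List (ℕ × ℕ)) × ℕ) :=
  (listsUpTo (pairsBelow (sepBound q.1 q.2)) (sepBound q.1 q.2)).flatMap fun sa =>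
    (listsUpTo (pairsBelow (sepBound q.1 q.2)) (sepBound q.1 q.2)).flatMap fun sb =>
      (List.range (sepBound q.1 q.2)).map fun p => ((sa, sb), p)

theorem primrec_sepReps : Primrec sepReps := by
  have hb : Primrec fun q : List Letter × List (List Letter) => sepBound q.1 q.2 :=
    primrec_sepBound
  have hl : Primrec fun q : List Letter × List (List Letter) =>
      listsUpTo (pairsBelow (sepBound q.1 q.2)) (sepBound q.1 q.2) :=
    primrec_listsUpTo.comp (primrec_pairsBelow.comp hb) hb
  refine Primrec.list_flatMap hl (Primrec.list_flatMap (hl.comp .fst) ?_)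
  refine Primrec.list_map (Primrec.list_range.comp (hb.comp (Primrec.fst.comp .fst))) ?_
  exact Primrec.pair (Primrec.pair (Primrec.snd.comp (Primrec.fst.comp .fst))
    (Primrec.snd.comp .fst)) .snd

theorem unseparated_iff (c : List Letter) (L : List (List Letter)) :
    Unseparated c L ↔ ∀ t ∈ sepReps (c, L), UnseparatedBy t (c, L) := by
  constructor
  · intro h t ht
    simp only [sepReps, List.mem_flatMap, List.mem_map] at ht
    obtain ⟨sa, ha, sb, hb, p, hp, rfl⟩ := ht
    exact h sa ha sb hb p hp
  · intro h sa ha sb hb p hp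
    exact h ((sa, sb), p) (by
      simp only [sepReps, List.mem_flatMap, List.mem_map]
      exact ⟨sa, ha, sb, hb, p, hp, rfl⟩)

theorem primrecRel_unseparated : PrimrecRel Unseparated :=
  PrimrecPred.of_eq (PrimrecPred.forall_mem (R := fun q t => UnseparatedBy t q) primrec_sepReps
    (primrecRel_unseparatedBy.comp .snd .fst)) fun q => (unseparated_iff q.1 q.2).symm

/-- Membership in a finitely generated subgroup of `F_2` is decidable. -/
theorem PrimrecPred.mk_mem {f : α → List Letter} {g : α → List (List Letter)} (hf : Primrec f)
    (hg : Primrec g) : PrimrecPred fun x => mk (f x) ∈ subgroupOfWords (g x) :=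
  PrimrecPred.of_eq (primrecRel_unseparated.comp hf hg) fun x =>
    (mk_mem_subgroupOfWords_iff (f x) (g x)).symm

theorem primrec_invRev : Primrec (invRev : List Letter → List Letter) := by
  have : Primrec fun w : List Letter => w.reverse.map fun x => (x.1, !x.2) := by
    refine Primrec.list_map Primrec.list_reverse ?_
    exact Primrec.pair (Primrec.fst.comp .snd) (Primrec.not.comp (Primrec.snd.comp .snd))
  refine this.of_eq fun w => ?_
  rw [invRev, List.map_reverse]

/-- The word problem in `F_2` is decidable. -/
theorem PrimrecPred.mk_eq {f g : α → List Letter} (hf : Primrec f) (hg : Primrec g) :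
    PrimrecPred fun x => (mk (f x) : F2) = mk (g x) := by
  have h : Primrec fun x => f x ++ invRev (g x) :=
    Primrec.list_append.comp hf (primrec_invRev.comp hg)
  -- The word problem is membership of `f x · (g x)⁻¹` in the subgroup generated by no words.
  refine (PrimrecPred.mk_mem h (.const [])).of_eq fun x => ?_
  have hbot : subgroupOfWords [] = ⊥ := by simp [subgroupOfWords]
  rw [hbot, Subgroup.mem_bot, ← mul_mk, ← inv_mk, mul_inv_eq_one]

/-- Substitution of words for the basis elements. -/
def substWord (p : List Letter × List Letter) (w : List Letter) : List Letter :=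
  w.flatMap fun x => if x.2 = true then (if x.1 = 0 then p.1 else p.2)
    else invRev (if x.1 = 0 then p.1 else p.2)

theorem primrec_substWord : Primrec₂ substWord := by
  refine Primrec.list_flatMap .snd ?_
  have h : Primrec fun q : ((List Letter × List Letter) × List Letter) × Letter =>
      if q.2.1 = 0 then q.1.1.1 else q.1.1.2 :=
    Primrec.ite (Primrec.eq.comp (Primrec.fst.comp .snd) (.const 0))
      (Primrec.fst.comp (Primrec.fst.comp .fst)) (Primrec.snd.comp (Primrec.fst.comp .fst))
  exact Primrec.ite (Primrec.eq.comp (Primrec.snd.comp .snd) (.const true)) h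
    (primrec_invRev.comp h)

end PrimitiveRecursion


/-! ### Stretching factors of the automorphisms in `Ω` -/

section Stretch

/-- An automorphism and its inverse stretch lengths by at most a factor `C`. -/
def IsStretch (C : ℕ) (φ : MulAut F2) : Prop :=
  ∀ x, len (φ x) ≤ C * len x ∧ len (φ⁻¹ x) ≤ C * len x

theorem IsStretch.one : IsStretch 1 1 := fun x => by simp

theorem IsStretch.inv {C : ℕ} {φ : MulAut F2} (h : IsStretch C φ) : IsStretch C φ⁻¹ :=
  fun x => ⟨(h x).2, by rw [inv_inv]; exact (h x).1⟩

theorem IsStretch.mul {C D : ℕ} {φ ψ : MulAut F2} (hφ : IsStretch C φ) (hψ : IsStretch D ψ) :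
    IsStretch (C * D) (φ * ψ) := by
  refine fun x => ⟨?_, ?_⟩
  · rw [MulAut.mul_apply, mul_assoc]
    exact (hφ _).1.trans (Nat.mul_le_mul_left _ (hψ x).1)
  · rw [mul_inv_rev, MulAut.mul_apply, mul_comm C, mul_assoc]
    exact (hψ _).2.trans (Nat.mul_le_mul_left _ (hφ x).2)

theorem IsStretch.pow {C : ℕ} {φ : MulAut F2} (h : IsStretch C φ) (n : ℕ) :
    IsStretch (C ^ n) (φ ^ n) := by
  induction n with
  | zero => exact IsStretch.one
  | succ n ih => rw [pow_succ, pow_succ]; exact ih.mul h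

theorem IsStretch.mono {C D : ℕ} {φ : MulAut F2} (h : IsStretch C φ) (hCD : C ≤ D) :
    IsStretch D φ := fun x =>
  ⟨(h x).1.trans (Nat.mul_le_mul_right _ hCD), (h x).2.trans (Nat.mul_le_mul_right _ hCD)⟩

theorem IsTypeW1.isStretch {β : MulAut F2} (hβ : IsTypeW1 β) : IsStretch 1 β := fun x => by
  rw [hβ.len_apply, hβ.inv.len_apply, one_mul]
  exact ⟨le_rfl, le_rfl⟩

theorem isStretch_chainLetter (t : Bool) : IsStretch 3 (chainLetter true t) := by
  have key : ∀ e, ∀ x, len (chainLetter e t x) ≤ 3 * len x := fun e x => by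
    have := len_chain_le e [t] x
    simp only [chain_cons, chain_nil, mul_one, List.length_singleton, pow_one] at this
    omega
  exact fun x => ⟨key true x, by rw [← chainLetter_not]; exact key _ x⟩

theorem isStretch_sigma : IsStretch 3 sigma := isStretch_chainLetter true

theorem isStretch_tau : IsStretch 3 tau := isStretch_chainLetter false

theorem isStretch_delta (i : Fin 4) : IsStretch 3 (delta i) := by
  have key : ∀ (y : F2), len y = 1 → ∀ x, len (MulAut.conj y x) ≤ 3 * len x := by
    intro y hy x
    refine len_map_le (MulAut.conj y).toMonoidHom (fun i => ?_) x
    change len (MulAut.conj y (of i)) ≤ 3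
    rw [MulAut.conj_apply]
    refine (wt_mul_le _ _ _).trans ?_
    have h1 := wt_mul_le (fun _ => true) y (of i)
    have h2 : len (of i : F2) = 1 := by rw [len_eq_norm, norm_of]
    rw [wt_inv]
    simp only [len] at *
    omega
  rw [delta_eq_conj]
  refine fun x => ⟨key _ (Letter.len_elt _) x, ?_⟩
  rw [← _root_.map_inv]
  exact key _ (by rw [len, wt_inv]; exact Letter.len_elt _) x

theorem isStretch_chainC1 (l : List (ℕ × ℕ)) : IsStretch (3 ^ chainLength l) (chainC1 l) := by
  induction l with
  | nil => exact IsStretch.one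
  | cons p l ih =>
    have := ih.mul ((isStretch_tau.pow p.2).mul (isStretch_sigma.pow p.1))
    rwa [← pow_add, ← pow_add, add_comm] at this

theorem isStretch_chainC2 (l : List (ℕ × ℕ)) : IsStretch (3 ^ chainLength l) (chainC2 l) := by
  induction l with
  | nil => exact IsStretch.one
  | cons p l ih =>
    have := ih.mul ((isStretch_tau.inv.pow p.2).mul (isStretch_sigma.inv.pow p.1))
    rwa [← pow_add, ← pow_add, add_comm] at this

/-- A bound for the stretching factor of the elements of `Omega h`. -/
def stretchBound (h : ℕ) : ℕ := 3 ^ ((2 ^ (4 * h + 4) + 1) * h + (4 * h + 4))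

theorem stretchBound_mono {h k : ℕ} (hk : h ≤ k) : stretchBound h ≤ stretchBound k := by
  rw [stretchBound, stretchBound]
  gcongr <;> norm_num

theorem isStretch_of_mem_Omega {h : ℕ} {ψ : MulAut F2} (hψ : ψ ∈ Omega h) :
    IsStretch (stretchBound h) ψ := by
  obtain ⟨β, δ', ψ', hβ, ⟨w, hw, rfl⟩, ⟨l, hl, hψ'⟩, rfl⟩ := hψ
  have h1 : IsStretch (3 ^ w.length) (w.map delta).prod := by
    clear hw
    induction w with
    | nil => exact IsStretch.one
    | cons i w ih =>
      rw [List.map_cons, List.prod_cons, List.length_cons, pow_succ, mul_comm]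
      exact (isStretch_delta i).mul ih
  have h2 : IsStretch (3 ^ chainLength l) ψ' := by
    rcases hψ' with rfl | rfl
    · exact isStretch_chainC1 l
    · exact isStretch_chainC2 l
  have h3 := (hβ.isStretch.mul h1).mul h2
  rw [one_mul, ← pow_add] at h3
  exact h3.mono (Nat.pow_le_pow_right (by norm_num) (add_le_add hw hl))

end Stretch

/-! ### Finite certificates and refutations -/

section Certificates

/-- The endomorphism that maps the basis to the elements given by two words. -/
def substHom (p : List Letter × List Letter) : F2 →* F2 := FreeGroup.lift ![mk p.1, mk p.2]

theorem substHom_mk (p : List Letter × List Letter) (w : List Letter) :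
    substHom p (mk w) = mk (substWord p w) := by
  induction w with
  | nil => simp [substWord, ← one_eq_mk]
  | cons x w ih =>
    have : substWord p (x :: w) = substWord p [x] ++ substWord p w := by simp [substWord]
    rw [mk_cons_eq, _root_.map_mul, ih, this, ← mul_mk]
    congr 1
    obtain ⟨i, e⟩ := x
    fin_cases i <;> cases e <;>
      simp [substHom, substWord, elt_true, elt_false, inv_mk]

/-- Four words that describe an automorphism and its inverse. -/
abbrev AutWords : Type := (List Letter × List Letter) × (List Letter × List Letter)

/-- The endomorphisms given by the words are inverse to each other. -/
def IsAutWords (t : AutWords) : Prop :=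
  ∀ x ∈ allLetters, (mk (substWord t.1 (substWord t.2 [x])) : F2) = mk [x] ∧
    (mk (substWord t.2 (substWord t.1 [x])) : F2) = mk [x]

theorem IsAutWords.exists_aut {t : AutWords} (ht : IsAutWords t) :
    ∃ φ : MulAut F2, ∀ w, φ (mk w) = mk (substWord t.1 w) := by
  have h1 : (substHom t.1).comp (substHom t.2) = MonoidHom.id _ := by
    ext i
    have := (ht (i, true) (mem_allLetters _)).1
    rwa [← substHom_mk, ← substHom_mk] at this
  have h2 : (substHom t.2).comp (substHom t.1) = MonoidHom.id _ := by
    ext i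
    have := (ht (i, true) (mem_allLetters _)).2
    rwa [← substHom_mk, ← substHom_mk] at this
  exact ⟨MonoidHom.toMulEquiv _ _ h2 h1, fun w => substHom_mk _ _⟩

/-- The words that describe a given automorphism. -/
def autWords (φ : MulAut F2) : AutWords :=
  (((φ (of 0)).toWord, (φ (of 1)).toWord), ((φ⁻¹ (of 0)).toWord, (φ⁻¹ (of 1)).toWord))

theorem mk_substWord_autWords (φ : MulAut F2) (w : List Letter) :
    (mk (substWord (autWords φ).1 w) : F2) = φ (mk w) ∧
      (mk (substWord (autWords φ).2 w) : F2) = φ⁻¹ (mk w) := by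
  have key : ∀ ψ : MulAut F2, substHom ((ψ (of 0)).toWord, (ψ (of 1)).toWord) =
      ψ.toMonoidHom := by
    intro ψ
    ext i
    fin_cases i <;> simp [substHom, mk_toWord]
  rw [← substHom_mk, ← substHom_mk, autWords, key, key]
  exact ⟨rfl, rfl⟩

theorem isAutWords_autWords (φ : MulAut F2) : IsAutWords (autWords φ) := by
  intro x _
  constructor
  · rw [(mk_substWord_autWords φ _).1, (mk_substWord_autWords φ _).2, MulAut.apply_inv_self]
  · rw [(mk_substWord_autWords φ _).2, (mk_substWord_autWords φ _).1, MulAut.inv_apply_self]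

theorem fixed_conj_tau_iff (α : MulAut F2) (g : F2) : (α * tau * α⁻¹) g = g ↔
    g ∈ Subgroup.closure {α (of 0), α (of 1 * of 0 * (of 1)⁻¹)} := by
  have h := tau_zpow_fixed_iff one_ne_zero (α⁻¹ g)
  rw [zpow_one] at h
  have h1 : (α * tau * α⁻¹) g = g ↔ tau (α⁻¹ g) = α⁻¹ g := by
    rw [MulAut.mul_apply, MulAut.mul_apply]
    constructor
    · intro h
      conv_rhs => rw [← h]
      rw [MulAut.inv_apply_self]
    · intro h
      rw [h, MulAut.apply_inv_self]
  have h2 : Subgroup.closure {α (of 0), α (of 1 * of 0 * (of 1)⁻¹)} =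
      (Subgroup.closure {of 0, of 1 * of 0 * (of 1)⁻¹}).map α.toMonoidHom := by
    rw [MonoidHom.map_closure, Set.image_pair]
    rfl
  rw [h1, h, h2, Subgroup.mem_map]
  constructor
  · exact fun h => ⟨_, h, MulAut.apply_inv_self _ _ _⟩
  · rintro ⟨x, hx, rfl⟩
    have : α⁻¹ (α.toMonoidHom x) = x := MulAut.inv_apply_self _ _ _
    rwa [this]

/-- All words in the list are trivial. -/
def IsTrivialList (L : List (List Letter)) : Prop := ∀ u ∈ L, (mk u : F2) = mk []

/-- The words commute, one of them is nontrivial, and every short word that commutes with all of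
them belongs to the subgroup. -/
def IsRootClosedList (L : List (List Letter)) : Prop :=
  (∃ u ∈ L, ¬ (mk u : F2) = mk []) ∧
  (∀ u ∈ L, ∀ v ∈ L, (mk (u ++ v) : F2) = mk (v ++ u)) ∧
  ∀ c ∈ listsUpTo allLetters L.flatten.length,
    (∀ u ∈ L, (mk (c ++ u) : F2) = mk (u ++ c)) → mk c ∈ subgroupOfWords L

/-- The subgroup is everything. -/
def IsFullList (L : List (List Letter)) : Prop :=
  mk [(0, true)] ∈ subgroupOfWords L ∧ mk [(1, true)] ∈ subgroupOfWords L

/-- The subgroup is the image of the fixed subgroup of `τ`. -/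
def IsTauImage (L : List (List Letter)) (t : AutWords) : Prop :=
  mk (substWord t.1 [(0, true)]) ∈ subgroupOfWords L ∧
  mk (substWord t.1 [(1, true), (0, true), (1, false)]) ∈ subgroupOfWords L ∧
  ∀ u ∈ L, mk u ∈ subgroupOfWords
    [substWord t.1 [(0, true)], substWord t.1 [(1, true), (0, true), (1, false)]]

theorem length_le_length_flatten {α : Type*} {L : List (List α)} {u : List α} (hu : u ∈ L) :
    u.length ≤ L.flatten.length := by
  induction L with
  | nil => simp at hu
  | cons v L ih =>
    rw [List.flatten_cons, List.length_append]
    rcases List.mem_cons.1 hu with rfl | hu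
    · omega
    · have := ih hu; omega

theorem subgroupOfWords_le {L : List (List Letter)} {K : Subgroup F2}
    (h : ∀ u ∈ L, mk u ∈ K) : subgroupOfWords L ≤ K := by
  rw [subgroupOfWords, Subgroup.closure_le]
  rintro _ ⟨u, hu, rfl⟩
  exact h u hu

theorem len_mk_le (w : List Letter) : len (mk w : F2) ≤ w.length := by
  rw [len_eq_norm]; exact norm_mk_le

theorem len_le_len_zpow {α : Type*} [DecidableEq α] (c : FreeGroup α) {j : ℤ} (hj : j ≠ 0) :
    len c ≤ len (c ^ j) := by
  obtain ⟨n, rfl | rfl⟩ := Int.eq_nat_or_neg j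
  · obtain ⟨m, rfl⟩ := Nat.exists_eq_succ_of_ne_zero (n := n) (by rintro rfl; simp at hj)
    rw [zpow_natCast]
    exact len_le_len_pow c m
  · obtain ⟨m, rfl⟩ := Nat.exists_eq_succ_of_ne_zero (n := n) (by rintro rfl; simp at hj)
    rw [zpow_neg, len, len, wt_inv, zpow_natCast]
    exact len_le_len_pow c m

theorem IsRootClosedList.exists_aut {L : List (List Letter)} (h : IsRootClosedList L) :
    ∃ φ, IsFixedPointGroup (subgroupOfWords L) φ := by
  obtain ⟨⟨r, hr, hr1⟩, hcomm, hroot⟩ := h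
  rw [← one_eq_mk] at hr1
  have hcomm' : ∀ u ∈ L, (mk u : F2) * mk r = mk r * mk u := fun u hu => by
    rw [mul_mk, mul_mk]; exact hcomm u hu r hr
  refine ⟨MulAut.conj (mk r), fun g => ?_⟩
  rw [MulAut.conj_apply, mul_inv_eq_iff_eq_mul]
  constructor
  · intro hg
    induction hg using Subgroup.closure_induction with
    | mem x hx => obtain ⟨u, hu, rfl⟩ := hx; exact (hcomm' u hu).symm
    | one => simp
    | mul x y _ _ hx hy => rw [← mul_assoc, hx, mul_assoc, hy, mul_assoc]
    | inv x _ hx => exact (Commute.inv_right (show Commute (mk r) x from hx)).eq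
  · intro hg
    -- The common root `c` of `g` and `r` is no longer than `r`, and it commutes with every
    -- generator because each generator centralises `r`. So it is among the short words tested, and
    -- `g` is one of its powers.
    obtain ⟨c, i, j, hgc, hrc⟩ := exists_zpow_of_commute hg.symm
    have hj : j ≠ 0 := by rintro rfl; rw [zpow_zero] at hrc; exact hr1 hrc
    rw [hgc]
    refine zpow_mem ?_ i
    rw [← mk_toWord (x := c)]
    have hcr : c * mk r = mk r * c := by rw [hrc]; group
    refine hroot _ (mem_listsUpTo_allLetters.2 ?_) fun u hu => ?_
    · refine le_trans ?_ (length_le_length_flatten hr)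
      refine le_trans ?_ (len_mk_le r)
      rw [hrc]
      refine le_trans ?_ (len_le_len_zpow c hj)
      rw [len_eq_norm, FreeGroup.norm]
    · rw [← mul_mk, ← mul_mk, mk_toWord]
      have h1 : MulAut.conj (mk u) c = c := by
        refine map_eq_of_commute hr1 ?_ hcr
        rw [MulAut.conj_apply, mul_inv_eq_iff_eq_mul]
        exact hcomm' u hu
      rw [MulAut.conj_apply, mul_inv_eq_iff_eq_mul] at h1
      exact h1.symm

/-- A list of words generates a fixed point group if and only if there is a certificate. -/
theorem exists_isFixedPointGroup_iff (L : List (List Letter)) :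
    (∃ φ, IsFixedPointGroup (subgroupOfWords L) φ) ↔ ∃ t : AutWords,
      IsTrivialList L ∨ IsRootClosedList L ∨ IsFullList L ∨ (IsAutWords t ∧ IsTauImage L t) := by
  constructor
  · rintro ⟨φ, hφ⟩
    have hfix : ∀ u ∈ L, φ (mk u) = mk u := fun u hu => (hφ _).1 (mk_mem_subgroupOfWords hu)
    by_cases h1 : IsTrivialList L
    · exact ⟨autWords 1, Or.inl h1⟩
    simp only [IsTrivialList, not_forall] at h1
    obtain ⟨r, hr, hr1⟩ := h1
    -- The cases follow the classification: a commutative nontrivial fixed subgroup contains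
    -- everything that commutes with its elements, and a noncommutative one is the whole group or an
    -- image of the fixed subgroup of `τ`.
    by_cases h2 : ∀ u ∈ L, ∀ v ∈ L, (mk (u ++ v) : F2) = mk (v ++ u)
    · refine ⟨autWords 1, Or.inr (Or.inl ⟨⟨r, hr, hr1⟩, h2, fun c _ hc => ?_⟩)⟩
      rw [hφ]
      refine map_eq_of_commute (by rwa [one_eq_mk]) (hfix r hr) ?_
      rw [mul_mk, mul_mk]
      exact hc r hr
    simp only [not_forall] at h2
    obtain ⟨u, hu, v, hv, huv⟩ := h2
    rcases fixClassified φ with hc | rfl | ⟨α, hα⟩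
    · refine absurd ?_ huv
      rw [← mul_mk, ← mul_mk]
      exact hc _ _ (hfix u hu) (hfix v hv)
    · exact ⟨autWords 1, Or.inr (Or.inr (Or.inl ⟨(hφ _).2 rfl, (hφ _).2 rfl⟩))⟩
    · refine ⟨autWords α, Or.inr (Or.inr (Or.inr ⟨isAutWords_autWords α, ?_⟩))⟩
      have e1 : (mk [(1, true), (0, true), (1, false)] : F2) = of 1 * of 0 * (of 1)⁻¹ := rfl
      have e2 : (mk [(0, true)] : F2) = of 0 := rfl
      have hmem : ∀ g, g ∈ subgroupOfWords L ↔
          g ∈ Subgroup.closure {α (of 0), α (of 1 * of 0 * (of 1)⁻¹)} := fun g => by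
        rw [← fixed_conj_tau_iff, ← hα, hφ]
      rw [IsTauImage]
      simp only [(mk_substWord_autWords α _).1, e1, e2, hmem]
      refine ⟨Subgroup.subset_closure (by simp), Subgroup.subset_closure (by simp),
        fun w hw => ?_⟩
      have := (hmem _).1 (mk_mem_subgroupOfWords hw)
      refine (Subgroup.closure_le _).2 ?_ this
      rintro x (rfl | rfl)
      · have h3 := mk_mem_subgroupOfWords (u := substWord (autWords α).1 [(0, true)])
          (L := [substWord (autWords α).1 [(0, true)],
            substWord (autWords α).1 [(1, true), (0, true), (1, false)]]) (by simp)
        rwa [(mk_substWord_autWords α _).1, e2] at h3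
      · have h3 := mk_mem_subgroupOfWords
          (u := substWord (autWords α).1 [(1, true), (0, true), (1, false)])
          (L := [substWord (autWords α).1 [(0, true)],
            substWord (autWords α).1 [(1, true), (0, true), (1, false)]]) (by simp)
        rwa [(mk_substWord_autWords α _).1, e1] at h3
  · rintro ⟨t, h | h | h | ⟨ht, h1, h2, h3⟩⟩
    · refine ⟨invA * swapAut * sigma, fun g => ⟨fun hg => ?_, fun hg => ?_⟩⟩
      · have : g = 1 := by
          have hle : subgroupOfWords L ≤ ⊥ := subgroupOfWords_le fun u hu => by
            rw [h u hu, ← one_eq_mk]; exact one_mem _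
          exact Subgroup.mem_bot.1 (hle hg)
        rw [this, _root_.map_one]
      · rw [eq_one_of_invA_swapAut_sigma hg]
        exact one_mem _
    · exact h.exists_aut
    · refine ⟨1, fun g => iff_of_true ?_ rfl⟩
      induction g using FreeGroup.induction_on with
      | C1 => exact one_mem _
      | of i => fin_cases i; exacts [h.1, h.2]
      | inv_of i hi => exact inv_mem hi
      | mul x y hx hy => exact mul_mem hx hy
    · obtain ⟨α, hα⟩ := ht.exists_aut
      have e1 : (mk (substWord t.1 [(1, true), (0, true), (1, false)]) : F2) =
        α (of 1 * of 0 * (of 1)⁻¹) := (hα _).symm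
      have e2 : (mk (substWord t.1 [(0, true)]) : F2) = α (of 0) := (hα _).symm
      rw [e1] at h2
      rw [e2] at h1
      refine ⟨α * tau * α⁻¹, fun g => ?_⟩
      rw [fixed_conj_tau_iff]
      constructor
      · intro hg
        refine subgroupOfWords_le (fun u hu => ?_) hg
        refine subgroupOfWords_le (fun v hv => ?_) (h3 u hu)
        simp only [List.mem_cons, List.not_mem_nil, or_false] at hv
        rcases hv with rfl | rfl
        · rw [e2]; exact Subgroup.subset_closure (by simp)
        · rw [e1]; exact Subgroup.subset_closure (by simp)
      · intro hg
        refine (Subgroup.closure_le _).2 ?_ hg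
        rintro x (rfl | rfl)
        exacts [h1, h2]

/-- The words that may describe the automorphisms considered for a list of generators. -/
def autCandidates (L : List (List Letter)) : List (List Letter) :=
  listsUpTo allLetters (stretchBound L.flatten.length)

/-- Words of length at most `N` show that an automorphism does not have the given fixed point
group. -/
def IsRefuted (L : List (List Letter)) (N : ℕ) (t : AutWords) : Prop :=
  (∃ u ∈ L, ¬ (mk (substWord t.1 u) : F2) = mk u) ∨
    ∃ g ∈ listsUpTo allLetters N, (mk (substWord t.1 g) : F2) = mk g ∧
      ¬ mk g ∈ subgroupOfWords L

theorem IsRefuted.mono {L : List (List Letter)} {M N : ℕ} {t : AutWords} (h : IsRefuted L M t)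
    (hMN : M ≤ N) : IsRefuted L N t := by
  refine h.imp_right ?_
  rintro ⟨g, hg, h⟩
  rw [mem_listsUpTo_allLetters] at hg
  exact ⟨g, mem_listsUpTo_allLetters.2 (hg.trans hMN), h⟩

theorem exists_uniform {α : Type*} {P : ℕ → α → Prop} (hP : ∀ m n x, m ≤ n → P m x → P n x)
    (l : List α) (h : ∀ x ∈ l, ∃ n, P n x) : ∃ n, ∀ x ∈ l, P n x := by
  induction l with
  | nil => exact ⟨0, by simp⟩
  | cons y l ih =>
    obtain ⟨n, hn⟩ := ih fun x hx => h x (by simp [hx])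
    obtain ⟨m, hm⟩ := h y (by simp)
    refine ⟨m + n, fun x hx => ?_⟩
    rcases List.mem_cons.1 hx with rfl | hx
    · exact hP m _ _ (by omega) hm
    · exact hP n _ _ (by omega) (hn x hx)

/-- All pairs with entries in a list. -/
def pairsOf {α : Type*} (l : List α) : List (α × α) := l.flatMap fun x => l.map fun y => (x, y)

theorem mem_pairsOf {α : Type*} {l : List α} {p : α × α} : p ∈ pairsOf l ↔ p.1 ∈ l ∧ p.2 ∈ l := by
  obtain ⟨x, y⟩ := p
  simp [pairsOf]

/-- A given automorphism fails either by moving a generator or by fixing some word outside the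
subgroup; a single word witnesses each failure. -/
theorem exists_refutation {L : List (List Letter)} {t : AutWords} (ht : IsAutWords t)
    (h : ∀ φ, ¬ IsFixedPointGroup (subgroupOfWords L) φ) : ∃ N, IsRefuted L N t := by
  obtain ⟨φ, hφ⟩ := ht.exists_aut
  by_cases h1 : ∀ u ∈ L, (mk (substWord t.1 u) : F2) = mk u
  · have h2 : ∃ g, φ g = g ∧ g ∉ subgroupOfWords L := by
      by_contra hc
      push Not at hc
      refine h φ fun g => ⟨fun hg => ?_, hc g⟩
      have hle : subgroupOfWords L ≤
          { carrier := {x | φ x = x}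
            one_mem' := _root_.map_one φ
            mul_mem' := fun {x y} hx hy => by
              change φ (x * y) = x * y
              rw [_root_.map_mul, hx, hy]
            inv_mem' := fun {x} hx => by
              change φ x⁻¹ = x⁻¹
              rw [_root_.map_inv, hx] } :=
        subgroupOfWords_le fun u hu => (hφ u).trans (h1 u hu)
      exact hle hg
    obtain ⟨g, hg, hgL⟩ := h2
    refine ⟨g.toWord.length, Or.inr ⟨g.toWord, mem_listsUpTo_allLetters.2 le_rfl, ?_, ?_⟩⟩
    · rw [← hφ, mk_toWord, hg]
    · rwa [mk_toWord]
  · simp only [not_forall] at h1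
    obtain ⟨u, hu, h1⟩ := h1
    exact ⟨0, Or.inl ⟨u, hu, h1⟩⟩

/-- The first part of the theorem is what makes this work: a fixed point group is realised by some
`ψ` in `Ω`, and the stretching bound puts the words of `ψ` and `ψ⁻¹` on the basis into a finite
list. Refuting all candidates in that list is then enough, and one bound `N` serves for all of them.
-/
theorem not_exists_isFixedPointGroup_iff (L : List (List Letter)) :
    (¬ ∃ φ, IsFixedPointGroup (subgroupOfWords L) φ) ↔ ∃ N : ℕ,
      ∀ t ∈ pairsOf (pairsOf (autCandidates L)), IsAutWords t → IsRefuted L N t := by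
  constructor
  · intro h
    refine exists_uniform (P := fun N t => IsAutWords t → IsRefuted L N t)
      (fun m n t hmn h ht => (h ht).mono hmn) _ fun t _ => ?_
    by_cases ht : IsAutWords t
    · obtain ⟨N, hN⟩ := exists_refutation ht (not_exists.1 h)
      exact ⟨N, fun _ => hN⟩
    · exact ⟨0, fun h => absurd h ht⟩
  · rintro ⟨N, hN⟩ ⟨φ, hφ⟩
    obtain ⟨ψ, hψΩ, hψ⟩ := exists_mem_Omega (fun i : Fin L.length => (mk (L.get i) : F2))
      (subgroupOfWords L) (by
        rw [subgroupOfWords]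
        congr 1
        ext g
        constructor
        · rintro ⟨w, hw, rfl⟩
          obtain ⟨i, rfl⟩ := List.get_of_mem hw
          exact ⟨i, rfl⟩
        · rintro ⟨i, rfl⟩
          exact ⟨_, List.get_mem _ _, rfl⟩) hφ
    have hmax : maxLength (fun i : Fin L.length => (mk (L.get i) : F2)) ≤ L.flatten.length :=
      Finset.sup_le fun i _ => norm_mk_le.trans (length_le_length_flatten (List.get_mem L i))
    have hs := (isStretch_of_mem_Omega hψΩ).mono (stretchBound_mono hmax)
    have hlen : ∀ i : Fin 2, (ψ (of i)).toWord ∈ autCandidates L ∧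
        (ψ⁻¹ (of i)).toWord ∈ autCandidates L := by
      intro i
      have h1 : len (of i : F2) = 1 := by rw [len_eq_norm, norm_of]
      have h2 := hs (of i)
      rw [h1, mul_one, len_eq_norm, len_eq_norm] at h2
      exact ⟨mem_listsUpTo_allLetters.2 h2.1, mem_listsUpTo_allLetters.2 h2.2⟩
    have hmem : autWords ψ ∈ pairsOf (pairsOf (autCandidates L)) := by
      simp only [mem_pairsOf, autWords]
      exact ⟨⟨(hlen 0).1, (hlen 1).1⟩, (hlen 0).2, (hlen 1).2⟩
    rcases hN _ hmem (isAutWords_autWords ψ) with ⟨u, hu, h⟩ | ⟨g, -, h1, h2⟩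
    · rw [(mk_substWord_autWords ψ u).1] at h
      exact h ((hψ _).1 (mk_mem_subgroupOfWords hu))
    · rw [(mk_substWord_autWords ψ g).1] at h1
      exact h2 ((hψ _).2 h1)

end Certificates


/-! ### Recursive enumerability of the predicate and of its complement -/

section Decision

variable {α : Type*} [Primcodable α]

theorem primrec_stretchBound : Primrec stretchBound := by
  have hpow : ∀ b : ℕ, Primrec fun n => b ^ n := fun b => by
    have : Primrec₂ fun (_ x : ℕ) => x * b := Primrec.nat_mul.comp .snd (.const b)
    refine (Primrec.nat_rec₁ 1 this).of_eq fun n => ?_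
    induction n with
    | zero => rfl
    | succ n ih => rw [pow_succ, ← ih]
  have hlin : Primrec fun h : ℕ => 4 * h + 4 :=
    Primrec.nat_add.comp (Primrec.nat_mul.comp (.const 4) .id) (.const 4)
  exact (hpow 3).comp (Primrec.nat_add.comp (Primrec.nat_mul.comp
    (Primrec.succ.comp ((hpow 2).comp hlin)) .id) hlin)

theorem primrecPred_isTrivialList : PrimrecPred IsTrivialList :=
  PrimrecPred.forall_mem (f := fun L : List (List Letter) => L)
    (R := fun _ u => (mk u : F2) = mk []) .id (PrimrecPred.mk_eq .snd (.const []))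

theorem primrecPred_isRootClosedList : PrimrecPred IsRootClosedList := by
  have hcomm : PrimrecPred fun p : List Letter × List Letter =>
      (mk (p.1 ++ p.2) : F2) = mk (p.2 ++ p.1) :=
    PrimrecPred.mk_eq (Primrec.list_append.comp .fst .snd) (Primrec.list_append.comp .snd .fst)
  refine PrimrecPred.and ?_ (PrimrecPred.and ?_ ?_)
  · exact PrimrecPred.exists_mem (f := fun L : List (List Letter) => L)
      (R := fun _ u => ¬ (mk u : F2) = mk []) .id (PrimrecPred.mk_eq .snd (.const [])).not
  · have h : PrimrecPred fun p : List (List Letter) × List Letter =>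
        ∀ v ∈ p.1, (mk (p.2 ++ v) : F2) = mk (v ++ p.2) :=
      PrimrecPred.forall_mem (f := fun p : List (List Letter) × List Letter => p.1)
        (R := fun p v => (mk (p.2 ++ v) : F2) = mk (v ++ p.2)) .fst
        (hcomm.comp (Primrec.pair (Primrec.snd.comp .fst) .snd))
    exact PrimrecPred.forall_mem (f := fun L : List (List Letter) => L)
      (R := fun L u => ∀ v ∈ L, (mk (u ++ v) : F2) = mk (v ++ u)) .id h
  · have h : PrimrecPred fun p : List (List Letter) × List Letter =>
        ∀ v ∈ p.1, (mk (p.2 ++ v) : F2) = mk (v ++ p.2) :=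
      PrimrecPred.forall_mem (f := fun p : List (List Letter) × List Letter => p.1)
        (R := fun p v => (mk (p.2 ++ v) : F2) = mk (v ++ p.2)) .fst
        (hcomm.comp (Primrec.pair (Primrec.snd.comp .fst) .snd))
    have hl : Primrec fun L : List (List Letter) => listsUpTo allLetters L.flatten.length :=
      primrec_listsUpTo.comp (.const _) (Primrec.list_length.comp Primrec.list_flatten)
    exact PrimrecPred.forall_mem (R := fun L c => (∀ u ∈ L, (mk (c ++ u) : F2) = mk (u ++ c)) →
      mk c ∈ subgroupOfWords L) hl (PrimrecPred.imp h (PrimrecPred.mk_mem .snd .fst))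

theorem primrecPred_isFullList : PrimrecPred IsFullList :=
  PrimrecPred.and (PrimrecPred.mk_mem (.const _) .id) (PrimrecPred.mk_mem (.const _) .id)

theorem primrecPred_isAutWords : PrimrecPred IsAutWords := by
  have hs : ∀ {f : AutWords × Letter → List Letter × List Letter}
      {g : AutWords × Letter → List Letter}, Primrec f → Primrec g →
      Primrec fun p => substWord (f p) (g p) := fun hf hg => primrec_substWord.comp hf hg
  have h1 : Primrec fun p : AutWords × Letter => p.1.1 := Primrec.fst.comp .fst
  have h2 : Primrec fun p : AutWords × Letter => p.1.2 := Primrec.snd.comp .fst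
  have hx : Primrec fun p : AutWords × Letter => [p.2] := Primrec.list_cons.comp .snd (.const [])
  exact PrimrecPred.forall_mem (f := fun _ : AutWords => allLetters)
    (R := fun t x => (mk (substWord t.1 (substWord t.2 [x])) : F2) = mk [x] ∧
      (mk (substWord t.2 (substWord t.1 [x])) : F2) = mk [x]) (.const _)
    (PrimrecPred.and (PrimrecPred.mk_eq (hs h1 (hs h2 hx)) hx)
      (PrimrecPred.mk_eq (hs h2 (hs h1 hx)) hx))

theorem primrecRel_isTauImage : PrimrecRel IsTauImage := by
  have hs : ∀ w : List Letter, Primrec fun p : List (List Letter) × AutWords =>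
      substWord p.2.1 w := fun w => primrec_substWord.comp (Primrec.fst.comp .snd) (.const w)
  have hl : Primrec fun p : List (List Letter) × AutWords =>
      [substWord p.2.1 [(0, true)], substWord p.2.1 [(1, true), (0, true), (1, false)]] :=
    Primrec.list_cons.comp (hs _) (Primrec.list_cons.comp (hs _) (.const []))
  refine PrimrecPred.and (PrimrecPred.mk_mem (hs _) .fst)
    (PrimrecPred.and (PrimrecPred.mk_mem (hs _) .fst) ?_)
  exact PrimrecPred.forall_mem (f := fun p : List (List Letter) × AutWords => p.1)
    (R := fun p u => mk u ∈ subgroupOfWords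
      [substWord p.2.1 [(0, true)], substWord p.2.1 [(1, true), (0, true), (1, false)]])
    .fst (PrimrecPred.mk_mem .snd (hl.comp .fst))

theorem rePred_isFixedPointGroup : REPred fun L : List (List Letter) =>
    ∃ φ : MulAut F2, IsFixedPointGroup (subgroupOfWords L) φ := by
  refine (REPred.exists_of_primrec (R := fun (L : List (List Letter)) (t : AutWords) =>
    IsTrivialList L ∨ IsRootClosedList L ∨ IsFullList L ∨ (IsAutWords t ∧ IsTauImage L t))
    ?_).of_eq fun L => (exists_isFixedPointGroup_iff L).symm
  exact (primrecPred_isTrivialList.comp .fst).or ((primrecPred_isRootClosedList.comp .fst).or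
    ((primrecPred_isFullList.comp .fst).or
      ((primrecPred_isAutWords.comp .snd).and primrecRel_isTauImage)))

theorem primrec_pairsOf : Primrec (pairsOf : List α → List (α × α)) := by
  refine Primrec.list_flatMap .id (Primrec.list_map .fst ?_)
  exact Primrec.pair (Primrec.snd.comp .fst) .snd

theorem primrecPred_isRefuted : PrimrecPred fun p : (List (List Letter) × ℕ) × AutWords =>
    IsRefuted p.1.1 p.1.2 p.2 := by
  have hs : Primrec fun q : ((List (List Letter) × ℕ) × AutWords) × List Letter =>
      substWord q.1.2.1 q.2 :=
    primrec_substWord.comp (Primrec.fst.comp (Primrec.snd.comp .fst)) .snd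
  have heq : PrimrecPred fun q : ((List (List Letter) × ℕ) × AutWords) × List Letter =>
      (mk (substWord q.1.2.1 q.2) : F2) = mk q.2 := PrimrecPred.mk_eq hs .snd
  refine PrimrecPred.or ?_ ?_
  · exact PrimrecPred.exists_mem
      (f := fun p : (List (List Letter) × ℕ) × AutWords => p.1.1)
      (R := fun p u => ¬ (mk (substWord p.2.1 u) : F2) = mk u) (Primrec.fst.comp .fst) heq.not
  · exact PrimrecPred.exists_mem
      (f := fun p : (List (List Letter) × ℕ) × AutWords => listsUpTo allLetters p.1.2)
      (R := fun p g => (mk (substWord p.2.1 g) : F2) = mk g ∧ ¬ mk g ∈ subgroupOfWords p.1.1)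
      (primrec_listsUpTo.comp (.const _) (Primrec.snd.comp .fst))
      (heq.and (PrimrecPred.mk_mem .snd (Primrec.fst.comp (Primrec.fst.comp .fst))).not)

theorem rePred_not_isFixedPointGroup : REPred fun L : List (List Letter) =>
    ¬ ∃ φ : MulAut F2, IsFixedPointGroup (subgroupOfWords L) φ := by
  refine (REPred.exists_of_primrec (R := fun (L : List (List Letter)) (N : ℕ) =>
    ∀ t ∈ pairsOf (pairsOf (autCandidates L)), IsAutWords t → IsRefuted L N t)
    ?_).of_eq fun L => (not_exists_isFixedPointGroup_iff L).symm
  have hc : Primrec autCandidates := primrec_listsUpTo.comp (.const _)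
    (primrec_stretchBound.comp (Primrec.list_length.comp Primrec.list_flatten))
  exact PrimrecPred.forall_mem
    (f := fun p : List (List Letter) × ℕ => pairsOf (pairsOf (autCandidates p.1)))
    (R := fun p t => IsAutWords t → IsRefuted p.1 p.2 t)
    (primrec_pairsOf.comp (primrec_pairsOf.comp (hc.comp .fst)))
    (PrimrecPred.imp (primrecPred_isAutWords.comp .snd) primrecPred_isRefuted)

end Decision

theorem mainTheorem4 :
    (∀ (k : ℕ) (u : Fin k → F2) (H : Subgroup F2), H = Subgroup.closure (Set.range u) →
      (∃ φ : MulAut F2, IsFixedPointGroup H φ) →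
        ∃ ψ ∈ Omega (maxLength u), IsFixedPointGroup H ψ) ∧
    ComputablePred (fun L : List (List Letter) =>
      ∃ φ : MulAut F2, IsFixedPointGroup (subgroupOfWords L) φ) :=
  ⟨fun _ u H hH ⟨_, hφ⟩ => exists_mem_Omega u H hH hφ,
    -- Post's theorem: enumerate certificates and refutations in parallel.
    ComputablePred.computable_iff_re_compl_re'.2
      ⟨rePred_isFixedPointGroup, rePred_not_isFixedPointGroup⟩⟩
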